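/- Let $d\ge 1$, $0<\gamma<1/4$, $\epsilon>0$. Let $\mu_1>\dots>\mu_d>0$ with $\sum_i\mu_i=1$ and let $\delta=\min_{1\le i\le d}(\mu_i-\mu_{i+1})$, $\mu_{d+1}:=0$. For $\theta=(u,\zeta)$ with $u\in\mathbb R^{d-1}$, $\zeta\in\mathbb C^{d(d-1)/2}$ and $n\ge1$ put $\mu_i^{u,n}=\mu_i+u_i/\sqrt n$ $(i<d)$, $\mu_d^{u,n}=\mu_d-\sum_{i<d}u_i/\sqrt n$, $$\rho_{\theta/\sqrt n}=U(\zeta/\sqrt n)\,\mathrm{Diag}(\mu_1^{u,n},\dots,\mu_d^{u,n})\,U(\zeta/\sqrt n)^*,\qquad U(\zeta)=\exp\Big[i\sum_{j<k}\frac{\mathrm{Re}(\zeta_{jk})T_{jk}+\mathrm{Im}(\zeta_{jk})T_{kj}}{\sqrt{\mu_j-\mu_k}}\Big],$$ where $T_{jk}=iE_{jk}-iE_{kj}$ and $T_{kj}=E_{jk}+E_{kj}$ for $j<k$. For a Young diagram $\lambda$ with $n$ boxes and at most $d$ rows let $p_\lambda^{\theta,n}=\mathrm{Tr}(\rho_{\theta/\sqrt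 n}^{\otimes n}P_\lambda)$, where $P_\lambda$ is the orthogonal projection onto the block $\mathcal H_\lambda\otimes\mathcal K_\lambda$ in the Schur--Weyl decomposition of $(\mathbb C^d)^{\otimes n}$. Let $\mathcal N(u,V(\mu))$ be the Gaussian density on $\mathbb R^{d-1}$ with mean $u$ and covariance $V(\mu)_{ij}=\delta_{ij}\mu_i-\mu_i\mu_j$, and let $\tau^n_\lambda$ be the density on $\mathbb R^{d-1}$ equal to $n^{(d-1)/2}$ on $\{x:|n^{1/2}x_i+n\mu_i-\lambda_i|\le 1/2,\ 1\le i\le d-1\}$ and $0$ elsewhere. Let $\sigma^n$ map $x\in\mathbb R^{d-1}$ to the Young diagram $\lambda_x$ with $n$ boxes, at most $d$ rows and $|n^{1/2}x_i+n\mu_i-(\lambda_x)_i|<1/2$ for $1\le i\le d-1$, if there is one, and to an arbitrary fixed diagram otherwise; let $\sigma^n\mathcal N(u,V(\mu))$ be the image distribution. Then there is a constant $C=C(d,\gamma,\epsilon)$ such that for all such $\mu$, all $n\ge 1$, all $u$ with $\|u\|_\infty\le n^\gamma$ for which $\rho_{\theta/\sqrt n}$ is a state (that is, all $\mu_i^{u,n}\ge0$),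 and all $\zeta$, $$\Big\|\mathcal N(u,V(\mu))-\sum_\lambda p_\lambda^{\theta,n}\tau_\lambda^n\Big\|_{L^1}\le \frac C\delta\big(n^{-1/2+\epsilon}+n^{-1/4+\gamma}\big),$$ $$\big\|\sigma^n\mathcal N(u,V(\mu))-p^{\theta,n}\big\|_{\ell^1}\le \frac C\delta\big(n^{-1/2+\epsilon}+n^{-1/4+\gamma}\big).$$ Moreover, for every $\delta_0>0$ there is $N$ such that for $n\ge N$ and every $\mu$ with $\delta\ge\delta_0$, all $u$ with $\|u\|_\infty\le n^\gamma$ satisfy $\mu_i^{u,n}\ge0$ for all $i$, so that for such $n$ the bounds hold uniformly over $\|u\|_\infty\le n^\gamma$. -/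

import Mathlib

open MeasureTheory

noncomputable section

/- Throughout `d = r + 1` is the dimension of one system, rows and basis vectors are indexed by
`Fin (r + 1)`, and `u` lives in `ℝ ^ r = ℝ ^ (d - 1)`. -/

/-- The separation `inf_{1 ≤ i ≤ d} (μ_i - μ_{i+1})`, with the convention `μ_{d+1} = 0`. -/
def gap {r : ℕ} (μ : Fin (r + 1) → ℝ) : ℝ :=
  ⨅ i : Fin (r + 1), (μ i - Fin.snoc (α := fun _ : Fin (r + 2) => ℝ) μ 0 i.succ)

/-- `(μ_1 + v_1, …, μ_{d-1} + v_{d-1}, μ_d - ∑ v_i)`. -/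
def perturb {r : ℕ} (μ : Fin (r + 1) → ℝ) (v : Fin r → ℝ) : Fin (r + 1) → ℝ :=
  Fin.snoc (α := fun _ : Fin (r + 1) => ℝ)
    (fun i : Fin r => μ i.castSucc + v i) (μ (Fin.last r) - ∑ i, v i)

/-- The eigenvalues `μ_i^{u,n}` of a single system at local parameter `u / √n`. -/
def localSpectrum {r : ℕ} (μ : Fin (r + 1) → ℝ) (n : ℕ) (u : Fin r → ℝ) : Fin (r + 1) → ℝ :=
  perturb μ (fun i => u i / Real.sqrt n)

/-- The off-diagonal generators of `SU(d)`: for `j < k`,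
`T_{j,k} = i E_{j,k} - i E_{k,j}` and `T_{k,j} = E_{j,k} + E_{k,j}`. -/
def generatorT {d : ℕ} (j k : Fin d) : Matrix (Fin d) (Fin d) ℂ :=
  if j < k then Complex.I • Matrix.single j k 1 - Complex.I • Matrix.single k j 1
  else Matrix.single j k 1 + Matrix.single k j 1

/-- The unitary
`U(ζ) = exp (i ∑_{j<k} (Re ζ_{j,k} T_{j,k} + Im ζ_{j,k} T_{k,j}) / √(μ_j - μ_k))`.
Only the entries `ζ j k` with `j < k` occur. -/
def localRotation {d : ℕ} (μ : Fin d → ℝ) (ζ : Fin d → Fin d → ℂ) : Matrix (Fin d) (Fin d) ℂ :=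
  NormedSpace.exp (Complex.I • ∑ j : Fin d, ∑ k ∈ Finset.univ.filter (fun k => j < k),
    (((Real.sqrt (μ j - μ k))⁻¹ : ℝ) : ℂ) •
      ((((ζ j k).re : ℝ) : ℂ) • generatorT j k + (((ζ j k).im : ℝ) : ℂ) • generatorT k j))

/-- The one-system state `ρ_{θ/√n}` for `θ = (u, ζ)`. -/
def localState {r : ℕ} (μ : Fin (r + 1) → ℝ) (n : ℕ) (u : Fin r → ℝ)
    (ζ : Fin (r + 1) → Fin (r + 1) → ℂ) : Matrix (Fin (r + 1)) (Fin (r + 1)) ℂ :=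
  localRotation μ (fun j k => ζ j k / (Real.sqrt n : ℂ)) *
    Matrix.diagonal (fun i => (localSpectrum μ n u i : ℂ)) *
    (localRotation μ (fun j k => ζ j k / (Real.sqrt n : ℂ))).conjTranspose

/-- `(ℂ^d)^{⊗ n}` with its Hilbert space structure, in coordinates with respect to the orthonormal
basis `f_a = f_{a(1)} ⊗ ⋯ ⊗ f_{a(n)}`. -/
abbrev TensorSpace (d n : ℕ) : Type := EuclideanSpace ℂ (Fin n → Fin d)

/-- The matrix of `ρ^{⊗ n}` in the basis `f_a`. -/
def tensorPow {d : ℕ} (n : ℕ) (ρ : Matrix (Fin d) (Fin d) ℂ) :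
    Matrix (Fin n → Fin d) (Fin n → Fin d) ℂ :=
  Matrix.of fun a b => ∏ k, ρ (a k) (b k)

/-- The action of `S(n)` on `(ℂ^d)^{⊗ n}`; on basis vectors `σ f_a = f_{a ∘ σ⁻¹}`. -/
def permAct {d n : ℕ} (σ : Equiv.Perm (Fin n)) (v : TensorSpace d n) : TensorSpace d n :=
  WithLp.toLp 2 fun a => v (a ∘ σ)

/-- The Young diagrams with `n` boxes and (at most) `d` rows, given by their row lengths. -/
def diagrams (d n : ℕ) : Finset (Fin d → ℕ) := by
  classical exact (Finset.piAntidiag Finset.univ n).filter fun l => Antitone l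

/-- The row of the box number `k` (counted from zero, as are the rows), when the boxes of the
diagram are numbered along the rows, starting with the top row. -/
def boxRow {d : ℕ} (l : Fin d → ℕ) (k : ℕ) : ℕ :=
  (Finset.univ.filter fun i : Fin d => ∑ j ∈ Finset.univ.filter (fun j => j ≤ i), l j ≤ k).card

/-- The column (counted from zero) of the box number `k` in the same numbering. -/
def boxCol {d : ℕ} (l : Fin d → ℕ) (k : ℕ) : ℕ :=
  k - ∑ j ∈ Finset.univ.filter (fun j : Fin d => (j : ℕ) < boxRow l k), l j

/-- The permutations of the boxes that leave every row invariant. -/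
def rowPerms {d : ℕ} (n : ℕ) (l : Fin d → ℕ) : Finset (Equiv.Perm (Fin n)) :=
  Finset.univ.filter fun σ => ∀ k : Fin n, boxRow l (σ k) = boxRow l k

/-- The permutations of the boxes that leave every column invariant. -/
def colPerms {d : ℕ} (n : ℕ) (l : Fin d → ℕ) : Finset (Equiv.Perm (Fin n)) :=
  Finset.univ.filter fun σ => ∀ k : Fin n, boxCol l (σ k) = boxCol l k

/-- The Young symmetriser `y_λ = q_λ p_λ` on `(ℂ^d)^{⊗ n}`: first symmetrise along the rows, then
antisymmetrise along the columns. -/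
def youngSymm {d n : ℕ} (l : Fin d → ℕ) (v : TensorSpace d n) : TensorSpace d n :=
  ∑ τ ∈ colPerms n l, ((Equiv.Perm.sign τ : ℤ) : ℂ) • permAct τ (∑ σ ∈ rowPerms n l, permAct σ v)

/-- The block `H_λ ⊗ K_λ` of `(ℂ^d)^{⊗ n}`, as a subspace: `y_λ` maps onto one copy of the
irreducible `SU(d)`-module `H_λ`, and the block is spanned by its translates under `S(n)`. -/
def block {d n : ℕ} (l : Fin d → ℕ) : Submodule ℂ (TensorSpace d n) :=
  Submodule.span ℂ
    (Set.range fun p : Equiv.Perm (Fin n) × TensorSpace d n => permAct p.1 (youngSymm l p.2))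

/-- The probability of the outcome `λ` when the `which block` measurement, given by the orthogonal
projections onto the blocks, is made on `n` systems in the state `ρ`: the trace of the `λ` block of
`ρ^{⊗ n}`. -/
def whichBlock {d : ℕ} (n : ℕ) (ρ : Matrix (Fin d) (Fin d) ℂ) (l : Fin d → ℕ) : ℝ :=
  (LinearMap.trace ℂ (TensorSpace d n)
    (Matrix.toEuclideanLin (tensorPow n ρ) ∘ₗ
      ((block l : Submodule ℂ (TensorSpace d n)).starProjection :
        TensorSpace d n →ₗ[ℂ] TensorSpace d n))).re

/-- The distribution `p_λ^{θ,n}` on Young diagrams, for `θ = (u, ζ)`. -/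
def blockProb {r : ℕ} (μ : Fin (r + 1) → ℝ) (n : ℕ) (u : Fin r → ℝ)
    (ζ : Fin (r + 1) → Fin (r + 1) → ℂ) (l : Fin (r + 1) → ℕ) : ℝ :=
  whichBlock n (localState μ n u ζ) l

/-- The covariance matrix `V(μ)_{i,j} = δ_{i,j} μ_i - μ_i μ_j`, `1 ≤ i, j ≤ d - 1`. -/
def covV {r : ℕ} (μ : Fin (r + 1) → ℝ) : Matrix (Fin r) (Fin r) ℝ :=
  Matrix.of fun i j => (if i = j then μ i.castSucc else 0) - μ i.castSucc * μ j.castSucc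

/-- The Lebesgue density of the Gaussian distribution `N(u, V(μ))` on `ℝ^{d-1}`. -/
def gaussDensity {r : ℕ} (μ : Fin (r + 1) → ℝ) (u x : Fin r → ℝ) : ℝ :=
  (Real.sqrt ((2 * Real.pi) ^ r * (covV μ).det))⁻¹ *
    Real.exp (-(1 / 2) * dotProduct (x - u) ((covV μ)⁻¹.mulVec (x - u)))

/-- The smoothing densities `τ_λ^n` on `ℝ^{d-1}`: uniform on the cube of side `n^{-1/2}` given by
`|n^{1/2} x_i + n μ_i - λ_i| ≤ 1/2`, `1 ≤ i ≤ d - 1`. -/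
def tauDensity {r : ℕ} (μ : Fin (r + 1) → ℝ) (n : ℕ) (l : Fin (r + 1) → ℕ) (x : Fin r → ℝ) : ℝ :=
  Set.indicator
    {x : Fin r → ℝ | ∀ i : Fin r,
      |Real.sqrt n * x i + n * μ i.castSucc - (l i.castSucc : ℝ)| ≤ 1 / 2}
    (fun _ => Real.sqrt n ^ r) x

open Classical in
/-- The diagram `λ_x`: the Young diagram with `n` boxes and `|n^{1/2} x_i + n μ_i - λ_i| < 1/2` for
`1 ≤ i ≤ d - 1`, if there is one, and the fixed diagram `κ` otherwise. -/
def youngOf {r : ℕ} (μ : Fin (r + 1) → ℝ) (n : ℕ) (κ : Fin (r + 1) → ℕ) (x : Fin r → ℝ) :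
    Fin (r + 1) → ℕ :=
  if h : ∃ l ∈ diagrams (r + 1) n, ∀ i : Fin r,
      |Real.sqrt n * x i + n * μ i.castSucc - (l i.castSucc : ℝ)| < 1 / 2
  then h.choose else κ

/-- The distribution `σ^n N(u, V(μ))` on Young diagrams, the image of `N(u, V(μ))` under
`x ↦ λ_x`. -/
def sigmaGauss {r : ℕ} (μ : Fin (r + 1) → ℝ) (n : ℕ) (κ : Fin (r + 1) → ℕ) (u : Fin r → ℝ)
    (l : Fin (r + 1) → ℕ) : ℝ :=
  ∫ x in {x : Fin r → ℝ | youngOf μ n κ x = l}, gaussDensity μ u x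

end

open MeasureTheory

noncomputable section

/-! ### Coordinates of boxes -/

/-! Only a lower bound for the block probabilities is needed. The Gaussian density φ has mass one,
and the numbers `p_λ` sum to at most one because blocks of different diagrams are orthogonal
(`block_isOrtho`, `sum_whichBlock_diagonal_le`). Hence the L¹ distance between φ and `∑ p_λ τ_λ` is
at most twice the integral of the positive part of their difference (`integral_abs_sub_le_of_le`),
and it suffices that `√n ^ r * p_λ ≥ (1 - error) φ` on the bulk of φ. Irreducibility of the blocks,
exact dimensions and character formulas are never used.

Each block is invariant under `A^{⊗n}`, so `p_λ` does not depend on ζ and the state may be taken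
diagonal with eigenvalues x (`blockProb_eq`). Then `p_λ` is at least the sum of the eigenvalues of
any independent family of eigenvectors in the block (`sum_eigenvalues_le_trace`). The family
consists of permuted Young symmetrisers of basis words, indexed by pairs of a column standard
numbering and a filling T (`linearIndependent_block`). The numberings come from ballot words, whose
number is at least the determinantal count (`tableauCount_le_card_ballotWords`). The fillings have i
in row i except for a few larger letters at the end of the row; if these stay beyond the length of
all lower rows, their weights sum to `∏ x_i ^ l_i` times a product over `i < j` of truncated
geometric series in `x_j / x_i`. This gives `whichBlock_diagonal_ge_tableauCount`.

Analytically, the determinantal count is about the multinomial coefficient times `∏_{i<j} (l_i -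
l_j) / l_i`, while the geometric series are about `x_i / (x_i - x_j)`. As `l_i ≈ n x_i`, these
products nearly cancel (`pair_factor_ge`). What remains is a multinomial probability, which
Stirling's formula compares row by row with the Gaussian (`row_log_ge`,
`whichBlock_ge_gaussDensity`).

If `|u_i| ≤ A` and the bulk is `quadForm μ (x - u) ≤ Z ^ 2`, all relative errors are controlled by
`B = Z³ A / (√n δ²)`. With `A = n^γ` and `Z = n^(γ/3)` this is the square of `n^(-1/4+γ) / δ`, hence
at most that quantity when it is at most one; otherwise the trivial bound 2 serves. The Gaussian
tail is smaller than any power of n. The discrete bound follows because integrating over the fibres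
of `x ↦ λ_x` contracts L¹ and recovers `p_λ` from the smoothed density
(`sum_abs_sigmaGauss_sub_le`). -/

theorem boxRow_eq {d : ℕ} (l : Fin d → ℕ) (k b : ℕ) (hb : b < d)
    (h1 : ∑ j ∈ Finset.univ.filter (fun j : Fin d => (j : ℕ) < b), l j ≤ k)
    (h2 : k < ∑ j ∈ Finset.univ.filter (fun j : Fin d => (j : ℕ) < b), l j + l ⟨b, hb⟩) :
    boxRow l k = b := by
  have key : (Finset.univ.filter fun i : Fin d =>
      ∑ j ∈ Finset.univ.filter (fun j => j ≤ i), l j ≤ k) =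
      Finset.univ.filter fun i : Fin d => (i : ℕ) < b := by
    ext i
    simp only [Finset.mem_filter, Finset.mem_univ, true_and]
    constructor
    · intro h
      by_contra hc
      push Not at hc
      have hsub : insert (⟨b, hb⟩ : Fin d) (Finset.univ.filter (fun j : Fin d => (j : ℕ) < b)) ⊆
          Finset.univ.filter (fun j => j ≤ i) := by
        intro j hj
        simp only [Finset.mem_insert, Finset.mem_filter, Finset.mem_univ, true_and] at hj ⊢
        rw [Fin.le_def]
        rcases hj with rfl | hj
        · exact hc
        · omega
      have := Finset.sum_le_sum_of_subset (f := l) hsub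
      rw [Finset.sum_insert (by simp)] at this
      omega
    · intro h
      refine le_trans (Finset.sum_le_sum_of_subset ?_) h1
      intro j hj
      simp only [Finset.mem_filter, Finset.mem_univ, true_and, Fin.le_def] at hj ⊢
      omega
  unfold boxRow
  rw [key, Fin.card_filter_val_lt]
  omega

/-- The boxes, numbered along the rows, in coordinates. -/
def boxEquiv {d n : ℕ} (l : Fin d → ℕ) (hl : ∑ i, l i = n) : Fin n ≃ Σ i : Fin d, Fin (l i) :=
  (finCongr hl.symm).trans finSigmaFinEquiv.symm

theorem sum_castLE_eq_sum_filter {d : ℕ} (l : Fin d → ℕ) (i : Fin d) :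
    ∑ j : Fin (i : ℕ), l (Fin.castLE i.2.le j) =
      ∑ j ∈ Finset.univ.filter (fun j : Fin d => (j : ℕ) < i), l j := by
  refine Finset.sum_bij (fun j _ => Fin.castLE i.2.le j) ?_ ?_ ?_ ?_
  · intro j _; exact Finset.mem_filter.mpr ⟨Finset.mem_univ _, j.2⟩
  · intro a _ b _ h; simpa using h
  · intro b hb
    simp only [Finset.mem_filter, Finset.mem_univ, true_and] at hb
    exact ⟨⟨b, hb⟩, Finset.mem_univ _, rfl⟩
  · intro j _; rfl

theorem boxEquiv_val {d n : ℕ} (l : Fin d → ℕ) (hl : ∑ i, l i = n) (k : Fin n) :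
    (k : ℕ) = ∑ j ∈ Finset.univ.filter (fun j : Fin d => (j : ℕ) < (boxEquiv l hl k).1), l j +
      (boxEquiv l hl k).2 := by
  obtain ⟨p, rfl⟩ := (boxEquiv l hl).symm.surjective k
  rw [Equiv.apply_symm_apply, ← sum_castLE_eq_sum_filter, ← finSigmaFinEquiv_apply]
  simp [boxEquiv]

theorem boxRow_eq_boxEquiv {d n : ℕ} (l : Fin d → ℕ) (hl : ∑ i, l i = n) (k : Fin n) :
    boxRow l k = (boxEquiv l hl k).1 := by
  have h := boxEquiv_val l hl k
  have h2 := (boxEquiv l hl k).2.2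
  exact boxRow_eq l k _ (boxEquiv l hl k).1.2 (by omega) (by simp only [Fin.eta]; omega)

theorem boxCol_eq_boxEquiv {d n : ℕ} (l : Fin d → ℕ) (hl : ∑ i, l i = n) (k : Fin n) :
    boxCol l k = (boxEquiv l hl k).2 := by
  have h := boxEquiv_val l hl k
  unfold boxCol
  rw [boxRow_eq_boxEquiv l hl]
  omega

/-- The row of a box as an element of `Fin d`. -/
def rowFin {d n : ℕ} (l : Fin d → ℕ) (hl : ∑ i, l i = n) (k : Fin n) : Fin d :=
  (boxEquiv l hl k).1

theorem boxRow_eq_rowFin {d n : ℕ} (l : Fin d → ℕ) (hl : ∑ i, l i = n) (k : Fin n) :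
    boxRow l k = rowFin l hl k := boxRow_eq_boxEquiv l hl k

theorem boxCol_lt {d n : ℕ} (l : Fin d → ℕ) (hl : ∑ i, l i = n) (k : Fin n) :
    boxCol l k < l (rowFin l hl k) := by
  rw [boxCol_eq_boxEquiv l hl]; exact (boxEquiv l hl k).2.2

theorem box_ext {d n : ℕ} (l : Fin d → ℕ) (hl : ∑ i, l i = n) {k k' : Fin n}
    (hr : rowFin l hl k = rowFin l hl k') (hc : boxCol l k = boxCol l k') : k = k' := by
  apply Fin.ext
  rw [boxEquiv_val l hl k, boxEquiv_val l hl k', ← boxCol_eq_boxEquiv, ← boxCol_eq_boxEquiv, hc]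
  change _ = ∑ j ∈ Finset.univ.filter (fun j : Fin d => (j : ℕ) < (rowFin l hl k')), l j + _
  rw [← hr]; rfl

theorem exists_box {d n : ℕ} (l : Fin d → ℕ) (hl : ∑ i, l i = n) (i : Fin d) {c : ℕ}
    (hc : c < l i) : ∃ k : Fin n, rowFin l hl k = i ∧ boxCol l k = c := by
  refine ⟨(boxEquiv l hl).symm ⟨i, c, hc⟩, ?_, ?_⟩
  · simp [rowFin]
  · rw [boxCol_eq_boxEquiv l hl]; rw [Equiv.apply_symm_apply]

theorem card_box_filter {d n : ℕ} (l : Fin d → ℕ) (hl : ∑ i, l i = n) (i : Fin d)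
    (p : ℕ → Prop) [DecidablePred p] :
    (Finset.univ.filter fun k : Fin n => rowFin l hl k = i ∧ p (boxCol l k)).card =
      ((Finset.range (l i)).filter p).card := by
  refine Finset.card_bij (fun k _ => boxCol l k) ?_ ?_ ?_
  · intro k hk
    simp only [Finset.mem_filter, Finset.mem_univ, true_and, Finset.mem_range] at hk ⊢
    exact ⟨hk.1 ▸ boxCol_lt l hl k, hk.2⟩
  · intro a ha b hb h
    simp only [Finset.mem_filter, Finset.mem_univ, true_and] at ha hb
    exact box_ext l hl (ha.1.trans hb.1.symm) h
  · intro c hc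
    simp only [Finset.mem_filter, Finset.mem_range] at hc
    obtain ⟨k, hk, hk'⟩ := exists_box l hl i hc.1
    exact ⟨k, by simp [hk, hk', hc.2], hk'⟩

theorem card_row {d n : ℕ} (l : Fin d → ℕ) (hl : ∑ i, l i = n) (i : Fin d) :
    (Finset.univ.filter fun k : Fin n => rowFin l hl k = i).card = l i := by
  simpa using card_box_filter l hl i (fun _ => True)

theorem card_row_col_lt {d n : ℕ} (l : Fin d → ℕ) (hl : ∑ i, l i = n) (i : Fin d) (m : ℕ) :
    (Finset.univ.filter fun k : Fin n => rowFin l hl k = i ∧ boxCol l k < m).card =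
      min (l i) m := by
  rw [card_box_filter l hl i (fun c => c < m)]
  have : (Finset.range (l i)).filter (fun c => c < m) = Finset.range (min (l i) m) := by
    ext c; simp
  rw [this, Finset.card_range]

theorem card_col_lt {d n : ℕ} (l : Fin d → ℕ) (hl : ∑ i, l i = n) (m : ℕ) :
    (Finset.univ.filter fun k : Fin n => boxCol l k < m).card = ∑ i, min (l i) m := by
  rw [Finset.card_eq_sum_card_fiberwise (f := rowFin l hl) (t := Finset.univ)
    (fun _ _ => Finset.mem_coe.2 (Finset.mem_univ _))]
  refine Finset.sum_congr rfl fun i _ => ?_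
  rw [← card_row_col_lt l hl i m, Finset.filter_filter]
  congr 1; ext k; simp [and_comm]

/-- Row sizes bound the number of boxes in the first `m` columns of a collision free filling. -/
theorem card_row_col_lt_le {d n : ℕ} (l l' : Fin d → ℕ) (hl : ∑ i, l i = n)
    (σ : Fin n → Fin n)
    (hinj : ∀ k k', rowFin l hl k = rowFin l hl k' → boxCol l' (σ k) = boxCol l' (σ k') → k = k')
    (i : Fin d) (m : ℕ) :
    (Finset.univ.filter fun k : Fin n => rowFin l hl k = i ∧ boxCol l' (σ k) < m).card ≤
      min (l i) m := by
  refine le_min ?_ ?_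
  · rw [← card_row l hl i]
    exact Finset.card_le_card fun k hk => by simp at hk ⊢; exact hk.1
  · rw [← Finset.card_range m]
    refine Finset.card_le_card_of_injOn (fun k => boxCol l' (σ k)) ?_ ?_
    · intro k hk; simp at hk ⊢; exact hk.2
    · intro a ha b hb h
      simp at ha hb
      exact hinj a b (ha.1.trans hb.1.symm) h

theorem sum_card_row_col_lt {d n : ℕ} (l l' : Fin d → ℕ) (hl : ∑ i, l i = n)
    (hl' : ∑ i, l' i = n) (σ : Equiv.Perm (Fin n)) (m : ℕ) :
    ∑ i, (Finset.univ.filter fun k : Fin n =>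
      rowFin l hl k = i ∧ boxCol l' (σ k) < m).card = ∑ i, min (l' i) m := by
  rw [← card_col_lt l' hl' m]
  have : (Finset.univ.filter fun k : Fin n => boxCol l' k < m).card =
      (Finset.univ.filter fun k : Fin n => boxCol l' (σ k) < m).card := by
    refine (Finset.card_bij (fun k _ => σ k) ?_ ?_ ?_).symm
    · intro a ha; simpa using ha
    · intro a _ b _ h; simpa using h
    · intro b hb; exact ⟨σ.symm b, by simpa using hb, by simp⟩
  rw [this, Finset.card_eq_sum_card_fiberwise (s := Finset.univ.filter fun k : Fin n =>
    boxCol l' (σ k) < m) (f := rowFin l hl) (t := Finset.univ)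
    (fun _ _ => Finset.mem_coe.2 (Finset.mem_univ _))]
  refine Finset.sum_congr rfl fun i _ => ?_
  rw [Finset.filter_filter]
  congr 1; ext k; simp [and_comm]

/-- A collision-free σ sends the boxes of one row of `l` to distinct columns of `l'`, so row i
supplies at most `min (l i) m` boxes to the first m columns of `l'`. Summing over the rows gives the
dominance order in terms of column sums. -/
theorem sum_min_le_of_injective {d n : ℕ} (l l' : Fin d → ℕ) (hl : ∑ i, l i = n)
    (hl' : ∑ i, l' i = n) (σ : Equiv.Perm (Fin n))
    (hinj : ∀ k k', rowFin l hl k = rowFin l hl k' → boxCol l' (σ k) = boxCol l' (σ k') → k = k')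
    (m : ℕ) : ∑ i, min (l' i) m ≤ ∑ i, min (l i) m := by
  rw [← sum_card_row_col_lt l l' hl hl' σ m]
  exact Finset.sum_le_sum fun i _ => card_row_col_lt_le l l' hl σ hinj i m

/-- The increment of `∑ min (l i) m` in m is the length of column m, and the column lengths
determine the diagram. -/
theorem eq_of_sum_min_eq {d : ℕ} (l l' : Fin d → ℕ) (ha : Antitone l) (ha' : Antitone l')
    (h : ∀ m, ∑ i, min (l i) m = ∑ i, min (l' i) m) : l = l' := by
  have hc : ∀ (l : Fin d → ℕ) m, (Finset.univ.filter fun i => m < l i).card + ∑ i, min (l i) m =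
      ∑ i, min (l i) (m + 1) := by
    intro l m
    rw [Finset.card_filter, ← Finset.sum_add_distrib]
    refine Finset.sum_congr rfl fun i _ => ?_
    split_ifs <;> omega
  have hcard : ∀ m, (Finset.univ.filter fun i => m < l i).card =
      (Finset.univ.filter fun i => m < l' i).card := by
    intro m
    have h1 := hc l m; have h2 := hc l' m
    rw [h, h] at h1; omega
  have hlow : ∀ (l : Fin d → ℕ), Antitone l → ∀ m i, m < l i ↔
      (i : ℕ) < (Finset.univ.filter fun i => m < l i).card := by
    intro l ha m i
    constructor
    · intro hm
      have : Finset.Iic i ⊆ Finset.univ.filter fun i => m < l i := by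
        intro j hj
        simp only [Finset.mem_Iic, Finset.mem_filter, Finset.mem_univ, true_and] at hj ⊢
        exact lt_of_lt_of_le hm (ha hj)
      have := Finset.card_le_card this
      rw [Fin.card_Iic] at this; omega
    · intro hm
      by_contra hcon
      have : (Finset.univ.filter fun i => m < l i) ⊆ Finset.Iio i := by
        intro j hj
        simp only [Finset.mem_Iio, Finset.mem_filter, Finset.mem_univ, true_and] at hj ⊢
        by_contra hji
        exact hcon (lt_of_lt_of_le hj (ha (not_lt.mp hji)))
      have := Finset.card_le_card this
      rw [Fin.card_Iio] at this; omega
  ext i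
  have key : ∀ m, m < l i ↔ m < l' i := fun m => by rw [hlow l ha, hlow l' ha', hcard]
  have h1 := key (l i); have h2 := key (l' i)
  omega

/-- A filling without collisions between rows and columns is a product of a row permutation and a
column permutation. -/
theorem exists_row_col_of_injective {d n : ℕ} (l : Fin d → ℕ) (hl : ∑ i, l i = n)
    (σ : Equiv.Perm (Fin n))
    (hinj : ∀ k k', rowFin l hl k = rowFin l hl k' → boxCol l (σ k) = boxCol l (σ k') → k = k') :
    ∃ π : Equiv.Perm (Fin n), (∀ k, boxRow l (π k) = boxRow l k) ∧
      ∀ k, boxCol l (π k) = boxCol l (σ k) := by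
  -- With `l' = l` the row-wise inequalities add up to an equality, so each of them is an equality.
  have heq : ∀ i m, (Finset.univ.filter fun k : Fin n =>
      rowFin l hl k = i ∧ boxCol l (σ k) < m).card = min (l i) m := by
    intro i m
    have h := sum_card_row_col_lt l l hl hl σ m
    exact (Finset.sum_eq_sum_iff_of_le
      (fun i _ => card_row_col_lt_le l l hl σ hinj i m)).mp h i (Finset.mem_univ _)
  -- Taking m to be the row length shows that every box of a row is sent to a column which this row
  -- reaches. So the box in its own row and in the target column exists, and it defines π.
  have hlt : ∀ k, boxCol l (σ k) < l (rowFin l hl k) := by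
    intro k
    have h := heq (rowFin l hl k) (l (rowFin l hl k))
    rw [min_self, ← card_row l hl (rowFin l hl k)] at h
    have hs : (Finset.univ.filter fun k' : Fin n => rowFin l hl k' = rowFin l hl k ∧
        boxCol l (σ k') < (Finset.univ.filter fun k' : Fin n =>
          rowFin l hl k' = rowFin l hl k).card) =
        Finset.univ.filter fun k' : Fin n => rowFin l hl k' = rowFin l hl k :=
      Finset.eq_of_subset_of_card_le (fun k hk => by simp at hk ⊢; exact hk.1) h.ge
    have hk : k ∈ Finset.univ.filter fun k' : Fin n => rowFin l hl k' = rowFin l hl k := by simp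
    rw [← hs] at hk
    simp only [Finset.mem_filter, Finset.mem_univ, true_and] at hk
    rw [card_row] at hk
    exact hk
  choose f hf hf' using fun k => exists_box l hl (rowFin l hl k) (hlt k)
  have hfi : Function.Injective f := by
    intro a b h
    refine hinj a b ?_ ?_
    · rw [← hf a, ← hf b, h]
    · rw [← hf' a, ← hf' b, h]
  refine ⟨Equiv.ofBijective f ((Fintype.bijective_iff_injective_and_card f).mpr ⟨hfi, rfl⟩), ?_, ?_⟩
  · intro k
    rw [boxRow_eq_rowFin l hl, boxRow_eq_rowFin l hl k]
    simp [hf]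
  · intro k; simp [hf']


/-! ### Row and column operators -/

/-- `permAct` as a representation of the symmetric group. -/
def permRep (d n : ℕ) : Equiv.Perm (Fin n) →* Module.End ℂ (TensorSpace d n) where
  toFun σ :=
    { toFun := permAct σ
      map_add' := fun _ _ => rfl
      map_smul' := fun _ _ => rfl }
  map_one' := rfl
  map_mul' _ _ := rfl

theorem permRep_apply {d n : ℕ} (σ : Equiv.Perm (Fin n)) (v : TensorSpace d n)
    (a : Fin n → Fin d) : permRep d n σ v a = v (a ∘ σ) := rfl

theorem inner_permRep {d n : ℕ} (σ : Equiv.Perm (Fin n)) (v w : TensorSpace d n) :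
    inner ℂ (permRep d n σ v) w = inner ℂ v (permRep d n σ⁻¹ w) := by
  simp only [PiLp.inner_apply, permRep_apply]
  refine Fintype.sum_equiv (Equiv.arrowCongr σ.symm (Equiv.refl _)) _ _ fun a => ?_
  have : ((Equiv.arrowCongr σ.symm (Equiv.refl (Fin d))) a) = a ∘ σ := rfl
  have h2 : (a ∘ σ) ∘ (σ⁻¹ : Equiv.Perm (Fin n)) = a := by funext k; simp
  rw [this, h2]

/-- The sum over the row permutations. -/
def rowSum {d : ℕ} (n : ℕ) (l : Fin d → ℕ) : Module.End ℂ (TensorSpace d n) :=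
  ∑ σ ∈ rowPerms n l, permRep d n σ

/-- The signed sum over the column permutations. -/
def colSum {d : ℕ} (n : ℕ) (l : Fin d → ℕ) : Module.End ℂ (TensorSpace d n) :=
  ∑ τ ∈ colPerms n l, ((Equiv.Perm.sign τ : ℤ) : ℂ) • permRep d n τ

theorem youngSymm_eq {d n : ℕ} (l : Fin d → ℕ) (v : TensorSpace d n) :
    youngSymm l v = colSum n l (rowSum n l v) := by
  simp only [youngSymm, colSum, rowSum, LinearMap.sum_apply, LinearMap.smul_apply]
  rfl

theorem mem_rowPerms {d n : ℕ} {l : Fin d → ℕ} {σ : Equiv.Perm (Fin n)} :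
    σ ∈ rowPerms n l ↔ ∀ k, boxRow l (σ k) = boxRow l k := by simp [rowPerms]

theorem mem_colPerms {d n : ℕ} {l : Fin d → ℕ} {σ : Equiv.Perm (Fin n)} :
    σ ∈ colPerms n l ↔ ∀ k, boxCol l (σ k) = boxCol l k := by simp [colPerms]

theorem mul_mem_rowPerms {d n : ℕ} {l : Fin d → ℕ} {σ τ : Equiv.Perm (Fin n)}
    (hσ : σ ∈ rowPerms n l) (hτ : τ ∈ rowPerms n l) : σ * τ ∈ rowPerms n l := by
  rw [mem_rowPerms] at *
  intro k; rw [Equiv.Perm.mul_apply, hσ, hτ]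

theorem inv_mem_rowPerms {d n : ℕ} {l : Fin d → ℕ} {σ : Equiv.Perm (Fin n)}
    (hσ : σ ∈ rowPerms n l) : σ⁻¹ ∈ rowPerms n l := by
  rw [mem_rowPerms] at *
  intro k; rw [← hσ (σ⁻¹ k)]; simp

theorem mul_mem_colPerms {d n : ℕ} {l : Fin d → ℕ} {σ τ : Equiv.Perm (Fin n)}
    (hσ : σ ∈ colPerms n l) (hτ : τ ∈ colPerms n l) : σ * τ ∈ colPerms n l := by
  rw [mem_colPerms] at *
  intro k; rw [Equiv.Perm.mul_apply, hσ, hτ]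

theorem inv_mem_colPerms {d n : ℕ} {l : Fin d → ℕ} {σ : Equiv.Perm (Fin n)}
    (hσ : σ ∈ colPerms n l) : σ⁻¹ ∈ colPerms n l := by
  rw [mem_colPerms] at *
  intro k; rw [← hσ (σ⁻¹ k)]; simp

theorem rowSum_mul_permRep {d n : ℕ} {l : Fin d → ℕ} {σ : Equiv.Perm (Fin n)}
    (hσ : σ ∈ rowPerms n l) : rowSum n l * permRep d n σ = rowSum n l := by
  simp only [rowSum, Finset.sum_mul, ← map_mul]
  refine Finset.sum_bij (fun τ _ => τ * σ) (fun τ h => mul_mem_rowPerms h hσ)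
    (fun a _ b _ h => mul_right_cancel h) (fun b hb => ⟨b * σ⁻¹, ?_, by simp⟩) (fun _ _ => rfl)
  exact mul_mem_rowPerms hb (inv_mem_rowPerms hσ)

theorem sign_coe_mul_self {n : ℕ} (σ : Equiv.Perm (Fin n)) :
    ((Equiv.Perm.sign σ : ℤ) : ℂ) * ((Equiv.Perm.sign σ : ℤ) : ℂ) = 1 := by
  rw [← Int.cast_mul, ← Units.val_mul, Int.units_mul_self]; simp

theorem permRep_mul_colSum {d n : ℕ} {l : Fin d → ℕ} {σ : Equiv.Perm (Fin n)}
    (hσ : σ ∈ colPerms n l) :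
    permRep d n σ * colSum n l = ((Equiv.Perm.sign σ : ℤ) : ℂ) • colSum n l := by
  simp only [colSum, Finset.mul_sum, Finset.smul_sum, mul_smul_comm, ← map_mul]
  refine Finset.sum_bij (fun τ _ => σ * τ) (fun τ h => mul_mem_colPerms hσ h)
    (fun a _ b _ h => mul_left_cancel h) (fun b hb => ⟨σ⁻¹ * b, ?_, by simp⟩) (fun τ _ => ?_)
  · exact mul_mem_colPerms (inv_mem_colPerms hσ) hb
  · rw [smul_smul, Equiv.Perm.sign_mul]
    push_cast
    rw [← mul_assoc, sign_coe_mul_self, one_mul]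

theorem colSum_mul_colSum {d n : ℕ} (l : Fin d → ℕ) :
    colSum n l * colSum (d := d) n l = ((colPerms n l).card : ℂ) • colSum n l := by
  nth_rewrite 1 [colSum]
  rw [Finset.sum_mul]
  rw [Finset.sum_congr rfl (g := fun _ => colSum n l)]
  · rw [Finset.sum_const]; norm_cast
  · intro τ hτ
    rw [smul_mul_assoc, permRep_mul_colSum hτ, smul_smul, sign_coe_mul_self, one_smul]

/-- Row permutations are closed under inversion, and the adjoint of a permutation operator is its
inverse. The same argument serves for `inner_colSum`, as inversion preserves the sign. -/
theorem inner_rowSum {d n : ℕ} (l : Fin d → ℕ) (v w : TensorSpace d n) :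
    inner ℂ (rowSum n l v) w = inner ℂ v (rowSum n l w) := by
  simp only [rowSum, LinearMap.sum_apply, sum_inner, inner_sum, inner_permRep]
  exact Finset.sum_bij (fun τ _ => τ⁻¹) (fun τ h => inv_mem_rowPerms h)
    (fun a _ b _ h => inv_injective h) (fun b hb => ⟨b⁻¹, inv_mem_rowPerms hb, inv_inv b⟩)
    (fun _ _ => rfl)

theorem inner_colSum {d n : ℕ} (l : Fin d → ℕ) (v w : TensorSpace d n) :
    inner ℂ (colSum n l v) w = inner ℂ v (colSum n l w) := by
  simp only [colSum, LinearMap.sum_apply, sum_inner, inner_sum, LinearMap.smul_apply,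
    inner_smul_left, inner_smul_right, inner_permRep]
  exact Finset.sum_bij (fun τ _ => τ⁻¹) (fun τ h => inv_mem_colPerms h)
    (fun a _ b _ h => inv_injective h) (fun b hb => ⟨b⁻¹, inv_mem_colPerms hb, inv_inv b⟩)
    (fun τ _ => by simp)

/-- The transposition of k and k' is absorbed by the row sum; moved past σ it becomes a column
transposition and yields the sign -1. So the product equals its own negative. -/
theorem rowSum_mul_permRep_mul_colSum_eq_zero {d n : ℕ} {l l' : Fin d → ℕ}
    {σ : Equiv.Perm (Fin n)} {k k' : Fin n} (hk : k ≠ k') (hr : boxRow l k = boxRow l k')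
    (hc : boxCol l' (σ⁻¹ k) = boxCol l' (σ⁻¹ k')) :
    rowSum n l * permRep d n σ * colSum n l' = 0 := by
  have ht : Equiv.swap k k' ∈ rowPerms n l := by
    rw [mem_rowPerms]
    intro j
    by_cases h1 : j = k
    · subst h1; rw [Equiv.swap_apply_left, hr]
    · by_cases h2 : j = k'
      · subst h2; rw [Equiv.swap_apply_right, hr]
      · rw [Equiv.swap_apply_of_ne_of_ne h1 h2]
  have hs : Equiv.swap (σ⁻¹ k) (σ⁻¹ k') ∈ colPerms n l' := by
    rw [mem_colPerms]
    intro j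
    by_cases h1 : j = σ⁻¹ k
    · subst h1; rw [Equiv.swap_apply_left, hc]
    · by_cases h2 : j = σ⁻¹ k'
      · subst h2; rw [Equiv.swap_apply_right, hc]
      · rw [Equiv.swap_apply_of_ne_of_ne h1 h2]
  have hconj : Equiv.swap k k' * σ = σ * Equiv.swap (σ⁻¹ k) (σ⁻¹ k') := by
    rw [Equiv.mul_swap_eq_swap_mul]; simp
  have h1 : rowSum n l * permRep d n σ * colSum n l' =
      -(rowSum n l * permRep d n σ * colSum n l') := by
    conv_lhs => rw [← rowSum_mul_permRep ht, mul_assoc (rowSum n l), ← map_mul, hconj, map_mul,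
      ← mul_assoc, mul_assoc _ _ (colSum n l'), permRep_mul_colSum hs]
    rw [Equiv.Perm.sign_swap (by simpa using hk)]
    simp
  have h2 : (2 : ℂ) • (rowSum n l * permRep d n σ * colSum n l') = 0 := by
    rw [two_smul]; nth_rewrite 2 [h1]; exact add_neg_cancel _
  exact (smul_eq_zero.mp h2).resolve_left two_ne_zero

/-- Von Neumann's lemma: either two boxes of one row collide in a column and the product vanishes,
or σ is a row permutation times a column permutation and the scalar is the sign of the latter. -/
theorem exists_rowSum_mul_permRep_mul_colSum {d n : ℕ} (l : Fin d → ℕ) (hl : ∑ i, l i = n)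
    (σ : Equiv.Perm (Fin n)) :
    ∃ κ : ℂ, rowSum n l * permRep d n σ * colSum n l = κ • (rowSum n l * colSum n l) := by
  by_cases h : ∀ k k', rowFin l hl k = rowFin l hl k' →
      boxCol l (σ⁻¹ k) = boxCol l (σ⁻¹ k') → k = k'
  · obtain ⟨π, hr, hc⟩ := exists_row_col_of_injective l hl σ⁻¹ h
    refine ⟨((Equiv.Perm.sign (π * σ) : ℤ) : ℂ), ?_⟩
    have h1 : π⁻¹ ∈ rowPerms n l := inv_mem_rowPerms (mem_rowPerms.mpr hr)
    have h2 : π * σ ∈ colPerms n l := mem_colPerms.mpr fun k => by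
      rw [Equiv.Perm.mul_apply, hc]; simp
    have : σ = π⁻¹ * (π * σ) := by simp
    conv_lhs => rw [this, map_mul, ← mul_assoc, rowSum_mul_permRep h1, mul_assoc,
      permRep_mul_colSum h2]
    rw [mul_smul_comm]
  · push Not at h
    obtain ⟨k, k', hr, hc, hk⟩ := h
    refine ⟨0, ?_⟩
    rw [zero_smul]
    exact rowSum_mul_permRep_mul_colSum_eq_zero hk
      (by rw [boxRow_eq_rowFin l hl, boxRow_eq_rowFin l hl, hr]) hc

/-- The scalar by which a permutation acts between a column and a row operator. -/
theorem exists_rowSum_colSum_mul_permRep_mul_colSum {d n : ℕ} (l : Fin d → ℕ)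
    (hl : ∑ i, l i = n) (σ : Equiv.Perm (Fin n)) :
    ∃ κ : ℂ, rowSum n l * colSum n l * permRep d n σ * colSum n l =
      κ • (rowSum n l * colSum n l) := by
  choose κ hκ using exists_rowSum_mul_permRep_mul_colSum (d := d) (n := n) l hl
  refine ⟨∑ τ ∈ colPerms n l, ((Equiv.Perm.sign τ : ℤ) : ℂ) * κ (τ * σ), ?_⟩
  have hq : rowSum n l * colSum n l = ∑ τ ∈ colPerms n l,
      rowSum (d := d) n l * (((Equiv.Perm.sign τ : ℤ) : ℂ) • permRep d n τ) := by
    rw [colSum, Finset.mul_sum]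
  rw [Finset.sum_smul]
  conv_lhs => rw [hq, Finset.sum_mul, Finset.sum_mul]
  refine Finset.sum_congr rfl fun τ _ => ?_
  rw [mul_smul_comm, smul_mul_assoc, smul_mul_assoc, mul_assoc (rowSum n l), ← map_mul, hκ,
    smul_smul]

theorem rowSum_mul_permRep_mul_colSum_of_lt {d n : ℕ} {l l' : Fin d → ℕ} (hl : ∑ i, l i = n)
    (hl' : ∑ i, l' i = n) {m : ℕ} (hm : ∑ i, min (l i) m < ∑ i, min (l' i) m)
    (σ : Equiv.Perm (Fin n)) : rowSum n l * permRep d n σ * colSum n l' = 0 := by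
  have h : ¬ ∀ k k', rowFin l hl k = rowFin l hl k' →
      boxCol l' (σ⁻¹ k) = boxCol l' (σ⁻¹ k') → k = k' := fun h =>
    absurd (sum_min_le_of_injective l l' hl hl' σ⁻¹ h m) (not_le.mpr hm)
  push Not at h
  obtain ⟨k, k', hr, hc, hk⟩ := h
  exact rowSum_mul_permRep_mul_colSum_eq_zero hk
      (by rw [boxRow_eq_rowFin l hl, boxRow_eq_rowFin l hl, hr]) hc

/-! ### Orthogonality of the blocks -/

/-- Row and column sums are self-adjoint, so the inner product of two generators contains `rowSum l
* colSum l * π * colSum l'`. Expanding the middle column sum leaves terms `rowSum l * π' * colSum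
l'`, each of which vanishes by the failure of dominance. -/
theorem block_isOrtho_of_lt {d n : ℕ} {l l' : Fin d → ℕ} (hl : ∑ i, l i = n)
    (hl' : ∑ i, l' i = n) {m : ℕ} (hm : ∑ i, min (l i) m < ∑ i, min (l' i) m) :
    (block l : Submodule ℂ (TensorSpace d n)) ⟂ block l' := by
  unfold block
  rw [Submodule.isOrtho_span]
  rintro _ ⟨⟨σ, v⟩, rfl⟩ _ ⟨⟨τ, w⟩, rfl⟩
  change inner ℂ (permRep d n σ (youngSymm l v)) (permRep d n τ (youngSymm l' w)) = 0
  rw [youngSymm_eq, youngSymm_eq, inner_permRep, inner_colSum, inner_rowSum]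
  have : rowSum n l * colSum n l * permRep d n σ⁻¹ * permRep d n τ * colSum n l' = 0 := by
    rw [mul_assoc _ (permRep d n σ⁻¹), ← map_mul]
    rw [colSum, Finset.mul_sum, Finset.sum_mul, Finset.sum_mul]
    refine Finset.sum_eq_zero fun π _ => ?_
    rw [mul_smul_comm, smul_mul_assoc, smul_mul_assoc, mul_assoc (rowSum n l), ← map_mul,
      rowSum_mul_permRep_mul_colSum_of_lt hl hl' hm, smul_zero]
  have h2 := LinearMap.congr_fun this (rowSum n l' w)
  simp only [Module.End.mul_apply, LinearMap.zero_apply] at h2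
  rw [h2, inner_zero_right]

theorem block_isOrtho {d n : ℕ} {l l' : Fin d → ℕ} (hl : l ∈ diagrams d n)
    (hl' : l' ∈ diagrams d n) (hne : l ≠ l') :
    (block l : Submodule ℂ (TensorSpace d n)) ⟂ block l' := by
  simp only [diagrams, Finset.mem_filter, Finset.mem_piAntidiag] at hl hl'
  by_cases h : ∀ m, ∑ i, min (l i) m = ∑ i, min (l' i) m
  · exact absurd (eq_of_sum_min_eq l l' hl.2 hl'.2 h) hne
  · push Not at h
    obtain ⟨m, hm⟩ := h
    rcases lt_or_gt_of_ne hm with hm | hm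
    · exact block_isOrtho_of_lt hl.1.1 hl'.1.1 hm
    · exact (block_isOrtho_of_lt hl'.1.1 hl.1.1 hm).symm

/-! ### The tensor power of a matrix -/

theorem tensorPow_mul {d : ℕ} (n : ℕ) (A B : Matrix (Fin d) (Fin d) ℂ) :
    tensorPow n (A * B) = tensorPow n A * tensorPow n B := by
  ext a b
  simp only [tensorPow, Matrix.of_apply, Matrix.mul_apply, ← Finset.prod_mul_distrib]
  rw [Finset.prod_univ_sum, Fintype.piFinset_univ]

theorem tensorPow_conjTranspose {d : ℕ} (n : ℕ) (A : Matrix (Fin d) (Fin d) ℂ) :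
    tensorPow n A.conjTranspose = (tensorPow n A).conjTranspose := by
  ext a b
  simp [tensorPow, Matrix.conjTranspose_apply]

theorem tensorPow_diagonal {d : ℕ} (n : ℕ) (x : Fin d → ℂ) :
    tensorPow n (Matrix.diagonal x) = Matrix.diagonal fun a => ∏ k, x (a k) := by
  ext a b
  simp only [tensorPow, Matrix.of_apply, Matrix.diagonal_apply]
  by_cases h : a = b
  · subst h; simp
  · rw [if_neg h]
    obtain ⟨k, hk⟩ := Function.ne_iff.mp h
    exact Finset.prod_eq_zero (Finset.mem_univ k) (by simp [hk])

theorem tensorPow_permRep {d n : ℕ} (A : Matrix (Fin d) (Fin d) ℂ) (σ : Equiv.Perm (Fin n))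
    (v : TensorSpace d n) :
    Matrix.toEuclideanLin (tensorPow n A) (permRep d n σ v) =
      permRep d n σ (Matrix.toEuclideanLin (tensorPow n A) v) := by
  ext a
  simp only [permRep_apply, Matrix.toLpLin_apply, Matrix.mulVec, dotProduct, tensorPow,
    Matrix.of_apply]
  refine Fintype.sum_equiv (Equiv.arrowCongr σ.symm (Equiv.refl _)) _ _ fun b => ?_
  have : ((Equiv.arrowCongr σ.symm (Equiv.refl (Fin d))) b) = b ∘ σ := rfl
  rw [this]
  congr 1
  exact (Equiv.prod_comp σ (fun k => A (a k) (b k))).symm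

theorem tensorPow_youngSymm {d n : ℕ} (A : Matrix (Fin d) (Fin d) ℂ) (l : Fin d → ℕ)
    (v : TensorSpace d n) :
    Matrix.toEuclideanLin (tensorPow n A) (youngSymm l v) =
      youngSymm l (Matrix.toEuclideanLin (tensorPow n A) v) := by
  simp only [youngSymm_eq, colSum, rowSum, LinearMap.sum_apply, LinearMap.smul_apply, map_sum,
    map_smul, tensorPow_permRep]

theorem tensorPow_mem_block {d n : ℕ} (A : Matrix (Fin d) (Fin d) ℂ) (l : Fin d → ℕ)
    {v : TensorSpace d n} (hv : v ∈ block l) :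
    Matrix.toEuclideanLin (tensorPow n A) v ∈ block l := by
  unfold block at hv
  induction hv using Submodule.span_induction with
  | mem x hx =>
    obtain ⟨⟨σ, w⟩, rfl⟩ := hx
    refine Submodule.subset_span ⟨⟨σ, Matrix.toEuclideanLin (tensorPow n A) w⟩, ?_⟩
    change permRep d n σ _ = Matrix.toEuclideanLin (tensorPow n A) (permRep d n σ _)
    rw [tensorPow_permRep, tensorPow_youngSymm]
  | zero => simp
  | add x y _ _ hx hy => rw [map_add]; exact Submodule.add_mem _ hx hy
  | smul c x _ hx => rw [map_smul]; exact Submodule.smul_mem _ _ hx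

/-- The block is invariant under `A^{⊗n}` and under its adjoint, the tensor power of `A*`; so the
orthogonal complement is invariant too, and the projection commutes with `A^{⊗n}`. -/
theorem tensorPow_starProjection_block {d n : ℕ} (A : Matrix (Fin d) (Fin d) ℂ) (l : Fin d → ℕ)
    (v : TensorSpace d n) :
    Matrix.toEuclideanLin (tensorPow n A) ((block l).starProjection v) =
      (block l).starProjection (Matrix.toEuclideanLin (tensorPow n A) v) := by
  refine (Submodule.eq_starProjection_of_mem_of_inner_eq_zero
    (tensorPow_mem_block A l (Submodule.starProjection_apply_mem _ _)) fun w hw => ?_).symm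
  rw [← map_sub]
  have hadj : Matrix.toEuclideanLin (tensorPow n A) =
      LinearMap.adjoint (Matrix.toEuclideanLin (tensorPow n A.conjTranspose)) := by
    rw [tensorPow_conjTranspose, Matrix.toEuclideanLin_conjTranspose_eq_adjoint,
      LinearMap.adjoint_adjoint]
  rw [hadj, LinearMap.adjoint_inner_left]
  exact Submodule.starProjection_inner_eq_zero _ _ (tensorPow_mem_block _ l hw)

/-- Cyclicity of the trace, since tensor powers commute with the block projection. -/
theorem whichBlock_unitary_conj {d n : ℕ} (U A : Matrix (Fin d) (Fin d) ℂ)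
    (hU : U.conjTranspose * U = 1) (l : Fin d → ℕ) :
    whichBlock n (U * A * U.conjTranspose) l = whichBlock n A l := by
  unfold whichBlock
  congr 1
  have hc : ∀ B : Matrix (Fin d) (Fin d) ℂ, Matrix.toEuclideanLin (tensorPow n B) ∘ₗ
      ((block l : Submodule ℂ (TensorSpace d n)).starProjection :
        TensorSpace d n →ₗ[ℂ] TensorSpace d n) =
      ((block l : Submodule ℂ (TensorSpace d n)).starProjection :
        TensorSpace d n →ₗ[ℂ] TensorSpace d n) ∘ₗ Matrix.toEuclideanLin (tensorPow n B) :=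
    fun B => LinearMap.ext fun v => tensorPow_starProjection_block B l v
  have hmul : ∀ B C : Matrix (Fin d) (Fin d) ℂ, Matrix.toEuclideanLin (tensorPow n (B * C)) =
      Matrix.toEuclideanLin (tensorPow n B) ∘ₗ Matrix.toEuclideanLin (tensorPow n C) := by
    intro B C
    rw [tensorPow_mul]
    exact Matrix.toLpLin_mul _ _ _ _ _
  rw [hmul, LinearMap.comp_assoc, hc, ← LinearMap.comp_assoc, LinearMap.trace_comp_comm',
    ← LinearMap.comp_assoc, ← hmul, ← mul_assoc, hU, one_mul]

/-! ### Unitarity of the local rotation -/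

theorem generatorT_isHermitian {d : ℕ} (j k : Fin d) : (generatorT j k).IsHermitian := by
  unfold Matrix.IsHermitian generatorT
  split_ifs
  · ext a b
    simp only [Matrix.conjTranspose_apply, Matrix.sub_apply, Matrix.smul_apply,
      Matrix.single_apply, smul_eq_mul, mul_ite, mul_one, mul_zero, star_sub]
    simp only [apply_ite star, star_zero, RCLike.star_def, Complex.conj_I]
    simp only [and_comm (a := j = b), and_comm (a := k = b)]
    split_ifs <;> simp
  · simp [Matrix.conjTranspose_add, Matrix.conjTranspose_single]
    abel

theorem localRotation_unitary {d : ℕ} (μ : Fin d → ℝ) (ζ : Fin d → Fin d → ℂ) :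
    (localRotation μ ζ).conjTranspose * localRotation μ ζ = 1 := by
  unfold localRotation
  set H := ∑ j : Fin d, ∑ k ∈ Finset.univ.filter (fun k => j < k),
    (((Real.sqrt (μ j - μ k))⁻¹ : ℝ) : ℂ) •
      ((((ζ j k).re : ℝ) : ℂ) • generatorT j k + (((ζ j k).im : ℝ) : ℂ) • generatorT k j) with hHdef
  have hH : H.conjTranspose = H := by
    rw [hHdef, Matrix.conjTranspose_sum]
    refine Finset.sum_congr rfl fun j _ => ?_
    rw [Matrix.conjTranspose_sum]
    refine Finset.sum_congr rfl fun k _ => ?_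
    rw [Matrix.conjTranspose_smul, Matrix.conjTranspose_add, Matrix.conjTranspose_smul,
      Matrix.conjTranspose_smul, (generatorT_isHermitian j k).eq, (generatorT_isHermitian k j).eq]
    simp
  rw [← Matrix.exp_conjTranspose, Matrix.conjTranspose_smul, hH]
  rw [← Matrix.exp_add_of_commute]
  · simp
  · simp


/-! ### Independent vectors in a block -/

/-- The basis vector `f_a` of the tensor space. -/
def wordVec {d n : ℕ} (a : Fin n → Fin d) : TensorSpace d n := EuclideanSpace.single a 1

theorem wordVec_apply {d n : ℕ} (a b : Fin n → Fin d) :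
    (wordVec a : TensorSpace d n) b = if b = a then 1 else 0 := by
  simp [wordVec]

theorem perm_eq_one_of_row_col {d n : ℕ} (l : Fin d → ℕ) (hl : ∑ i, l i = n)
    {τ : Equiv.Perm (Fin n)} (hτ : τ ∈ colPerms n l)
    (hr : ∀ k, rowFin l hl (τ k) = rowFin l hl k) : τ = 1 :=
  Equiv.ext fun k => box_ext l hl (hr k) (mem_colPerms.mp hτ k)

theorem rowSum_wordVec_rowFin {d n : ℕ} (l : Fin d → ℕ) (hl : ∑ i, l i = n) :
    rowSum n l (wordVec (rowFin l hl)) = ((rowPerms n l).card : ℂ) • wordVec (rowFin l hl) := by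
  rw [rowSum, LinearMap.sum_apply, Finset.sum_congr rfl (g := fun _ => wordVec (rowFin l hl))]
  · rw [Finset.sum_const]; norm_cast
  · intro σ hσ
    ext b
    rw [permRep_apply, wordVec_apply, wordVec_apply]
    have hr : rowFin l hl ∘ σ = rowFin l hl := by
      funext k
      apply Fin.ext
      rw [Function.comp_apply, ← boxRow_eq_rowFin, ← boxRow_eq_rowFin]
      exact mem_rowPerms.mp hσ k
    congr 1
    rw [eq_iff_iff]
    constructor
    · intro h
      funext k
      have h1 := congrFun h (σ⁻¹ k)
      have h2 := congrFun hr (σ⁻¹ k)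
      simp only [Function.comp_apply, Equiv.Perm.inv_def, Equiv.apply_symm_apply] at h1 h2
      rw [h1, ← h2]
    · rintro rfl
      exact hr

theorem colSum_wordVec_apply {d n : ℕ} (l : Fin d → ℕ) (a b : Fin n → Fin d) :
    colSum n l (wordVec a) b =
      ∑ τ ∈ colPerms n l, ((Equiv.Perm.sign τ : ℤ) : ℂ) * if b ∘ τ = a then 1 else 0 := by
  simp only [colSum, LinearMap.sum_apply, LinearMap.smul_apply, WithLp.ofLp_sum, Finset.sum_apply,
    PiLp.smul_apply, permRep_apply, wordVec_apply, smul_eq_mul]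

theorem rowSum_wordVec_apply {d n : ℕ} (l : Fin d → ℕ) (a b : Fin n → Fin d) :
    rowSum n l (wordVec a) b = ∑ σ ∈ rowPerms n l, if b ∘ σ = a then 1 else 0 := by
  simp only [rowSum, LinearMap.sum_apply, WithLp.ofLp_sum, Finset.sum_apply,
    permRep_apply, wordVec_apply]

theorem youngSymm_wordVec_apply {d n : ℕ} (l : Fin d → ℕ) (a b : Fin n → Fin d) :
    colSum n l (rowSum n l (wordVec a)) b =
      ∑ τ ∈ colPerms n l, ((Equiv.Perm.sign τ : ℤ) : ℂ) *
        ∑ σ ∈ rowPerms n l, if (b ∘ τ) ∘ σ = a then 1 else 0 := by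
  rw [colSum]
  simp only [LinearMap.sum_apply, LinearMap.smul_apply, WithLp.ofLp_sum, Finset.sum_apply,
    PiLp.smul_apply, permRep_apply, smul_eq_mul, rowSum_wordVec_apply]

/-- Fillings of the boxes by letters such that every letter is at least the row of its box,
with equality unless the box is at the bottom of its column. -/
def IsAdapted {d n : ℕ} (l : Fin d → ℕ) (hl : ∑ i, l i = n) (T : Fin n → Fin d) : Prop :=
  (∀ k, rowFin l hl k ≤ T k) ∧ ∀ k k' : Fin n, boxCol l k' = boxCol l k →
    rowFin l hl k < rowFin l hl k' → T k = rowFin l hl k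

/-- A row permutation does not affect the condition that letters are at least the row index, so `T ∘
τ` satisfies it because `T'` does. If τ moved a box k to a higher one, the letter of `T` there would
be the smaller row index of `τ k`, a contradiction. So τ never decreases the row index, and as the
indices have a fixed sum it preserves rows as well as columns. -/
theorem IsAdapted.col_eq_one {d n : ℕ} {l : Fin d → ℕ} {hl : ∑ i, l i = n}
    {T T' : Fin n → Fin d} (hT : IsAdapted l hl T) (hT' : IsAdapted l hl T')
    {τ σ : Equiv.Perm (Fin n)} (hτ : τ ∈ colPerms n l) (hσ : σ ∈ rowPerms n l)
    (h : (T ∘ τ) ∘ σ = T') : τ = 1 := by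
  have hge : ∀ k, rowFin l hl k ≤ T (τ k) := by
    intro k
    have h1 := congrFun h (σ⁻¹ k)
    simp only [Function.comp_apply, Equiv.Perm.inv_def, Equiv.apply_symm_apply] at h1
    have h2 := hT'.1 (σ⁻¹ k)
    rw [Equiv.Perm.inv_def] at h2
    rw [← h1] at h2
    refine le_trans (le_of_eq ?_) h2
    apply Fin.ext
    rw [← boxRow_eq_rowFin, ← boxRow_eq_rowFin]
    exact (mem_rowPerms.mp (inv_mem_rowPerms hσ) k).symm
  have hle : ∀ k, (rowFin l hl k : ℕ) ≤ rowFin l hl (τ k) := by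
    intro k
    by_contra hc
    push Not at hc
    have := hT.2 (τ k) k (mem_colPerms.mp hτ k).symm hc
    have h2 := hge k
    rw [this, Fin.le_def] at h2
    omega
  have hsum : ∑ k, (rowFin l hl k : ℕ) = ∑ k, (rowFin l hl (τ k) : ℕ) :=
    (Equiv.sum_comp τ fun k => (rowFin l hl k : ℕ)).symm
  have heq := (Finset.sum_eq_sum_iff_of_le fun k _ => hle k).mp hsum
  exact perm_eq_one_of_row_col l hl hτ fun k => Fin.ext (heq k (Finset.mem_univ _)).symm

theorem IsAdapted.youngSymm_apply {d n : ℕ} {l : Fin d → ℕ} {hl : ∑ i, l i = n}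
    {T T' : Fin n → Fin d} (hT : IsAdapted l hl T) (hT' : IsAdapted l hl T') :
    colSum n l (rowSum n l (wordVec T')) T =
      ((rowPerms n l).filter fun σ : Equiv.Perm (Fin n) => T ∘ σ = T').card := by
  rw [youngSymm_wordVec_apply, Finset.sum_eq_single 1]
  · rw [Finset.card_filter]
    simp
  · intro τ hτ hne
    rw [Finset.sum_eq_zero, mul_zero]
    intro σ hσ
    rw [if_neg]
    exact fun h => hne (hT.col_eq_one hT' hτ hσ h)
  · intro h
    exact absurd (mem_colPerms.mpr fun _ => rfl) h

/-- A numbering of the boxes that increases down the columns. -/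
def IsColStandard {d n : ℕ} (l : Fin d → ℕ) (hl : ∑ i, l i = n) (s : Equiv.Perm (Fin n)) : Prop :=
  ∀ k k', boxCol l (s k') = boxCol l (s k) → rowFin l hl (s k') < rowFin l hl (s k) → k' < k

/-- The row word of `s` is the lexicographically least word in its polytabloid. At the first
position i where another word b is smaller, b shows the row of a box above `s i` in its column. That
box has an earlier number k', where the two words agree, which forces the column permutation to fix
`s i`. -/
theorem IsColStandard.not_lt {d n : ℕ} {l : Fin d → ℕ} {hl : ∑ i, l i = n}
    {s : Equiv.Perm (Fin n)} (hs : IsColStandard l hl s) {b : Fin n → Fin d}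
    (hb : permRep d n s⁻¹ (colSum n l (wordVec (rowFin l hl))) b ≠ 0) :
    ¬ toLex b < toLex (rowFin l hl ∘ s) := by
  rw [permRep_apply, colSum_wordVec_apply] at hb
  obtain ⟨τ, hτ, hne⟩ := Finset.exists_ne_zero_of_sum_ne_zero hb
  have hbτ : (b ∘ ⇑s⁻¹) ∘ τ = rowFin l hl := by
    by_contra h
    exact hne (by rw [if_neg h, mul_zero])
  have hπ := inv_mem_colPerms hτ
  rw [mem_colPerms] at hπ
  have hbk : ∀ k, b k = rowFin l hl (τ⁻¹ (s k)) := by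
    intro k
    rw [← hbτ]; simp
  rintro ⟨i, hj, hi⟩
  simp only [Pi.toLex_apply, Function.comp_apply, hbk] at hj hi
  set k' := s⁻¹ (τ⁻¹ (s i)) with hk'
  have hsk' : s k' = τ⁻¹ (s i) := by simp [hk']
  have hlt : k' < i := hs i k' (by rw [hsk', hπ]) (by rw [hsk']; exact hi)
  have h1 := hj k' hlt
  rw [hsk'] at h1
  have h2 : τ⁻¹ (τ⁻¹ (s i)) = τ⁻¹ (s i) := box_ext l hl h1 (by rw [hπ])
  have h3 : τ⁻¹ (s i) = s i := τ⁻¹.injective h2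
  rw [h3] at hi
  exact lt_irrefl _ hi

theorem permRep_colSum_wordVec_self {d n : ℕ} (l : Fin d → ℕ) (hl : ∑ i, l i = n)
    (s : Equiv.Perm (Fin n)) :
    permRep d n s⁻¹ (colSum n l (wordVec (rowFin l hl))) (rowFin l hl ∘ s) = 1 := by
  have : (rowFin l hl ∘ s) ∘ ⇑s⁻¹ = rowFin l hl := by funext k; simp
  rw [permRep_apply, colSum_wordVec_apply, this, Finset.sum_eq_single 1]
  · simp
  · intro τ hτ hne
    rw [if_neg, mul_zero]
    exact fun h => hne (perm_eq_one_of_row_col l hl hτ fun k => congrFun h k)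
  · intro h
    exact absurd (mem_colPerms.mpr fun _ => rfl) h

/-- Triangularity: the least words of the polytabloids are distinct and have coefficient one. -/
theorem linearIndependent_polytabloids {d n : ℕ} {l : Fin d → ℕ} {hl : ∑ i, l i = n}
    {ι : Type*} [Fintype ι] (s : ι → Equiv.Perm (Fin n)) (hs : ∀ i, IsColStandard l hl (s i))
    (hinj : Function.Injective fun i => rowFin l hl ∘ s i) :
    LinearIndependent ℂ fun i => permRep d n (s i)⁻¹ (colSum n l (wordVec (rowFin l hl))) := by
  classical
  rw [Fintype.linearIndependent_iff]
  intro c hc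
  by_contra hne
  push Not at hne
  -- Among the polytabloids with nonzero coefficient take the one with the least leading word; none
  -- of the others contains that word.
  obtain ⟨i, hi, hmin⟩ := Finset.exists_min_image (Finset.univ.filter fun i => c i ≠ 0)
    (fun i => toLex (rowFin l hl ∘ s i)) (by obtain ⟨i, hi⟩ := hne; exact ⟨i, by simp [hi]⟩)
  simp only [Finset.mem_filter, Finset.mem_univ, true_and] at hi hmin
  have h := congrArg (fun v : TensorSpace d n => v (rowFin l hl ∘ s i)) hc
  simp only [WithLp.ofLp_sum, Finset.sum_apply, PiLp.smul_apply, smul_eq_mul, PiLp.zero_apply] at h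
  rw [Finset.sum_eq_single i] at h
  · rw [permRep_colSum_wordVec_self, mul_one] at h
    exact hi h
  · intro j _ hji
    by_cases hcj : c j = 0
    · rw [hcj, zero_mul]
    · by_contra hv
      have h1 := (hs j).not_lt (right_ne_zero_of_mul hv)
      have h2 := hmin j hcj
      exact hji (hinj (toLex.injective (le_antisymm (not_lt.mp h1) h2)))
  · intro h; exact absurd (Finset.mem_univ _) h

/-- With p, q the row and column sums, `q² = |C| q` and self-adjointness give `‖q p w‖² = |C| ⟨p q p
w, w⟩`, where C is the set of column permutations. So p is injective on the image of `q p`. -/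
theorem colSum_rowSum_eq_zero_of_rowSum {d n : ℕ} (l : Fin d → ℕ) (w : TensorSpace d n)
    (h : rowSum n l (colSum n l (rowSum n l w)) = 0) : colSum n l (rowSum n l w) = 0 := by
  have hqq : colSum n l (colSum n l (rowSum n l w)) =
      ((colPerms n l).card : ℂ) • colSum n l (rowSum n l w) :=
    LinearMap.congr_fun (colSum_mul_colSum l) (rowSum n l w)
  rw [← inner_self_eq_zero (𝕜 := ℂ)]
  nth_rewrite 2 [← one_smul ℂ (colSum n l (rowSum n l w))]
  rw [one_smul, ← inner_colSum, hqq, inner_smul_left, ← inner_rowSum, h, inner_zero_left, mul_zero]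

/-- Products of independent families in the two tensor factors of a block. -/
theorem linearIndependent_block {d n : ℕ} {l : Fin d → ℕ} {hl : ∑ i, l i = n}
    {ι κ : Type*} [Fintype ι] [Fintype κ] (s : ι → Equiv.Perm (Fin n))
    (hs : ∀ i, IsColStandard l hl (s i)) (hinj : Function.Injective fun i => rowFin l hl ∘ s i)
    (T : κ → Fin n → Fin d) (hT : ∀ j, IsAdapted l hl (T j))
    (hTinj : ∀ j j', ∀ σ : Equiv.Perm (Fin n), σ ∈ rowPerms n l → T j ∘ σ = T j' → j = j') :
    LinearIndependent ℂ fun p : ι × κ =>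
      permRep d n (s p.1)⁻¹ (colSum n l (rowSum n l (wordVec (T p.2)))) := by
  classical
  rw [Fintype.linearIndependent_iff]
  intro g hg
  choose κ' hκ using exists_rowSum_colSum_mul_permRep_mul_colSum (d := d) (n := n) l hl
  have hκv : ∀ σ v, rowSum n l (colSum n l (permRep d n σ (colSum n l v))) =
      κ' σ • rowSum n l (colSum n l v) := fun σ v => LinearMap.congr_fun (hκ σ) v
  -- Applying `rowSum * colSum * σ` replaces each numbering by a scalar, so only the vectors of the
  -- fillings remain. These are separated by reading off the coefficient at `T j`, because different
  -- fillings are not related by row permutations.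
  have hzero : ∀ σ j, ∑ i, g (i, j) * κ' (σ * (s i)⁻¹) = 0 := by
    intro σ
    have h1 := congrArg (fun v => rowSum n l (colSum n l (permRep d n σ v))) hg
    simp only [map_sum, map_smul, map_zero] at h1
    have h2 : ∀ (i : ι) v, permRep d n σ (permRep d n (s i)⁻¹ v) =
        permRep d n (σ * (s i)⁻¹) v := fun i v => by rw [map_mul]; rfl
    simp only [h2, hκv, smul_smul] at h1
    rw [Fintype.sum_prod_type_right] at h1
    simp only [← Finset.sum_smul, ← map_smul, ← map_sum] at h1
    have h3 := colSum_rowSum_eq_zero_of_rowSum l _ h1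
    intro j
    have h4 := congrArg (fun v : TensorSpace d n => v (T j)) h3
    simp only [map_sum, map_smul, WithLp.ofLp_sum, Finset.sum_apply, PiLp.smul_apply, smul_eq_mul,
      PiLp.zero_apply, (hT j).youngSymm_apply (hT _)] at h4
    rw [Finset.sum_eq_single j] at h4
    · refine (mul_eq_zero.mp h4).resolve_right ?_
      have : (1 : Equiv.Perm (Fin n)) ∈ (rowPerms n l).filter fun σ : Equiv.Perm (Fin n) => T j ∘ σ = T j :=
        Finset.mem_filter.mpr ⟨mem_rowPerms.mpr fun _ => rfl, rfl⟩
      exact_mod_cast (Finset.card_pos.mpr ⟨_, this⟩).ne'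
    · intro j' _ hne
      rw [Finset.filter_eq_empty_iff.mpr, Finset.card_empty, Nat.cast_zero, mul_zero]
      exact fun σ hσ h => hne (hTinj j j' σ hσ h).symm
    · intro h; exact absurd (Finset.mem_univ _) h
  rintro ⟨i, j⟩
  set w := wordVec (rowFin l hl) with hw
  -- The same coefficients are tested on the row word, where the symmetrised vectors are multiples
  -- of polytabloids. By `hzero` the vector z is annihilated after every translate, so it is
  -- orthogonal to each of its own summands and vanishes.
  set z := ∑ i, g (i, j) • permRep d n (s i)⁻¹ (colSum n l (rowSum n l w)) with hz
  have hpz : ∀ σ, rowSum n l (colSum n l (permRep d n σ z)) = 0 := by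
    intro σ
    simp only [hz, map_sum, map_smul]
    have h2 : ∀ (i : ι) v, permRep d n σ (permRep d n (s i)⁻¹ v) =
        permRep d n (σ * (s i)⁻¹) v := fun i v => by rw [map_mul]; rfl
    simp only [h2, hκv, smul_smul]
    rw [← Finset.sum_smul, hzero, zero_smul]
  have hz0 : z = 0 := by
    rw [← inner_self_eq_zero (𝕜 := ℂ)]
    nth_rewrite 1 [hz]
    rw [sum_inner]
    refine Finset.sum_eq_zero fun i _ => ?_
    rw [inner_smul_left, inner_permRep, inner_colSum, inner_rowSum, hpz, inner_zero_right,
      mul_zero]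
  have hli := linearIndependent_polytabloids s hs hinj
  rw [Fintype.linearIndependent_iff] at hli
  have hR : ((rowPerms n l).card : ℂ) ≠ 0 := by
    exact_mod_cast (Finset.card_pos.mpr
      ⟨(1 : Equiv.Perm (Fin n)), mem_rowPerms.mpr fun _ => rfl⟩).ne'
  have h5 := hli (fun i => g (i, j) * (rowPerms n l).card) (by
    rw [← hz0, hz]
    refine Finset.sum_congr rfl fun i _ => ?_
    rw [hw, rowSum_wordVec_rowFin, map_smul, map_smul, smul_smul]) i
  exact (mul_eq_zero.mp h5).resolve_right hR

/-! ### Traces -/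

theorem toEuclideanLin_diagonal_apply {d n : ℕ} (x : (Fin n → Fin d) → ℂ) (v : TensorSpace d n)
    (a : Fin n → Fin d) : Matrix.toEuclideanLin (Matrix.diagonal x) v a = x a * v a := by
  simp [Matrix.toLpLin_apply, Matrix.mulVec_diagonal]

/-- The trace of a diagonal operator times an orthogonal projection. -/
theorem trace_diagonal_comp_starProjection {d n : ℕ} (x : (Fin n → Fin d) → ℝ)
    (K : Submodule ℂ (TensorSpace d n)) :
    (LinearMap.trace ℂ (TensorSpace d n)
      (Matrix.toEuclideanLin (Matrix.diagonal fun a => (x a : ℂ)) ∘ₗ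
        (K.starProjection : TensorSpace d n →ₗ[ℂ] TensorSpace d n))).re =
    ∑ a, x a * ‖K.starProjection (wordVec a)‖ ^ 2 := by
  rw [LinearMap.trace_eq_sum_inner _ (EuclideanSpace.basisFun (Fin n → Fin d) ℂ), Complex.re_sum]
  refine Finset.sum_congr rfl fun a _ => ?_
  have h1 : EuclideanSpace.basisFun (Fin n → Fin d) ℂ a = wordVec a := by simp [wordVec]
  rw [h1, LinearMap.comp_apply]
  have h2 : ∀ v : TensorSpace d n, inner ℂ (wordVec a) v = v a := by
    intro v; simp [wordVec, EuclideanSpace.inner_single_left]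
  have h3 : (inner ℂ (wordVec a) (K.starProjection (wordVec a)) : ℂ) =
      (‖K.starProjection (wordVec a)‖ : ℂ) ^ 2 := by
    refine Eq.trans ?_ (inner_self_eq_norm_sq_to_K (𝕜 := ℂ) (K.starProjection (wordVec a)))
    rw [Submodule.inner_starProjection_left_eq_right]
    congr 1
    exact (Submodule.starProjection_eq_self_iff.mpr
      (Submodule.starProjection_apply_mem _ _)).symm
  rw [h2, toEuclideanLin_diagonal_apply]
  change ((x a : ℂ) * (K.starProjection (wordVec a)) a).re = _
  rw [← h2, h3, ← Complex.ofReal_pow, ← Complex.ofReal_mul, Complex.ofReal_re]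

theorem norm_starProjection_le_of_le {E : Type*} [NormedAddCommGroup E] [InnerProductSpace ℂ E]
    [FiniteDimensional ℂ E] {K L : Submodule ℂ E} (h : K ≤ L) (v : E) :
    ‖K.starProjection v‖ ≤ ‖L.starProjection v‖ := by
  have : K.starProjection v = K.starProjection (L.starProjection v) := by
    refine (Submodule.eq_starProjection_of_mem_of_inner_eq_zero
      (Submodule.starProjection_apply_mem _ _) fun w hw => ?_).symm
    have h1 := Submodule.starProjection_inner_eq_zero (K := K) v w hw
    have h2 := Submodule.starProjection_inner_eq_zero (K := L) v w (h hw)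
    have : L.starProjection v - K.starProjection v =
        (v - K.starProjection v) - (v - L.starProjection v) := by abel
    rw [this, inner_sub_left, h1, h2, sub_zero]
  rw [this]
  exact Submodule.norm_starProjection_apply_le K _

/-- Let K be the span of the eigenvectors. The trace of D times the projection onto K is computed on
K in the basis v, which need not be orthonormal, and equals the sum of the eigenvalues. Enlarging K
to L increases every `‖P f_a‖`, and the diagonal entries of D are nonnegative. -/
theorem sum_eigenvalues_le_trace {d n : ℕ} (x : (Fin n → Fin d) → ℝ) (hx : ∀ a, 0 ≤ x a)
    (L : Submodule ℂ (TensorSpace d n)) {ι : Type*} [Fintype ι] (v : ι → TensorSpace d n)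
    (hv : LinearIndependent ℂ v) (hvL : ∀ i, v i ∈ L) (ω : ι → ℝ)
    (hω : ∀ i, Matrix.toEuclideanLin (Matrix.diagonal fun a => (x a : ℂ)) (v i) =
      (ω i : ℂ) • v i) :
    ∑ i, ω i ≤ ∑ a, x a * ‖L.starProjection (wordVec a)‖ ^ 2 := by
  classical
  set K := Submodule.span ℂ (Set.range v) with hK
  have hKL : K ≤ L := Submodule.span_le.mpr (by rintro _ ⟨i, rfl⟩; exact hvL i)
  have h1 : ∑ a, x a * ‖K.starProjection (wordVec a)‖ ^ 2 ≤
      ∑ a, x a * ‖L.starProjection (wordVec a)‖ ^ 2 := by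
    refine Finset.sum_le_sum fun a _ => mul_le_mul_of_nonneg_left ?_ (hx a)
    exact pow_le_pow_left₀ (norm_nonneg _) (norm_starProjection_le_of_le hKL _) 2
  refine le_trans (le_of_eq ?_) h1
  rw [← trace_diagonal_comp_starProjection]
  set D := Matrix.toEuclideanLin (Matrix.diagonal fun a : Fin n → Fin d => (x a : ℂ)) with hD
  have hDK : ∀ w ∈ K, D w ∈ K := by
    intro w hw
    rw [hK] at hw ⊢
    induction hw using Submodule.span_induction with
    | mem y hy => obtain ⟨i, rfl⟩ := hy; rw [hω]; exact Submodule.smul_mem _ _ (Submodule.subset_span ⟨i, rfl⟩)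
    | zero => simp
    | add a b _ _ ha hb => rw [map_add]; exact Submodule.add_mem _ ha hb
    | smul c a _ ha => rw [map_smul]; exact Submodule.smul_mem _ _ ha
  have hmem : ∀ w, (D ∘ₗ (K.starProjection : TensorSpace d n →ₗ[ℂ] TensorSpace d n)) w ∈ K :=
    fun w => hDK _ (Submodule.starProjection_apply_mem _ _)
  rw [← LinearMap.trace_restrict_eq_of_forall_mem K _ hmem]
  set b := Module.Basis.span hv with hb
  rw [LinearMap.trace_eq_matrix_trace ℂ b, Matrix.trace, Complex.re_sum]
  refine Finset.sum_congr rfl fun i _ => ?_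
  have hbi : LinearMap.restrict (D ∘ₗ (K.starProjection : TensorSpace d n →ₗ[ℂ] TensorSpace d n))
      (fun w _ => hmem w) (b i) = (ω i : ℂ) • b i := by
    apply Subtype.ext
    have hbv : (b i : TensorSpace d n) = v i := by rw [hb, Module.Basis.span_apply]
    change D (K.starProjection (b i : TensorSpace d n)) = (ω i : ℂ) • (b i : TensorSpace d n)
    rw [Submodule.starProjection_eq_self_iff.mpr (b i).2, hbv, hω]
  rw [Matrix.diag_apply, LinearMap.toMatrix_apply]
  erw [hbi]
  rw [map_smul, Module.Basis.repr_self]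
  simp

theorem whichBlock_diagonal {d n : ℕ} (x : Fin d → ℝ) (l : Fin d → ℕ) :
    whichBlock n (Matrix.diagonal fun i => (x i : ℂ)) l =
      ∑ a : Fin n → Fin d, (∏ k, x (a k)) *
        ‖(block l : Submodule ℂ (TensorSpace d n)).starProjection (wordVec a)‖ ^ 2 := by
  rw [whichBlock, tensorPow_diagonal, ← trace_diagonal_comp_starProjection]
  push_cast
  rfl

/-! ### Block probabilities of diagonal states -/

theorem whichBlock_diagonal_nonneg {d n : ℕ} (x : Fin d → ℝ) (hx : ∀ i, 0 ≤ x i)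
    (l : Fin d → ℕ) : 0 ≤ whichBlock n (Matrix.diagonal fun i => (x i : ℂ)) l := by
  rw [whichBlock_diagonal]
  exact Finset.sum_nonneg fun a _ =>
    mul_nonneg (Finset.prod_nonneg fun k _ => hx _) (sq_nonneg _)

/-- Bessel's inequality for the orthogonal blocks: the sum w of the projections satisfies `‖w‖² =
⟨w, v⟩ ≤ ‖w‖ ‖v‖`. -/
theorem sum_norm_starProjection_block_le {d n : ℕ} (v : TensorSpace d n) :
    ∑ l ∈ diagrams d n, ‖(block l : Submodule ℂ (TensorSpace d n)).starProjection v‖ ^ 2 ≤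
      ‖v‖ ^ 2 := by
  set w : TensorSpace d n := ∑ l ∈ diagrams d n, (block l).starProjection v with hw
  have h1 : ‖w‖ ^ 2 = ∑ l ∈ diagrams d n,
      ‖(block l : Submodule ℂ (TensorSpace d n)).starProjection v‖ ^ 2 := by
    have : (inner ℂ w w : ℂ) = ∑ l ∈ diagrams d n,
        ((‖(block l : Submodule ℂ (TensorSpace d n)).starProjection v‖ : ℂ)) ^ 2 := by
      nth_rewrite 1 [hw]
      rw [sum_inner]
      refine Finset.sum_congr rfl fun l hl => ?_
      rw [hw, inner_sum, Finset.sum_eq_single l]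
      · rw [inner_self_eq_norm_sq_to_K]; rfl
      · intro l' hl' hne
        exact (block_isOrtho hl hl' hne.symm).inner_eq (Submodule.starProjection_apply_mem _ _)
          (Submodule.starProjection_apply_mem _ _)
      · intro h; exact absurd hl h
    rw [inner_self_eq_norm_sq_to_K] at this
    refine Complex.ofReal_injective ?_
    push_cast
    exact this
  have h2 : (inner ℂ w v : ℂ) = ∑ l ∈ diagrams d n,
        ((‖(block l : Submodule ℂ (TensorSpace d n)).starProjection v‖ : ℂ)) ^ 2 := by
    rw [hw, sum_inner]
    refine Finset.sum_congr rfl fun l _ => ?_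
    have h := Submodule.starProjection_inner_eq_zero (K := block l) v _
      (Submodule.starProjection_apply_mem (block l) v)
    rw [inner_sub_left, sub_eq_zero] at h
    rw [← inner_conj_symm, h, inner_self_eq_norm_sq_to_K]
    simp
  have h3 : ‖(inner ℂ w v : ℂ)‖ ≤ ‖w‖ * ‖v‖ := norm_inner_le_norm _ _
  have h4 : ‖(inner ℂ w v : ℂ)‖ = ‖w‖ ^ 2 := by
    rw [h2, h1]
    have : (∑ l ∈ diagrams d n,
        ((‖(block l : Submodule ℂ (TensorSpace d n)).starProjection v‖ : ℂ)) ^ 2) =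
        ((∑ l ∈ diagrams d n,
          ‖(block l : Submodule ℂ (TensorSpace d n)).starProjection v‖ ^ 2 : ℝ) : ℂ) := by
      push_cast; rfl
    rw [this, Complex.norm_real, Real.norm_of_nonneg (Finset.sum_nonneg fun _ _ => sq_nonneg _)]
  rw [← h1]
  have h5 : ‖w‖ ≤ ‖v‖ := by
    by_cases h0 : ‖w‖ = 0
    · rw [h0]; exact norm_nonneg _
    · have hp : 0 < ‖w‖ := lt_of_le_of_ne (norm_nonneg _) (Ne.symm h0)
      rw [h4] at h3
      nlinarith
  exact pow_le_pow_left₀ (norm_nonneg _) h5 2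

theorem sum_whichBlock_diagonal_le {d n : ℕ} (x : Fin d → ℝ) (hx : ∀ i, 0 ≤ x i)
    (hx1 : ∑ i, x i = 1) :
    ∑ l ∈ diagrams d n, whichBlock n (Matrix.diagonal fun i => (x i : ℂ)) l ≤ 1 := by
  simp only [whichBlock_diagonal]
  rw [Finset.sum_comm]
  simp only [← Finset.mul_sum]
  calc _ ≤ ∑ a : Fin n → Fin d, (∏ k, x (a k)) * 1 := by
        refine Finset.sum_le_sum fun a _ => mul_le_mul_of_nonneg_left ?_
          (Finset.prod_nonneg fun k _ => hx _)
        refine (sum_norm_starProjection_block_le _).trans (le_of_eq ?_)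
        simp [wordVec]
    _ = 1 := by
        simp only [mul_one]
        have := Finset.prod_univ_sum (fun _ : Fin n => (Finset.univ : Finset (Fin d)))
          (fun _ i => x i)
        rw [Fintype.piFinset_univ] at this
        rw [← this, hx1]; simp

/-- The vectors of `linearIndependent_block` are eigenvectors of the tensor power, as it commutes
with permutations; the eigenvalue depends only on the filling, so each filling is counted once per
numbering. -/
theorem whichBlock_diagonal_ge {d n : ℕ} {l : Fin d → ℕ} (hl : ∑ i, l i = n) (x : Fin d → ℝ)
    (hx : ∀ i, 0 ≤ x i) {ι κ : Type*} [Fintype ι] [Fintype κ] (s : ι → Equiv.Perm (Fin n))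
    (hs : ∀ i, IsColStandard l hl (s i)) (hinj : Function.Injective fun i => rowFin l hl ∘ s i)
    (T : κ → Fin n → Fin d) (hT : ∀ j, IsAdapted l hl (T j))
    (hTinj : ∀ j j', ∀ σ : Equiv.Perm (Fin n), σ ∈ rowPerms n l → T j ∘ σ = T j' → j = j') :
    (Fintype.card ι : ℝ) * ∑ j, ∏ k, x (T j k) ≤
      whichBlock n (Matrix.diagonal fun i => (x i : ℂ)) l := by
  have h := sum_eigenvalues_le_trace (fun a : Fin n → Fin d => ∏ k, x (a k))
    (fun a => Finset.prod_nonneg fun k _ => hx _) (block l) _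
    (linearIndependent_block s hs hinj T hT hTinj)
    (fun p => Submodule.subset_span ⟨⟨(s p.1)⁻¹, wordVec (T p.2)⟩, by
      simp only [youngSymm_eq]; rfl⟩)
    (fun p => ∏ k, x (T p.2 k)) (fun p => by
      have hD : (Matrix.diagonal fun a : Fin n → Fin d => ((∏ k, x (a k) : ℝ) : ℂ)) =
          tensorPow n (Matrix.diagonal fun i => (x i : ℂ)) := by
        rw [tensorPow_diagonal]; push_cast; rfl
      have hT : Matrix.toEuclideanLin (tensorPow n (Matrix.diagonal fun i => (x i : ℂ)))
          (wordVec (T p.2)) = ((∏ k, x (T p.2 k) : ℝ) : ℂ) • wordVec (T p.2) := by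
        rw [← hD]
        ext a
        rw [toEuclideanLin_diagonal_apply, PiLp.smul_apply, wordVec_apply]
        split_ifs with h
        · rw [h]; simp
        · simp
      rw [hD, tensorPow_permRep, ← youngSymm_eq, tensorPow_youngSymm, hT, youngSymm_eq,
        youngSymm_eq, map_smul, map_smul, map_smul])
  rw [whichBlock_diagonal]
  refine le_trans (le_of_eq ?_) h
  rw [Fintype.sum_prod_type]
  simp


/-! ### Counting ballot words -/

/-- The words of content `l` all of whose prefixes have antitone content. -/
def ballotWords (d n : ℕ) (l : Fin d → ℕ) : Finset (Fin n → Fin d) := by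
  classical exact Finset.univ.filter fun a =>
    (∀ i, (Finset.univ.filter fun k => a k = i).card = l i) ∧
      ∀ m : ℕ, Antitone fun i => (Finset.univ.filter fun k : Fin n => (k : ℕ) < m ∧ a k = i).card

theorem mem_ballotWords {d n : ℕ} {l : Fin d → ℕ} {a : Fin n → Fin d} :
    a ∈ ballotWords d n l ↔ (∀ i, (Finset.univ.filter fun k => a k = i).card = l i) ∧
      ∀ m : ℕ, Antitone fun i =>
        (Finset.univ.filter fun k : Fin n => (k : ℕ) < m ∧ a k = i).card := by
  simp [ballotWords]

theorem exists_colStandard_of_ballot {d n : ℕ} {l : Fin d → ℕ} (hl : ∑ i, l i = n)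
    {a : Fin n → Fin d} (ha : a ∈ ballotWords d n l) :
    ∃ s : Equiv.Perm (Fin n), IsColStandard l hl s ∧ rowFin l hl ∘ s = a := by
  rw [mem_ballotWords] at ha
  obtain ⟨hc, hp⟩ := ha
  set cnt : ℕ → Fin d → ℕ := fun m i =>
    (Finset.univ.filter fun k : Fin n => (k : ℕ) < m ∧ a k = i).card with hcnt
  have hmono : ∀ {m m' : ℕ} (i), m ≤ m' → cnt m i ≤ cnt m' i := by
    intro m m' i h
    refine Finset.card_le_card fun k hk => ?_
    simp only [Finset.mem_filter, Finset.mem_univ, true_and] at hk ⊢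
    exact ⟨by omega, hk.2⟩
  have hsucc : ∀ k : Fin n, cnt k (a k) < cnt (k + 1) (a k) := by
    intro k
    refine Finset.card_lt_card (Finset.ssubset_iff_of_subset ?_ |>.mpr ⟨k, by simp, by simp⟩)
    intro k' hk
    simp only [Finset.mem_filter, Finset.mem_univ, true_and] at hk ⊢
    exact ⟨by omega, hk.2⟩
  have hlt : ∀ k : Fin n, cnt k (a k) < l (a k) := by
    intro k
    refine lt_of_lt_of_le (hsucc k) ?_
    rw [← hc (a k)]
    refine Finset.card_le_card fun k' hk => ?_
    simp only [Finset.mem_filter, Finset.mem_univ, true_and] at hk ⊢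
    exact hk.2
  -- Position k is sent to row `a k` and to the column given by the number of earlier occurrences of
  -- this letter. The ballot condition says exactly that a box higher in a column is filled earlier.
  choose f hf hf' using fun k => exists_box l hl (a k) (hlt k)
  have hfi : Function.Injective f := by
    intro k k' h
    have h1 : a k = a k' := by rw [← hf, ← hf, h]
    have h2 : cnt k (a k) = cnt k' (a k') := by rw [← hf', ← hf', h]
    rcases lt_trichotomy k k' with h3 | h3 | h3
    · have := hsucc k
      have h4 := hmono (a k) (show (k : ℕ) + 1 ≤ k' from h3)
      rw [← h1] at h2; omega
    · exact h3
    · have := hsucc k'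
      have h4 := hmono (a k') (show (k' : ℕ) + 1 ≤ k from h3)
      rw [h1] at h2; omega
  refine ⟨Equiv.ofBijective f ((Fintype.bijective_iff_injective_and_card f).mpr ⟨hfi, rfl⟩),
    ?_, ?_⟩
  · intro k k' hcol hrow
    simp only [Equiv.ofBijective_apply, hf, hf'] at hcol hrow
    by_contra hkk
    push Not at hkk
    have hne : k ≠ k' := by rintro rfl; exact lt_irrefl _ hrow
    have h3 : (k : ℕ) + 1 ≤ k' := lt_of_le_of_ne hkk hne
    have h4 := hmono (a k') h3
    have h5 : cnt (k + 1) (a k) ≤ cnt (k + 1) (a k') := hp (k + 1) hrow.le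
    have h6 := hsucc k
    omega
  · funext k; simp [hf]

theorem card_filter_snoc {d n : ℕ} (a : Fin n → Fin d) (i : Fin d)
    (p : ℕ → Fin d → Prop) [∀ k j, Decidable (p k j)] :
    (Finset.univ.filter fun k : Fin (n + 1) =>
        p k (Fin.snoc (α := fun _ => Fin d) a i k)).card =
      (Finset.univ.filter fun k : Fin n => p k (a k)).card + if p n i then 1 else 0 := by
  rw [Finset.card_filter, Finset.card_filter, Fin.sum_univ_castSucc]
  simp

theorem snoc_mem_ballotWords {d n : ℕ} {l : Fin d → ℕ} (hl : Antitone l) {i : Fin d}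
    (hi : 1 ≤ l i) {a : Fin n → Fin d}
    (ha : a ∈ ballotWords d n (Function.update l i (l i - 1))) :
    (Fin.snoc (α := fun _ => Fin d) a i : Fin (n + 1) → Fin d) ∈ ballotWords d (n + 1) l := by
  rw [mem_ballotWords] at ha ⊢
  obtain ⟨hc, hp⟩ := ha
  have hcont : ∀ j, (Finset.univ.filter fun k : Fin (n + 1) =>
      Fin.snoc (α := fun _ => Fin d) a i k = j).card = l j := by
    intro j
    rw [card_filter_snoc a i (fun _ b => b = j), hc j]
    by_cases h : j = i
    · subst h; simp; omega
    · rw [Function.update_of_ne h, if_neg (Ne.symm h), add_zero]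
  refine ⟨hcont, fun m => ?_⟩
  by_cases hm : m ≤ n
  · have : (fun j => (Finset.univ.filter fun k : Fin (n + 1) => (k : ℕ) < m ∧
        Fin.snoc (α := fun _ => Fin d) a i k = j).card) =
        fun j => (Finset.univ.filter fun k : Fin n => (k : ℕ) < m ∧ a k = j).card := by
      funext j
      rw [card_filter_snoc a i (fun k b => k < m ∧ b = j), if_neg (by omega), add_zero]
    rw [this]; exact hp m
  · have : (fun j => (Finset.univ.filter fun k : Fin (n + 1) => (k : ℕ) < m ∧
        Fin.snoc (α := fun _ => Fin d) a i k = j).card) = l := by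
      funext j
      rw [← hcont j]
      congr 1
      ext k
      simp only [Finset.mem_filter, Finset.mem_univ, true_and, and_iff_right_iff_imp]
      intro _
      omega
    rw [this]; exact hl

/-- Appending the letter i to a ballot word whose content has one i less is injective in the pair of
word and letter. Only this half of the branching rule is needed. -/
theorem sum_card_ballotWords_le {d n : ℕ} {l : Fin d → ℕ} (hl : Antitone l) :
    ∑ i, (if 1 ≤ l i then (ballotWords d n (Function.update l i (l i - 1))).card else 0) ≤
      (ballotWords d (n + 1) l).card := by
  classical
  have : ∑ i, (if 1 ≤ l i then (ballotWords d n (Function.update l i (l i - 1))).card else 0) =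
      ((Finset.univ : Finset (Fin d)).sigma fun i =>
        if 1 ≤ l i then ballotWords d n (Function.update l i (l i - 1)) else ∅).card := by
    rw [Finset.card_sigma]
    refine Finset.sum_congr rfl fun i _ => ?_
    split_ifs <;> simp
  rw [this]
  refine Finset.card_le_card_of_injOn
    (fun p => (Fin.snoc (α := fun _ => Fin d) p.2 p.1 : Fin (n + 1) → Fin d)) ?_ ?_
  · rintro ⟨i, a⟩ h
    simp only [Finset.mem_coe, Finset.mem_sigma, Finset.mem_univ, true_and] at h
    split_ifs at h with h1
    · exact snoc_mem_ballotWords hl h1 h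
    · exact absurd h (Finset.notMem_empty _)
  · rintro ⟨i, a⟩ _ ⟨j, b⟩ _ h
    simp only [Fin.snoc_inj] at h
    obtain ⟨rfl, rfl⟩ := h
    rfl

/-! ### The Vandermonde product -/

/-- The product of the differences `x i - x j`, `i < j`. -/
def diffProd {d : ℕ} (x : Fin d → ℝ) : ℝ := ∏ i, ∏ j ∈ Finset.Ioi i, (x i - x j)

/-- In the Vandermonde determinant the powers may be replaced by any monic polynomials. Rising
factorials are chosen because `v (v+1)(v+2)⋯(v+m)` can be split off at either end. -/
theorem diffProd_neg_eq_det {d : ℕ} (v : Fin d → ℝ) :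
    diffProd (-v) = ∑ σ : Equiv.Perm (Fin d), ((Equiv.Perm.sign σ : ℤ) : ℝ) *
      ∏ i : Fin d, (ascPochhammer ℝ (i : ℕ)).eval (v (σ i)) := by
  have h1 : diffProd (-v) = (Matrix.vandermonde v).det := by
    rw [Matrix.det_vandermonde, diffProd]
    refine Finset.prod_congr rfl fun i _ => Finset.prod_congr rfl fun j _ => ?_
    simp only [Pi.neg_apply]; ring
  rw [h1, Matrix.det_eval_matrixOfPolynomials_eq_det_vandermonde v
    (fun i => ascPochhammer ℝ (i : ℕ)) (fun i => ascPochhammer_natDegree _ _)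
    (fun i => monic_ascPochhammer _ _), Matrix.det_apply']
  rfl

/-- In the determinant expansion, decrementing `x k` changes only the factor at `σ⁻¹ k`; multiplied
by `v k`, this factor returns to the original one times `v k + σ⁻¹ k`. The sum of `σ⁻¹ k` over k
does not depend on σ. -/
theorem sum_mul_diffProd {d : ℕ} (x : Fin d → ℝ) :
    ∑ i, x i * diffProd (x - Pi.single i 1) = (∑ i, x i - ∑ i : Fin d, (i : ℝ)) * diffProd x := by
  obtain ⟨v, rfl⟩ : ∃ v, x = -v := ⟨-x, by simp⟩
  have h1 : ∀ i, (-v - Pi.single i 1 : Fin d → ℝ) = -(v + Pi.single i 1) := fun i => by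
    rw [neg_add, sub_eq_add_neg]
  simp only [h1, diffProd_neg_eq_det, Finset.mul_sum]
  rw [Finset.sum_comm]
  refine Finset.sum_congr rfl fun σ _ => ?_
  have key : ∀ k, v k * ∏ i : Fin d, (ascPochhammer ℝ (i : ℕ)).eval ((v + Pi.single k 1 : Fin d → ℝ) (σ i)) =
      (v k + ((σ⁻¹ k : Fin d) : ℝ)) * ∏ i : Fin d, (ascPochhammer ℝ (i : ℕ)).eval (v (σ i)) := by
    intro k
    rw [← Finset.mul_prod_erase _ _ (Finset.mem_univ (σ⁻¹ k)),
      ← Finset.mul_prod_erase _ (fun i : Fin d => (ascPochhammer ℝ (i : ℕ)).eval (v (σ i)))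
        (Finset.mem_univ (σ⁻¹ k))]
    have h2 : ∏ i ∈ Finset.univ.erase (σ⁻¹ k),
        (ascPochhammer ℝ (i : ℕ)).eval ((v + Pi.single k 1 : Fin d → ℝ) (σ i)) =
        ∏ i ∈ Finset.univ.erase (σ⁻¹ k), (ascPochhammer ℝ (i : ℕ)).eval (v (σ i)) := by
      refine Finset.prod_congr rfl fun i hi => ?_
      have : σ i ≠ k := by
        rintro rfl
        simp at hi
      rw [Pi.add_apply, Pi.single_eq_of_ne this, add_zero]
    rw [h2]
    have hk : σ (σ⁻¹ k) = k := by simp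
    rw [hk, Pi.add_apply, Pi.single_eq_same]
    have h3 : v k * (ascPochhammer ℝ ((σ⁻¹ k : Fin d) : ℕ)).eval (v k + 1) =
        (v k + ((σ⁻¹ k : Fin d) : ℝ)) * (ascPochhammer ℝ ((σ⁻¹ k : Fin d) : ℕ)).eval (v k) := by
      have h4 := congrArg (Polynomial.eval (v k)) (ascPochhammer_succ_left ℝ ((σ⁻¹ k : Fin d) : ℕ))
      rw [ascPochhammer_succ_right] at h4
      simp only [Polynomial.eval_mul, Polynomial.eval_add, Polynomial.eval_X,
        Polynomial.eval_natCast, Polynomial.eval_comp, Polynomial.eval_one] at h4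
      rw [← h4]; ring
    rw [← mul_assoc, h3]; ring
  have h5 : ∀ k, (-v) k * (((Equiv.Perm.sign σ : ℤ) : ℝ) *
      ∏ i : Fin d, (ascPochhammer ℝ (i : ℕ)).eval ((v + Pi.single k 1 : Fin d → ℝ) (σ i))) =
      -((v k + ((σ⁻¹ k : Fin d) : ℝ))) * (((Equiv.Perm.sign σ : ℤ) : ℝ) *
        ∏ i : Fin d, (ascPochhammer ℝ (i : ℕ)).eval (v (σ i))) := by
    intro k
    have := key k
    simp only [Pi.neg_apply]
    linear_combination (-((Equiv.Perm.sign σ : ℤ) : ℝ)) * this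
  simp only [h5]
  rw [← Finset.sum_mul]
  congr 1
  rw [Finset.sum_neg_distrib, Finset.sum_add_distrib,
    Equiv.sum_comp σ⁻¹ (fun i : Fin d => (i : ℝ))]
  simp only [Pi.neg_apply, Finset.sum_neg_distrib]
  ring

/-! ### The determinantal formula for the number of standard tableaux -/

/-- The shifted row lengths `l i + d - 1 - i`. -/
def shiftedRow {d : ℕ} (l : Fin d → ℕ) (i : Fin d) : ℕ := l i + (d - 1 - i)

/-- The number of standard tableaux of shape `l`, by the determinantal formula. -/
def tableauCount {d : ℕ} (n : ℕ) (l : Fin d → ℕ) : ℝ :=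
  n.factorial * diffProd (fun i => (shiftedRow l i : ℝ)) / ∏ i, ((shiftedRow l i).factorial : ℝ)

theorem prod_Ioi_sub_eq_factorial {d : ℕ} (i : Fin d) :
    ∏ j ∈ Finset.Ioi i, ((j : ℝ) - i) = ((d - 1 - i : ℕ).factorial : ℝ) := by
  rw [← Finset.prod_range_add_one_eq_factorial]
  push_cast
  refine Finset.prod_bij (fun j _ => (j : ℕ) - i - 1) ?_ ?_ ?_ ?_
  · intro j hj
    have := j.2
    simp only [Finset.mem_Ioi, Fin.lt_def, Finset.mem_range] at hj ⊢
    omega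
  · intro a ha b hb h
    simp only [Finset.mem_Ioi, Fin.lt_def] at ha hb
    apply Fin.ext; omega
  · intro b hb
    simp only [Finset.mem_range] at hb
    refine ⟨⟨b + i + 1, by omega⟩, ?_, ?_⟩
    · simp only [Finset.mem_Ioi, Fin.lt_def]; omega
    · simp only []; omega
  · intro j hj
    simp only [Finset.mem_Ioi, Fin.lt_def] at hj
    rw [Nat.cast_sub (by omega), Nat.cast_sub (by omega)]
    push_cast; ring

theorem tableauCount_zero {d : ℕ} : tableauCount 0 (0 : Fin d → ℕ) = 1 := by
  unfold tableauCount diffProd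
  have : ∀ i : Fin d, ∏ j ∈ Finset.Ioi i,
      ((shiftedRow (0 : Fin d → ℕ) i : ℝ) - (shiftedRow (0 : Fin d → ℕ) j : ℝ)) =
      ((shiftedRow (0 : Fin d → ℕ) i).factorial : ℝ) := by
    intro i
    simp only [shiftedRow, Pi.zero_apply, zero_add]
    rw [← prod_Ioi_sub_eq_factorial]
    refine Finset.prod_congr rfl fun j hj => ?_
    have h1 := i.2
    have h2 := j.2
    have h3 : ((d - 1 - i : ℕ) : ℝ) = ((d - 1 - j : ℕ) : ℝ) + ((j : ℝ) - i) := by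
      have h4 := Finset.mem_Ioi.mp hj
      rw [Fin.lt_def] at h4
      rw [← Nat.cast_sub h4.le, ← Nat.cast_add]
      congr 1; omega
    rw [h3]; ring
  simp only [this]
  rw [Nat.factorial_zero, Nat.cast_one, one_mul, div_self]
  exact Finset.prod_ne_zero_iff.mpr fun i _ => by positivity

theorem diffProd_eq_zero {d : ℕ} {x : Fin d → ℝ} {i j : Fin d} (hij : i < j) (h : x i = x j) :
    diffProd x = 0 :=
  Finset.prod_eq_zero (Finset.mem_univ i)
    (Finset.prod_eq_zero (Finset.mem_Ioi.mpr hij) (by rw [h, sub_self]))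

theorem sum_shiftedRow {d : ℕ} (l : Fin d → ℕ) :
    ∑ i, (shiftedRow l i : ℝ) - ∑ i : Fin d, (i : ℝ) = ∑ i, (l i : ℝ) := by
  have h1 : ∑ i : Fin d, ((d - 1 - i : ℕ) : ℝ) = ∑ i : Fin d, (i : ℝ) := by
    refine Fintype.sum_equiv Fin.revPerm _ _ fun i => ?_
    simp only [Fin.revPerm_apply, Fin.val_rev]
    congr 1; omega
  simp only [shiftedRow]
  push_cast
  rw [Finset.sum_add_distrib, h1]; ring

theorem tableauCount_succ {d n : ℕ} (l : Fin d → ℕ) (hl : ∑ i, l i = n + 1) :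
    tableauCount (n + 1) l = ∑ i, n.factorial * ((shiftedRow l i : ℝ) *
      diffProd ((fun i => (shiftedRow l i : ℝ)) - Pi.single i 1)) /
        ∏ i, ((shiftedRow l i).factorial : ℝ) := by
  rw [← Finset.sum_div, ← Finset.mul_sum, sum_mul_diffProd (fun i => (shiftedRow l i : ℝ)),
    sum_shiftedRow]
  have : ∑ i, (l i : ℝ) = n + 1 := by exact_mod_cast hl
  rw [this, tableauCount, Nat.factorial_succ]
  push_cast; ring

theorem shiftedRow_update {d : ℕ} (l : Fin d → ℕ) (i : Fin d) (hi : 1 ≤ l i) :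
    (fun j => (shiftedRow (Function.update l i (l i - 1)) j : ℝ)) =
      (fun j => (shiftedRow l j : ℝ)) - Pi.single i 1 := by
  funext j
  by_cases h : j = i
  · subst h
    simp only [shiftedRow, Function.update_self, Pi.sub_apply, Pi.single_eq_same]
    push_cast [Nat.cast_sub hi]; ring
  · simp [shiftedRow, Function.update_of_ne h, Pi.single_eq_of_ne h]

theorem tableauCount_update {d n : ℕ} (l : Fin d → ℕ) (i : Fin d) (hi : 1 ≤ l i) :
    n.factorial * ((shiftedRow l i : ℝ) *
      diffProd ((fun i => (shiftedRow l i : ℝ)) - Pi.single i 1)) /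
        ∏ i, ((shiftedRow l i).factorial : ℝ) =
      tableauCount n (Function.update l i (l i - 1)) := by
  rw [tableauCount, shiftedRow_update l i hi]
  rw [← Finset.mul_prod_erase _ _ (Finset.mem_univ i),
    ← Finset.mul_prod_erase _ (fun j =>
      ((shiftedRow (Function.update l i (l i - 1)) j).factorial : ℝ)) (Finset.mem_univ i)]
  have h1 : ∏ j ∈ Finset.univ.erase i,
      ((shiftedRow (Function.update l i (l i - 1)) j).factorial : ℝ) =
      ∏ j ∈ Finset.univ.erase i, ((shiftedRow l j).factorial : ℝ) := by
    refine Finset.prod_congr rfl fun j hj => ?_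
    simp [shiftedRow, Function.update_of_ne (Finset.ne_of_mem_erase hj)]
  rw [h1]
  have h2 : shiftedRow l i = shiftedRow (Function.update l i (l i - 1)) i + 1 := by
    simp only [shiftedRow, Function.update_self]; omega
  rw [h2, Nat.factorial_succ]
  have h3 : (∏ j ∈ Finset.univ.erase i, ((shiftedRow l j).factorial : ℝ)) ≠ 0 :=
    Finset.prod_ne_zero_iff.mpr fun i _ => by positivity
  have h4 : ((shiftedRow (Function.update l i (l i - 1)) i + 1 : ℕ) : ℝ) ≠ 0 := by positivity
  push_cast at h4 ⊢
  field_simp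

/-- The determinantal count satisfies the recursion of removing a last box with equality, ballot
words satisfy it with an inequality in the favourable direction, and both start from the empty
diagram. -/
theorem tableauCount_le_card_ballotWords {d : ℕ} (n : ℕ) (l : Fin d → ℕ) (hl : ∑ i, l i = n)
    (ha : Antitone l) : tableauCount n l ≤ (ballotWords d n l).card := by
  induction n generalizing l with
  | zero =>
    have h0 : l = 0 := by
      funext i
      exact (Finset.sum_eq_zero_iff.mp hl) i (Finset.mem_univ i)
    subst h0
    rw [tableauCount_zero]
    have : (fun k : Fin 0 => k.elim0) ∈ ballotWords d 0 0 := by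
      rw [mem_ballotWords]
      refine ⟨fun i => by simp, fun m i j _ => by simp⟩
    exact_mod_cast Finset.card_pos.mpr ⟨_, this⟩
  | succ n ih =>
    rw [tableauCount_succ l hl]
    refine le_trans ?_ (Nat.cast_le.mpr (sum_card_ballotWords_le ha))
    push_cast
    refine Finset.sum_le_sum fun i _ => ?_
    -- When rows i and i + 1 have equal length, the box cannot be removed from row i; then the
    -- decremented shifted rows coincide and the difference product vanishes.
    by_cases hnext : ∃ h : (i : ℕ) + 1 < d, l ⟨i + 1, h⟩ = l i
    · obtain ⟨h, hli⟩ := hnext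
      have hlt : i < ⟨i + 1, h⟩ := Fin.lt_def.mpr (Nat.lt_succ_self _)
      rw [diffProd_eq_zero hlt, mul_zero, mul_zero, zero_div]
      · split_ifs
        · exact Nat.cast_nonneg _
        · exact le_rfl
      · rw [Pi.sub_apply, Pi.sub_apply, Pi.single_eq_same, Pi.single_eq_of_ne hlt.ne', sub_zero]
        simp only [shiftedRow, hli]
        have : d - 1 - i = (d - 1 - (i + 1)) + 1 := by omega
        rw [this]; push_cast; ring
    · by_cases hi : 1 ≤ l i
      · rw [if_pos hi, tableauCount_update l i hi]
        refine ih _ ?_ ?_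
        · have h1 := Finset.add_sum_erase Finset.univ l (Finset.mem_univ i)
          rw [← Finset.add_sum_erase _ _ (Finset.mem_univ i), Function.update_self]
          have h2 : ∑ j ∈ Finset.univ.erase i, Function.update l i (l i - 1) j =
              ∑ j ∈ Finset.univ.erase i, l j :=
            Finset.sum_congr rfl fun j hj => Function.update_of_ne (Finset.ne_of_mem_erase hj) _ _
          omega
        · intro j k hjk
          by_cases hj : j = i
          · subst hj
            by_cases hk : k = j
            · subst hk; exact le_rfl
            · have hlt : j < k := lt_of_le_of_ne hjk (Ne.symm hk)
              have hb : (j : ℕ) + 1 < d := lt_of_le_of_lt hlt k.2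
              have h1 : l k ≤ l ⟨j + 1, hb⟩ := ha (Fin.le_def.mpr hlt)
              have h2 : l ⟨j + 1, hb⟩ ≤ l j := ha (Fin.le_def.mpr (Nat.le_succ _))
              have h3 : l ⟨j + 1, hb⟩ ≠ l j := fun h => hnext ⟨hb, h⟩
              rw [Function.update_self, Function.update_of_ne hk]
              omega
          · rw [Function.update_of_ne hj]
            by_cases hk : k = i
            · subst hk; rw [Function.update_self]
              have := ha hjk; omega
            · rw [Function.update_of_ne hk]; exact ha hjk
      · rw [if_neg hi]
        by_cases hlast : (i : ℕ) + 1 < d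
        · exfalso
          refine hnext ⟨hlast, ?_⟩
          have : l ⟨i + 1, hlast⟩ ≤ l i := ha (Fin.le_def.mpr (Nat.le_succ _))
          omega
        -- The last row is empty and its shift is zero, so the factor `shiftedRow l i` kills the
        -- term.
        · have : shiftedRow l i = 0 := by simp only [shiftedRow]; omega
          rw [this]; simp


/-! ### Fillings with letters of lower rows at the row ends -/

/-- The pairs `i < j`. -/
abbrev RowPair (d : ℕ) : Type := {p : Fin d × Fin d // p.1 < p.2}

theorem prod_rowPair {d : ℕ} (f : Fin d → Fin d → ℝ) :
    ∏ p : RowPair d, f p.1.1 p.1.2 = ∏ i, ∏ j ∈ Finset.Ioi i, f i j := by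
  rw [← Finset.prod_subtype (Finset.univ.filter fun p : Fin d × Fin d => p.1 < p.2) (by simp)
    (fun p => f p.1 p.2), Finset.prod_filter, Fintype.prod_prod_type]
  refine Finset.prod_congr rfl fun i _ => ?_
  rw [← Finset.prod_filter]
  congr 1; ext j; simp

/-- The entry of the box at distance `c` from the end of row `i`, in the filling with `m i j`
letters `j` in row `i`. -/
def endLetter {d K : ℕ} (m : RowPair d → Fin (K + 1)) (i : Fin d) (c : ℕ) : Fin d :=
  -- Measured from the end of row i, the places are cut into segments of length K. Segment number j
  -- is reserved for the letter j and its first `m i j` places carry it, if `i < j`.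
  if h : ∃ h' : c / K < d, ∃ hlt : i < ⟨c / K, h'⟩, c % K < m ⟨(i, ⟨c / K, h'⟩), hlt⟩
  then ⟨c / K, h.1⟩ else i

/-- The filling with `m i j` letters `j` in row `i`, for `i < j`. -/
def endFilling {d n K : ℕ} (l : Fin d → ℕ) (hl : ∑ i, l i = n) (m : RowPair d → Fin (K + 1))
    (k : Fin n) : Fin d :=
  endLetter m (rowFin l hl k) (l (rowFin l hl k) - 1 - boxCol l k)

theorem le_endLetter {d K : ℕ} (m : RowPair d → Fin (K + 1)) (i : Fin d) (c : ℕ) :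
    i ≤ endLetter m i c := by
  unfold endLetter
  split_ifs with h
  · obtain ⟨_, h2, _⟩ := h; exact h2.le
  · exact le_rfl

theorem endLetter_eq_of_le {d K : ℕ} (m : RowPair d → Fin (K + 1)) (i : Fin d) {c : ℕ}
    (hc : d * K ≤ c) : endLetter m i c = i := by
  unfold endLetter
  rw [dif_neg]
  rintro ⟨h, hlt, _⟩
  rcases Nat.eq_zero_or_pos K with hK | hK
  · rw [Fin.lt_def] at hlt
    simp [hK] at hlt
  · have := (Nat.div_lt_iff_lt_mul hK).mp h
    omega

theorem endLetter_eq_iff {d K : ℕ} (m : RowPair d → Fin (K + 1)) {i j : Fin d} (hij : i < j)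
    (c : ℕ) : endLetter m i c = j ↔ c / K = j ∧ c % K < m ⟨(i, j), hij⟩ := by
  unfold endLetter
  constructor
  · intro h
    split_ifs at h with h1
    · obtain ⟨h2, h3, h4⟩ := h1
      subst h
      exact ⟨rfl, h4⟩
    · exact absurd h hij.ne
  · rintro ⟨h1, h2⟩
    have h3 : c / K < d := h1 ▸ j.2
    have h4 : (⟨c / K, h3⟩ : Fin d) = j := Fin.ext h1
    rw [dif_pos]
    · exact h4
    · refine ⟨h3, by rw [h4]; exact hij, ?_⟩
      convert h2

/-- A box with another one below it lies at distance at least `l i - l j ≥ d * K` from the end of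
its row, beyond all reserved segments. -/
theorem isAdapted_endFilling {d n K : ℕ} {l : Fin d → ℕ} (hl : ∑ i, l i = n)
    (hK : ∀ i j, i < j → d * K + l j ≤ l i) (m : RowPair d → Fin (K + 1)) :
    IsAdapted l hl (endFilling l hl m) := by
  refine ⟨fun k => le_endLetter _ _ _, fun k k' hc hr => endLetter_eq_of_le _ _ ?_⟩
  have h1 := hK _ _ hr
  have h2 := boxCol_lt l hl k'
  rw [hc] at h2
  omega

theorem card_endFilling {d n K : ℕ} {l : Fin d → ℕ} (hl : ∑ i, l i = n)
    (hK : ∀ i j, i < j → d * K + l j ≤ l i) (m : RowPair d → Fin (K + 1)) {i j : Fin d}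
    (hij : i < j) :
    (Finset.univ.filter fun k => rowFin l hl k = i ∧ endFilling l hl m k = j).card =
      m ⟨(i, j), hij⟩ := by
  have h1 : (Finset.univ.filter fun k => rowFin l hl k = i ∧ endFilling l hl m k = j) =
      Finset.univ.filter fun k => rowFin l hl k = i ∧
        endLetter m i (l i - 1 - boxCol l k) = j := by
    refine Finset.filter_congr fun k _ => ?_
    unfold endFilling
    constructor
    · rintro ⟨rfl, h⟩; exact ⟨rfl, h⟩
    · rintro ⟨rfl, h⟩; exact ⟨rfl, h⟩
  rw [h1, card_box_filter l hl i (fun c => endLetter m i (l i - 1 - c) = j)]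
  have hm := (m ⟨(i, j), hij⟩).2
  have hd : (j : ℕ) * K + K ≤ l i := by
    have h2 := hK i j hij
    have h3 : ((j : ℕ) + 1) * K ≤ d * K := Nat.mul_le_mul_right K j.2
    rw [add_mul, one_mul] at h3
    omega
  rw [← Finset.card_range (m ⟨(i, j), hij⟩ : ℕ)]
  -- The boxes with letter j correspond to the offset t inside segment j; columns are counted from
  -- zero, whence the `- 1`.
  refine Finset.card_bij' (fun c _ => (l i - 1 - c) % K) (fun t _ => l i - 1 - (j * K + t))
    ?_ ?_ ?_ ?_
  · intro c hc
    simp only [Finset.mem_filter, endLetter_eq_iff m hij] at hc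
    exact Finset.mem_range.mpr hc.2.2
  · intro t ht
    rw [Finset.mem_range] at ht
    have htK : t < K := by omega
    simp only [Finset.mem_filter, endLetter_eq_iff m hij, Finset.mem_range]
    have h4 : l i - 1 - (l i - 1 - (j * K + t)) = t + K * j := by
      rw [mul_comm (K : ℕ)]; omega
    rw [h4]
    refine ⟨by omega, ?_, ?_⟩
    · rw [Nat.add_mul_div_left _ _ (by omega), Nat.div_eq_of_lt htK, zero_add]
    · rw [Nat.add_mul_mod_self_left, Nat.mod_eq_of_lt htK]; exact ht
  · intro c hc
    simp only [Finset.mem_filter, endLetter_eq_iff m hij, Finset.mem_range] at hc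
    have h5 := Nat.div_add_mod' (l i - 1 - c) K
    rw [hc.2.1] at h5
    rw [h5]
    omega
  · intro t ht
    rw [Finset.mem_range] at ht
    have htK : t < K := by omega
    have h4 : l i - 1 - (l i - 1 - (j * K + t)) = t + K * j := by
      rw [mul_comm (K : ℕ)]; omega
    simp only [h4]
    rw [Nat.add_mul_mod_self_left, Nat.mod_eq_of_lt htK]

/-- A row permutation preserves the number of letters j in row i, and these numbers are the
parameters m. -/
theorem endFilling_injective {d n K : ℕ} {l : Fin d → ℕ} (hl : ∑ i, l i = n)
    (hK : ∀ i j, i < j → d * K + l j ≤ l i) (m m' : RowPair d → Fin (K + 1))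
    (σ : Equiv.Perm (Fin n)) (hσ : σ ∈ rowPerms n l)
    (h : endFilling l hl m ∘ σ = endFilling l hl m') : m = m' := by
  funext ⟨⟨i, j⟩, hij⟩
  apply Fin.ext
  rw [← card_endFilling hl hK m hij, ← card_endFilling hl hK m' hij]
  have hr : ∀ k, rowFin l hl (σ k) = rowFin l hl k := fun k => Fin.ext (by
    rw [← boxRow_eq_rowFin, ← boxRow_eq_rowFin]; exact mem_rowPerms.mp hσ k)
  refine Finset.card_bij (fun k _ => σ⁻¹ k) ?_ ?_ ?_
  · intro k hk
    simp only [Finset.mem_filter, Finset.mem_univ, true_and] at hk ⊢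
    rw [← h, ← hr]
    simpa using hk
  · intro a _ b _ hab; exact σ⁻¹.injective hab
  · intro k hk
    simp only [Finset.mem_filter, Finset.mem_univ, true_and] at hk
    refine ⟨σ k, ?_, by simp⟩
    simp only [Finset.mem_filter, Finset.mem_univ, true_and]
    rw [hr]
    exact ⟨hk.1, by rw [← hk.2, ← h]; rfl⟩

theorem prod_endFilling {d n K : ℕ} {l : Fin d → ℕ} (hl : ∑ i, l i = n)
    (hK : ∀ i j, i < j → d * K + l j ≤ l i) (m : RowPair d → Fin (K + 1)) {x : Fin d → ℝ}
    (hx : ∀ i, 0 < x i) :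
    ∏ k, x (endFilling l hl m k) =
      (∏ i, x i ^ l i) * ∏ p : RowPair d, (x p.1.2 / x p.1.1) ^ (m p : ℕ) := by
  have h1 : ∏ i, x i ^ l i = ∏ k, x (rowFin l hl k) := by
    rw [← Finset.prod_fiberwise_of_maps_to (g := rowFin l hl) (t := Finset.univ)
      (fun _ _ => Finset.mem_univ _)]
    refine Finset.prod_congr rfl fun i _ => ?_
    rw [Finset.prod_congr rfl (g := fun _ => x i), Finset.prod_const, card_row]
    intro k hk
    rw [(Finset.mem_filter.mp hk).2]
  have h2 : ∏ p : RowPair d, (x p.1.2 / x p.1.1) ^ (m p : ℕ) =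
      ∏ k, (x (endFilling l hl m k) / x (rowFin l hl k)) := by
    rw [← Finset.prod_fiberwise_of_maps_to (s := Finset.univ)
      (g := fun k => (rowFin l hl k, endFilling l hl m k))
      (t := Finset.univ) (fun _ _ => Finset.mem_univ _)]
    have h3 : ∀ p : Fin d × Fin d, ∏ k ∈ Finset.univ.filter
        (fun k => (rowFin l hl k, endFilling l hl m k) = p),
          (x (endFilling l hl m k) / x (rowFin l hl k)) =
        if h : p.1 < p.2 then (x p.2 / x p.1) ^ (m ⟨p, h⟩ : ℕ) else 1 := by
      rintro ⟨i, j⟩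
      simp only [Prod.mk.injEq]
      split_ifs with h
      · rw [← card_endFilling hl hK m h, ← Finset.prod_const]
        refine Finset.prod_congr rfl fun k hk => ?_
        simp only [Finset.mem_filter, Finset.mem_univ, true_and] at hk
        rw [hk.1, hk.2]
      · refine Finset.prod_eq_one fun k hk => ?_
        simp only [Finset.mem_filter, Finset.mem_univ, true_and] at hk
        have h4 : i ≤ j := by
          rw [← hk.1, ← hk.2]; exact le_endLetter _ _ _
        have h5 : i = j := le_antisymm h4 (not_lt.mp h)
        rw [hk.1, hk.2, h5, div_self (hx j).ne']
    rw [Finset.prod_congr rfl fun p _ => h3 p]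
    symm
    rw [← Finset.prod_subset (Finset.subset_univ
      (Finset.univ.filter fun p : Fin d × Fin d => p.1 < p.2))]
    · rw [Finset.prod_subtype (Finset.univ.filter fun p : Fin d × Fin d => p.1 < p.2)
        (p := fun p => p.1 < p.2) (by simp)]
      refine Finset.prod_congr rfl fun p _ => ?_
      rw [dif_pos p.2]
    · intro p _ hp
      rw [dif_neg (by simpa using hp)]
  rw [h1, h2, ← Finset.prod_mul_distrib]
  refine Finset.prod_congr rfl fun k _ => ?_
  rw [mul_div_cancel₀ _ (hx _).ne']

/-- Lower bound for the block probabilities by the number of standard tableaux and the leading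
part of the Schur polynomial. -/
theorem whichBlock_diagonal_ge_tableauCount {d n K : ℕ} {l : Fin d → ℕ} (hl : ∑ i, l i = n)
    (ha : Antitone l) (hK : ∀ i j, i < j → d * K + l j ≤ l i) {x : Fin d → ℝ}
    (hx : ∀ i, 0 < x i) :
    tableauCount n l * ((∏ i, x i ^ l i) *
      ∏ i, ∏ j ∈ Finset.Ioi i, ∑ t ∈ Finset.range (K + 1), (x j / x i) ^ t) ≤
      whichBlock n (Matrix.diagonal fun i => (x i : ℂ)) l := by
  choose s hs hs' using fun a : ballotWords d n l => exists_colStandard_of_ballot hl a.2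
  have h := whichBlock_diagonal_ge hl x (fun i => (hx i).le) s hs
    (fun a b hab => Subtype.ext (by
      have h1 : rowFin l hl ∘ s a = rowFin l hl ∘ s b := hab
      rwa [hs', hs'] at h1))
    (endFilling (K := K) l hl) (isAdapted_endFilling hl hK) (endFilling_injective hl hK)
  refine le_trans ?_ h
  rw [Fintype.card_coe]
  have h2 : ∑ m : RowPair d → Fin (K + 1), ∏ k, x (endFilling l hl m k) =
      (∏ i, x i ^ l i) *
        ∏ i, ∏ j ∈ Finset.Ioi i, ∑ t ∈ Finset.range (K + 1), (x j / x i) ^ t := by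
    simp only [prod_endFilling hl hK _ hx]
    rw [← Finset.mul_sum, ← prod_rowPair fun i j => ∑ t ∈ Finset.range (K + 1), (x j / x i) ^ t]
    congr 1
    have h3 := Finset.prod_univ_sum (fun _ : RowPair d => (Finset.univ : Finset (Fin (K + 1))))
      (fun p t => (x p.1.2 / x p.1.1) ^ (t : ℕ))
    rw [Fintype.piFinset_univ] at h3
    rw [← h3]
    refine Finset.prod_congr rfl fun p _ => ?_
    rw [Finset.sum_range]
  rw [h2]
  refine mul_le_mul_of_nonneg_right (tableauCount_le_card_ballotWords n l hl ha) ?_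
  refine mul_nonneg (Finset.prod_nonneg fun i _ => pow_nonneg (hx i).le _) ?_
  exact Finset.prod_nonneg fun i _ => Finset.prod_nonneg fun j _ => Finset.sum_nonneg fun t _ =>
    pow_nonneg (div_nonneg (hx j).le (hx i).le) _


/-! ### The Gaussian density -/

/-- The quadratic form of the inverse of `covV μ`. -/
def quadForm {r : ℕ} (μ : Fin (r + 1) → ℝ) (v : Fin r → ℝ) : ℝ :=
  ∑ i : Fin r, v i ^ 2 / μ i.castSucc + (∑ i, v i) ^ 2 / μ (Fin.last r)

/-- The inverse of `covV μ`. -/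
def precision {r : ℕ} (μ : Fin (r + 1) → ℝ) : Matrix (Fin r) (Fin r) ℝ :=
  Matrix.of fun i j => (if i = j then (μ i.castSucc)⁻¹ else 0) + (μ (Fin.last r))⁻¹

theorem covV_mul_precision {r : ℕ} {μ : Fin (r + 1) → ℝ} (hμ : ∀ i, 0 < μ i)
    (h1 : ∑ i, μ i = 1) : covV μ * precision μ = 1 := by
  rw [Fin.sum_univ_castSucc] at h1
  ext i k
  have hi := (hμ i.castSucc).ne'
  have hk := (hμ k.castSucc).ne'
  have hl := (hμ (Fin.last r)).ne'
  simp only [Matrix.mul_apply, covV, precision, Matrix.of_apply, sub_mul, mul_add, ite_mul, mul_ite,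
    zero_mul, mul_zero, Finset.sum_sub_distrib, Finset.sum_add_distrib, Finset.sum_ite_eq,
    Finset.sum_ite_eq', Finset.mem_univ, if_true, Matrix.one_apply, ← Finset.sum_mul,
    ← Finset.mul_sum]
  have h2 : ∑ i : Fin r, μ i.castSucc = 1 - μ (Fin.last r) := by linarith
  rw [h2]
  by_cases h : i = k
  · subst h; rw [if_pos rfl, if_pos rfl]; field_simp; ring
  · rw [if_neg h, if_neg h]; field_simp; ring

theorem inv_covV {r : ℕ} {μ : Fin (r + 1) → ℝ} (hμ : ∀ i, 0 < μ i)
    (h1 : ∑ i, μ i = 1) : (covV μ)⁻¹ = precision μ :=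
  Matrix.inv_eq_right_inv (covV_mul_precision hμ h1)

/-- The covariance is a diagonal matrix times a rank-one perturbation of the identity; the latter
has determinant `1 - ∑ μ_i` over the first r indices, which is the last eigenvalue. -/
theorem det_covV {r : ℕ} {μ : Fin (r + 1) → ℝ} (h1 : ∑ i, μ i = 1) :
    (covV μ).det = ∏ i, μ i := by
  have h : covV μ = Matrix.diagonal (fun i : Fin r => μ i.castSucc) *
      (1 + Matrix.replicateCol Unit (fun _ => (1 : ℝ)) *
        Matrix.replicateRow Unit (fun i : Fin r => -μ i.castSucc)) := by
    ext i j
    rw [Matrix.diagonal_mul]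
    simp only [covV, Matrix.of_apply, Matrix.add_apply, Matrix.one_apply, Matrix.mul_apply,
      Matrix.replicateCol_apply, Matrix.replicateRow_apply, Finset.univ_unique,
      Finset.sum_singleton]
    split_ifs <;> ring
  rw [h, Matrix.det_mul, Matrix.det_diagonal, Matrix.det_one_add_replicateCol_mul_replicateRow,
    Fin.prod_univ_castSucc]
  rw [Fin.sum_univ_castSucc] at h1
  congr 1
  simp only [dotProduct, mul_one, Finset.sum_neg_distrib]
  linarith

theorem dotProduct_precision {r : ℕ} (μ : Fin (r + 1) → ℝ) (v : Fin r → ℝ) :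
    dotProduct v ((precision μ).mulVec v) = quadForm μ v := by
  simp only [dotProduct, Matrix.mulVec, precision, Matrix.of_apply, add_mul, ite_mul, zero_mul,
    Finset.sum_add_distrib, Finset.sum_ite_eq, Finset.mem_univ, if_true, quadForm, mul_add,
    ← Finset.mul_sum]
  congr 1
  · refine Finset.sum_congr rfl fun i _ => ?_
    rw [div_eq_mul_inv]; ring
  · rw [← Finset.sum_mul, div_eq_mul_inv]; ring

theorem gaussDensity_eq {r : ℕ} {μ : Fin (r + 1) → ℝ} (hμ : ∀ i, 0 < μ i)
    (h1 : ∑ i, μ i = 1) (u x : Fin r → ℝ) :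
    gaussDensity μ u x =
      (Real.sqrt ((2 * Real.pi) ^ r * ∏ i, μ i))⁻¹ * Real.exp (-(1 / 2) * quadForm μ (x - u)) := by
  rw [gaussDensity, inv_covV hμ h1, det_covV h1, dotProduct_precision]

theorem quadForm_nonneg {r : ℕ} {μ : Fin (r + 1) → ℝ} (hμ : ∀ i, 0 < μ i) (v : Fin r → ℝ) :
    0 ≤ quadForm μ v :=
  add_nonneg (Finset.sum_nonneg fun _ _ => div_nonneg (sq_nonneg _) (hμ _).le)
    (div_nonneg (sq_nonneg _) (hμ _).le)

theorem continuous_quadForm {r : ℕ} (μ : Fin (r + 1) → ℝ) : Continuous (quadForm μ) := by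
  unfold quadForm
  fun_prop

theorem sqrt_pow_eq {x : ℝ} (hx : 0 ≤ x) (r : ℕ) : Real.sqrt (x ^ r) = Real.sqrt x ^ r := by
  have h : x ^ r = (Real.sqrt x ^ r) ^ 2 := by
    rw [← pow_mul, mul_comm, pow_mul, Real.sq_sqrt hx]
  rw [h, Real.sqrt_sq (by positivity)]

theorem integral_exp_neg_mul_quadForm {r : ℕ} {μ : Fin (r + 1) → ℝ} (hμ : ∀ i, 0 < μ i)
    (h1 : ∑ i, μ i = 1) {c : ℝ} (hc : 0 < c) :
    Integrable (fun v : Fin r → ℝ => Real.exp (-c * quadForm μ v)) ∧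
      ∫ v : Fin r → ℝ, Real.exp (-c * quadForm μ v) =
        Real.sqrt (Real.pi / c) ^ r * Real.sqrt (∏ i, μ i) := by
  have hpsd : (precision μ).PosSemidef := by
    refine Matrix.PosSemidef.of_dotProduct_mulVec_nonneg ?_ fun v => ?_
    · ext i j
      simp only [Matrix.conjTranspose_apply, precision, Matrix.of_apply, star_trivial]
      by_cases h : i = j
      · subst h; rfl
      · rw [if_neg h, if_neg (Ne.symm h)]
    · rw [star_trivial, dotProduct_precision]; exact quadForm_nonneg hμ v
  -- Factoring the precision matrix as `Bᵀ B` turns the quadratic form into a sum of squares, and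
  -- the substitution `y = B v` reduces the integral to a product of one-dimensional Gaussian
  -- integrals.
  obtain ⟨B, hB⟩ : ∃ B : Matrix (Fin r) (Fin r) ℝ, precision μ = B.transpose * B := by
    open scoped MatrixOrder in
    obtain ⟨B, hB⟩ := CStarAlgebra.nonneg_iff_eq_star_mul_self.mp hpsd.nonneg
    exact ⟨B, by rw [hB, Matrix.star_eq_conjTranspose, Matrix.conjTranspose_eq_transpose_of_trivial]⟩
  have hpos : 0 < ∏ i, μ i := Finset.prod_pos fun i _ => hμ i
  have hdet : B.det ^ 2 * ∏ i, μ i = 1 := by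
    have h2 := congrArg Matrix.det (covV_mul_precision hμ h1)
    rw [Matrix.det_mul, det_covV h1, hB, Matrix.det_mul, Matrix.det_transpose,
      Matrix.det_one] at h2
    linarith
  have hB0 : B.det ≠ 0 := by
    intro h; rw [h] at hdet; simp at hdet
  have hQ : ∀ v, quadForm μ v = ∑ i, (B.mulVec v i) ^ 2 := by
    intro v
    rw [← dotProduct_precision, hB, ← Matrix.mulVec_mulVec, Matrix.dotProduct_mulVec,
      Matrix.vecMul_transpose]
    simp only [dotProduct, sq]
  set f : (Fin r → ℝ) → ℝ := fun y => ∏ i, Real.exp (-c * y i ^ 2) with hf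
  have hfQ : ∀ v, Real.exp (-c * quadForm μ v) = f (Matrix.toLin' B v) := by
    intro v
    rw [hf, hQ]
    simp only [Matrix.toLin'_apply]
    rw [Finset.mul_sum, Real.exp_sum]
  have hfint : Integrable f := Integrable.fintype_prod fun _ => integrable_exp_neg_mul_sq hc
  have hfI : ∫ y, f y = Real.sqrt (Real.pi / c) ^ r := by
    rw [hf, integral_fintype_prod_volume_eq_prod (f := fun (_ : Fin r) y => Real.exp (-c * y ^ 2))]
    simp only [integral_gaussian, Finset.prod_const, Finset.card_univ, Fintype.card_fin]
  have hmap := Real.map_matrix_volume_pi_eq_smul_volume_pi hB0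
  have hmeas : Measurable (Matrix.toLin' B) :=
    (LinearMap.continuous_of_finiteDimensional _).measurable
  have hfm : AEStronglyMeasurable f (Measure.map (Matrix.toLin' B) volume) := by
    refine Continuous.aestronglyMeasurable ?_
    rw [hf]; fun_prop
  have habs : |(B.det)⁻¹| = Real.sqrt (∏ i, μ i) := by
    rw [← Real.sqrt_sq_eq_abs]
    congr 1
    have : B.det ^ 2 ≠ 0 := pow_ne_zero _ hB0
    field_simp
    linarith
  simp only [hfQ]
  constructor
  · have h3 : Integrable f (Measure.map (Matrix.toLin' B) volume) := by
      rw [hmap]; exact hfint.smul_measure ENNReal.ofReal_ne_top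
    exact (integrable_map_measure hfm hmeas.aemeasurable).mp h3
  · rw [← integral_map hmeas.aemeasurable hfm, hmap, integral_smul_measure, hfI,
      ENNReal.toReal_ofReal (abs_nonneg _), habs, smul_eq_mul, mul_comm]

theorem integrable_gaussDensity {r : ℕ} {μ : Fin (r + 1) → ℝ} (hμ : ∀ i, 0 < μ i)
    (h1 : ∑ i, μ i = 1) (u : Fin r → ℝ) : Integrable (gaussDensity μ u) := by
  have h := ((integral_exp_neg_mul_quadForm hμ h1 (c := 1 / 2) (by norm_num)).1.comp_sub_right
    u).const_mul (Real.sqrt ((2 * Real.pi) ^ r * ∏ i, μ i))⁻¹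
  exact h.congr (Filter.Eventually.of_forall fun x => (gaussDensity_eq hμ h1 u x).symm)

theorem integral_gaussDensity {r : ℕ} {μ : Fin (r + 1) → ℝ} (hμ : ∀ i, 0 < μ i)
    (h1 : ∑ i, μ i = 1) (u : Fin r → ℝ) : ∫ x, gaussDensity μ u x = 1 := by
  simp only [gaussDensity_eq hμ h1]
  have hpos : 0 < ∏ i, μ i := Finset.prod_pos fun i _ => hμ i
  rw [integral_const_mul, integral_sub_right_eq_self
    (fun v => Real.exp (-(1 / 2) * quadForm μ v)) u,
    (integral_exp_neg_mul_quadForm hμ h1 (c := 1 / 2) (by norm_num)).2,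
    Real.sqrt_mul (by positivity), sqrt_pow_eq (by positivity) r]
  have : Real.pi / (1 / 2) = 2 * Real.pi := by ring
  rw [this]
  have h2 : Real.sqrt (2 * Real.pi) ≠ 0 := by positivity
  have h3 : Real.sqrt (∏ i, μ i) ≠ 0 := by positivity
  field_simp

theorem gaussDensity_nonneg {r : ℕ} (μ : Fin (r + 1) → ℝ) (u x : Fin r → ℝ) :
    0 ≤ gaussDensity μ u x :=
  mul_nonneg (inv_nonneg.mpr (Real.sqrt_nonneg _)) (Real.exp_pos _).le

/-- The tails of the Gaussian density. -/
theorem setIntegral_gaussDensity_le {r : ℕ} {μ : Fin (r + 1) → ℝ} (hμ : ∀ i, 0 < μ i)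
    (h1 : ∑ i, μ i = 1) (u : Fin r → ℝ) (t : ℝ) :
    ∫ x in {x | t < quadForm μ (x - u)}, gaussDensity μ u x ≤
      Real.sqrt 2 ^ r * Real.exp (-(t / 4)) := by
  have hpos : 0 < ∏ i, μ i := Finset.prod_pos fun i _ => hμ i
  set A := (Real.sqrt ((2 * Real.pi) ^ r * ∏ i, μ i))⁻¹ with hA
  have hA0 : 0 ≤ A := inv_nonneg.mpr (Real.sqrt_nonneg _)
  obtain ⟨hi, hI⟩ := integral_exp_neg_mul_quadForm hμ h1 (c := 1 / 4) (by norm_num)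
  have hg : Integrable fun x => A * Real.exp (-(t / 4)) *
      Real.exp (-(1 / 4) * quadForm μ (x - u)) := (hi.comp_sub_right u).const_mul _
  have hmeas : MeasurableSet {x : Fin r → ℝ | t < quadForm μ (x - u)} :=
    (isOpen_lt continuous_const
      ((continuous_quadForm μ).comp (continuous_id.sub continuous_const))).measurableSet
  calc ∫ x in {x | t < quadForm μ (x - u)}, gaussDensity μ u x
      ≤ ∫ x in {x | t < quadForm μ (x - u)}, A * Real.exp (-(t / 4)) *
          Real.exp (-(1 / 4) * quadForm μ (x - u)) := by
        refine setIntegral_mono_on (integrable_gaussDensity hμ h1 u).integrableOn hg.integrableOn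
          hmeas fun x hx => ?_
        -- Half of the exponent is spent on the factor `exp (-(t / 4))`, the other half keeps the
        -- integral finite.
        rw [gaussDensity_eq hμ h1, mul_assoc, ← Real.exp_add]
        refine mul_le_mul_of_nonneg_left (Real.exp_le_exp.mpr ?_) hA0
        have : t < quadForm μ (x - u) := hx
        linarith
    _ ≤ ∫ x, A * Real.exp (-(t / 4)) * Real.exp (-(1 / 4) * quadForm μ (x - u)) :=
        setIntegral_le_integral hg (Filter.Eventually.of_forall fun x => by positivity)
    _ = Real.sqrt 2 ^ r * Real.exp (-(t / 4)) := by
        rw [integral_const_mul, integral_sub_right_eq_self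
          (fun v => Real.exp (-(1 / 4) * quadForm μ v)) u, hI, hA, Real.sqrt_mul (by positivity),
          sqrt_pow_eq (by positivity) r]
        -- Halving the exponent doubles the covariance, which costs `√2` in each coordinate.
        have : Real.pi / (1 / 4) = 2 * (2 * Real.pi) := by ring
        rw [this, Real.sqrt_mul (by norm_num) (2 * Real.pi), mul_pow]
        have h2 : Real.sqrt (2 * Real.pi) ≠ 0 := by positivity
        have h3 : Real.sqrt (∏ i, μ i) ≠ 0 := by positivity
        field_simp


/-! ### Elementary estimates -/

theorem exp_neg_two_mul_le {t : ℝ} (h0 : 0 ≤ t) (h1 : t ≤ 1 / 2) :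
    Real.exp (-(2 * t)) ≤ 1 - t := by
  have h2 : 0 < 1 - t := by linarith
  rw [Real.exp_neg, inv_le_comm₀ (Real.exp_pos _) h2]
  refine le_trans ?_ (Real.add_one_le_exp (2 * t))
  rw [inv_le_iff_one_le_mul₀ h2]
  nlinarith

theorem exp_neg_le_one_div {t : ℝ} (h0 : 0 < t) : Real.exp (-t) ≤ 1 / t := by
  rw [Real.exp_neg, ← one_div]
  exact one_div_le_one_div_of_le h0 (by linarith [Real.add_one_le_exp t])

/-- The logarithm of the Stirling sequence decreases by at most `1/(12k) - 1/(12(k+1))` at each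
step. So after subtracting `1/(12k)` it increases to its limit `log √π`, and is at most this limit.
-/
theorem log_factorial_le {m : ℕ} (hm : m ≠ 0) :
    Real.log m.factorial ≤ m * Real.log m - m + Real.log m / 2 + Real.log (2 * Real.pi) / 2 +
      1 / (12 * m) := by
  obtain ⟨k, rfl⟩ := Nat.exists_eq_succ_of_ne_zero hm
  have hmono : Monotone fun k : ℕ =>
      Real.log (Stirling.stirlingSeq (k + 1)) - 1 / (12 * ((k : ℝ) + 1)) := by
    refine monotone_nat_of_le_succ fun k => ?_
    have h := Stirling.log_stirlingSeq_sdiff_le (k + 1)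
    have h2 : 1 / (12 * ((k + 1 : ℕ) : ℝ) * (((k + 1 : ℕ) : ℝ) + 1)) =
        1 / (12 * ((k : ℝ) + 1)) - 1 / (12 * (((k + 1 : ℕ) : ℝ) + 1)) := by
      push_cast; field_simp; ring
    rw [h2] at h
    linarith
  have hlim : Filter.Tendsto (fun k : ℕ =>
      Real.log (Stirling.stirlingSeq (k + 1)) - 1 / (12 * ((k : ℝ) + 1))) Filter.atTop
      (nhds (Real.log (Real.sqrt Real.pi) - 0)) := by
    refine Filter.Tendsto.sub ?_ ?_
    · refine Filter.Tendsto.log ?_ (by positivity)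
      exact Stirling.tendsto_stirlingSeq_sqrt_pi.comp (Filter.tendsto_add_atTop_nat 1)
    · have h := (tendsto_one_div_add_atTop_nhds_zero_nat (𝕜 := ℝ)).const_mul (1 / 12)
      rw [mul_zero] at h
      refine h.congr fun k => ?_
      field_simp
  have h := hmono.ge_of_tendsto hlim k
  simp only [sub_zero] at h
  rw [Stirling.log_stirlingSeq_formula, Real.log_sqrt Real.pi_pos.le] at h
  have hk : (0 : ℝ) < ((k + 1 : ℕ) : ℝ) := by positivity
  rw [Real.log_mul two_ne_zero hk.ne', Real.log_div hk.ne' (Real.exp_pos _).ne',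
    Real.log_exp] at h
  rw [Nat.succ_eq_add_one, Real.log_mul two_ne_zero Real.pi_ne_zero]
  have h3 : 1 / (12 * ((k : ℝ) + 1)) = 1 / (12 * ((k + 1 : ℕ) : ℝ)) := by push_cast; rfl
  rw [h3] at h
  linarith

theorem one_add_mul_log_le {t : ℝ} (ht : |t| ≤ 1 / 2) :
    (1 + t) * Real.log (1 + t) ≤ t + t ^ 2 / 2 + 4 * |t| ^ 3 := by
  have h := Real.abs_log_sub_add_sum_range_le (x := -t) (by rw [abs_neg]; linarith) 2
  simp only [Finset.sum_range_succ, Finset.sum_range_zero, abs_neg, sub_neg_eq_add] at h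
  have h2 := (abs_le.mp h).2
  have h3 : |t| ^ (2 + 1) / (1 - |t|) ≤ 2 * |t| ^ 3 := by
    rw [div_le_iff₀ (by linarith)]
    have : 0 ≤ |t| ^ 3 := by positivity
    change |t| ^ 3 ≤ _
    nlinarith
  have h4 : Real.log (1 + t) ≤ t - t ^ 2 / 2 + 2 * |t| ^ 3 := by
    norm_num at h2 h3
    linarith
  have h5 : 0 ≤ 1 + t := by linarith [(abs_le.mp ht).1]
  have h6 : |t ^ 3| = |t| ^ 3 := abs_pow t 3
  have h7 := neg_abs_le (t ^ 3)
  have h8 : 0 ≤ |t| ^ 3 := by positivity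
  have h9 := mul_le_mul_of_nonneg_left h4 h5
  have h10 : t * |t| ^ 3 ≤ 1 / 2 * |t| ^ 3 :=
    mul_le_mul_of_nonneg_right (le_trans (le_abs_self t) ht) h8
  rw [h6] at h7
  nlinarith

/-- Taylor expansion of `(1 + t) log (1 + t)` at `t = w / (s y)`; here s stands for `√n`, y for an
eigenvalue and w for the rescaled deviation of a row length. -/
theorem mul_log_div_le {L s y w : ℝ} (hs : 0 < s) (hy : 0 < y) (hL : L = s ^ 2 * y + s * w)
    (hw : |w| ≤ s * y / 2) :
    L * Real.log (L / (s ^ 2 * y)) ≤ s * w + w ^ 2 / (2 * y) + 4 * |w| ^ 3 / (s * y ^ 2) := by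
  have ht : |w / (s * y)| ≤ 1 / 2 := by
    rw [abs_div, abs_of_pos (mul_pos hs hy), div_le_iff₀ (mul_pos hs hy)]
    linarith
  have h := one_add_mul_log_le ht
  have h1 : L / (s ^ 2 * y) = 1 + w / (s * y) := by rw [hL]; field_simp
  have h2 : L = s ^ 2 * y * (1 + w / (s * y)) := by rw [hL]; field_simp
  rw [h1]
  nth_rewrite 1 [h2]
  rw [mul_assoc]
  refine (mul_le_mul_of_nonneg_left h (by positivity)).trans (le_of_eq ?_)
  rw [abs_div, abs_of_pos (mul_pos hs hy)]
  field_simp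

/-- Comparison of the quadratic forms at nearby points with nearby variances. -/
theorem sq_div_le_add {w e y μ a b δ Z M : ℝ} (hδ : 0 < δ) (hμ : δ ≤ μ) (hy : δ / 2 ≤ y)
    (hwe : |w - e| ≤ a) (hyμ : |y - μ| ≤ b) (he : |e| ≤ Z) (hw : |w| ≤ M) (hZM : Z ≤ M) :
    w ^ 2 / y ≤ e ^ 2 / μ + 4 * a * M / δ + 2 * Z ^ 2 * b / δ ^ 2 := by
  have hy0 : 0 < y := by linarith
  have hμ0 : 0 < μ := by linarith
  have ha : 0 ≤ a := (abs_nonneg _).trans hwe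
  have hb : 0 ≤ b := (abs_nonneg _).trans hyμ
  have hM : 0 ≤ M := (abs_nonneg _).trans hw
  have h1 : w ^ 2 / y = e ^ 2 / μ + (w - e) * (w + e) / y + e ^ 2 * (μ - y) / (y * μ) := by
    field_simp; ring
  have h2 : (w - e) * (w + e) ≤ a * (2 * M) := by
    refine (le_abs_self _).trans ?_
    rw [abs_mul]
    exact mul_le_mul hwe ((abs_add_le _ _).trans (by linarith)) (abs_nonneg _) ha
  have h3 : (w - e) * (w + e) / y ≤ 4 * a * M / δ := by
    rw [div_le_div_iff₀ hy0 hδ]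
    have h4 : (w - e) * (w + e) * δ ≤ a * (2 * M) * δ := mul_le_mul_of_nonneg_right h2 hδ.le
    have h5 : a * (2 * M) * δ ≤ a * (2 * M) * (2 * y) :=
      mul_le_mul_of_nonneg_left (by linarith) (by positivity)
    linarith
  have h6 : e ^ 2 ≤ Z ^ 2 := by
    rw [← sq_abs e]; exact pow_le_pow_left₀ (abs_nonneg _) he 2
  have h7 : e ^ 2 * (μ - y) ≤ Z ^ 2 * b := by
    refine (mul_le_mul_of_nonneg_left ?_ (sq_nonneg e)).trans (mul_le_mul_of_nonneg_right h6 hb)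
    have := (abs_le.mp hyμ).1
    linarith
  have h8 : e ^ 2 * (μ - y) / (y * μ) ≤ 2 * Z ^ 2 * b / δ ^ 2 := by
    rw [div_le_div_iff₀ (by positivity) (by positivity)]
    have h9 : δ ^ 2 ≤ 2 * (y * μ) := by nlinarith
    calc e ^ 2 * (μ - y) * δ ^ 2 ≤ Z ^ 2 * b * δ ^ 2 :=
          mul_le_mul_of_nonneg_right h7 (by positivity)
      _ ≤ Z ^ 2 * b * (2 * (y * μ)) := mul_le_mul_of_nonneg_left h9 (by positivity)
      _ = 2 * Z ^ 2 * b * (y * μ) := by ring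
  rw [h1]; linarith

/-- The contribution of one pair of rows. -/
theorem pair_factor_ge {Li Lj yi yj wi wj s δ M dd : ℝ} {K : ℕ} (hs : 1 ≤ s) (hδ : 0 < δ)
    (hLi : Li = s ^ 2 * yi + s * wi) (hLj : Lj = s ^ 2 * yj + s * wj)
    (hwi : |wi| ≤ M) (hwj : |wj| ≤ M) (hyij : δ / 2 ≤ yi - yj) (hyj : 0 < yj) (hyi : yi ≤ 1)
    (hdd : 1 ≤ dd) (hddM : dd ≤ M) (hM : 16 * M ≤ s * δ) (hK : s ^ 2 * δ ≤ 4 * dd * (K + 1))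
    (hsδ : 16 * dd ≤ s ^ 2 * δ ^ 2) :
    Real.exp (-(12 * (M / (s * δ)) + 16 * (dd / (s ^ 2 * δ ^ 2)))) ≤
      (Li - Lj) / (Li + dd) * ∑ t ∈ Finset.range (K + 1), (yj / yi) ^ t := by
  have hs0 : 0 < s := by linarith
  have hM0 : 0 < M := by linarith
  have hyi0 : 0 < yi := by linarith
  have hyi2 : δ / 2 ≤ yi := by linarith
  have hd : 0 < yi - yj := by linarith
  have hsδ0 : 0 < s * δ := by positivity
  -- The relative size of the fluctuations; it controls the replacement of row lengths by their
  -- means.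
  set η := M / (s * δ) with hη
  have hη0 : 0 ≤ η := by positivity
  have hη1 : η ≤ 1 / 16 := by rw [hη, div_le_iff₀ hsδ0]; linarith
  have hMη : M = η * (s * δ) := by rw [hη]; field_simp
  set τ := 8 * (dd / (s ^ 2 * δ ^ 2)) with hτ
  have hτ0 : 0 ≤ τ := by positivity
  have hτ1 : τ ≤ 1 / 2 := by
    have h : dd / (s ^ 2 * δ ^ 2) ≤ 1 / 16 := by rw [div_le_iff₀ (by positivity)]; linarith
    rw [hτ]; linarith
  have hq : yj / yi = 1 - (yi - yj) / yi := by field_simp; ring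
  have hq1 : δ / 2 ≤ (yi - yj) / yi := by
    rw [le_div_iff₀ hyi0]; nlinarith
  set q := yj / yi with hqdef
  have hq0 : 0 < q := by positivity
  have hqlt : q < 1 := by rw [hq]; linarith
  -- Since `q ≤ 1 - δ/2 ≤ exp (-δ/2)`, the truncated tail is at most `exp (-(K+1)δ/2)`, and `exp
  -- (-t) ≤ 1/t` suffices.
  have hqK : q ^ (K + 1) ≤ τ := by
    have h1 : q ≤ Real.exp (-(δ / 2)) := by
      have := Real.add_one_le_exp (-(δ / 2)); rw [hq]; linarith
    have h2 : q ^ (K + 1) ≤ Real.exp (-(((K : ℝ) + 1) * (δ / 2))) := by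
      refine (pow_le_pow_left₀ hq0.le h1 _).trans (le_of_eq ?_)
      rw [← Real.exp_nat_mul]; congr 1; push_cast; ring
    refine h2.trans ((exp_neg_le_one_div (by positivity)).trans ?_)
    rw [hτ, ← mul_div_assoc (8 : ℝ) dd, div_le_div_iff₀ (by positivity) (by positivity)]
    linarith [mul_le_mul_of_nonneg_right hK hδ.le]
  have hF3 : Real.exp (-(2 * τ)) ≤ 1 - q ^ (K + 1) :=
    (exp_neg_two_mul_le hτ0 hτ1).trans (by linarith)
  have hF1 : Real.exp (-(8 * η)) ≤ (Li - Lj) / (s ^ 2 * (yi - yj)) := by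
    have h1 := exp_neg_two_mul_le (t := 4 * η) (by linarith) (by linarith)
    have h2 : -(8 * η) = -(2 * (4 * η)) := by ring
    rw [h2]
    refine h1.trans ?_
    rw [le_div_iff₀ (by positivity), hLi, hLj]
    have h3 := (abs_le.mp hwi).1
    have h4 := (abs_le.mp hwj).2
    have h5 : s * (-(2 * M)) ≤ s * (wi - wj) := mul_le_mul_of_nonneg_left (by linarith) hs0.le
    have h6 : η * s ^ 2 * (δ / 2) ≤ η * s ^ 2 * (yi - yj) :=
      mul_le_mul_of_nonneg_left hyij (by positivity)
    rw [hMη] at h5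
    linarith
  have hLpos : 0 < Li + dd := by
    rw [hLi]
    have h3 := (abs_le.mp hwi).1
    have h5 : s * (-M) ≤ s * wi := mul_le_mul_of_nonneg_left (by linarith) hs0.le
    have h6 : s ^ 2 * (δ / 2) ≤ s ^ 2 * yi := mul_le_mul_of_nonneg_left hyi2 (by positivity)
    have h7 : s * (16 * M) ≤ s * (s * δ) := mul_le_mul_of_nonneg_left hM hs0.le
    have h8 : 0 < s ^ 2 * δ := by positivity
    linarith
  have hF2 : Real.exp (-(4 * η)) ≤ s ^ 2 * yi / (Li + dd) := by
    rw [Real.exp_neg, inv_le_comm₀ (Real.exp_pos _) (by positivity), inv_div]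
    refine le_trans ?_ (Real.add_one_le_exp (4 * η))
    rw [div_le_iff₀ (by positivity), hLi]
    have h3 := (abs_le.mp hwi).2
    have h5 : s * wi ≤ s * M := mul_le_mul_of_nonneg_left h3 hs0.le
    have h6 : dd ≤ s * M := hddM.trans (le_mul_of_one_le_left hM0.le hs)
    have h7 : η * s ^ 2 * (δ / 2) ≤ η * s ^ 2 * yi :=
      mul_le_mul_of_nonneg_left hyi2 (by positivity)
    rw [hMη] at h5 h6
    linarith
  have hgeom : ∑ t ∈ Finset.range (K + 1), q ^ t = (1 - q ^ (K + 1)) / (1 - q) := by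
    rw [geom_sum_eq hqlt.ne, ← neg_div_neg_eq]; congr 1 <;> ring
  have h1q : 1 - q = (yi - yj) / yi := by rw [hq]; ring
  -- The complete geometric series `yi / (yi - yj)` cancels the main part of `(Li - Lj) / Li`; three
  -- factors close to one remain.
  have hprod : (Li - Lj) / (Li + dd) * ∑ t ∈ Finset.range (K + 1), q ^ t =
      (Li - Lj) / (s ^ 2 * (yi - yj)) * (s ^ 2 * yi / (Li + dd)) * (1 - q ^ (K + 1)) := by
    rw [hgeom, h1q]
    field_simp
  have hexp : -(12 * η + 16 * (dd / (s ^ 2 * δ ^ 2))) = -(8 * η) + -(4 * η) + -(2 * τ) := by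
    rw [hτ]; ring
  rw [hprod, hexp, Real.exp_add, Real.exp_add]
  refine mul_le_mul (mul_le_mul hF1 hF2 (Real.exp_pos _).le ?_) hF3 (Real.exp_pos _).le ?_
  · exact (Real.exp_pos _).le.trans hF1
  · exact mul_nonneg ((Real.exp_pos _).le.trans hF1) ((Real.exp_pos _).le.trans hF2)

theorem factorial_add_le (m k d : ℕ) (hk : k ≤ d) :
    ((m + k).factorial : ℝ) ≤ m.factorial * ((m : ℝ) + d) ^ k := by
  have h1 : (m + k).factorial ≤ m.factorial * (m + k) ^ k := by
    rw [← Nat.factorial_mul_ascFactorial]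
    exact Nat.mul_le_mul_left _ (Nat.ascFactorial_le_pow_add _ _)
  have h2 : m.factorial * (m + k) ^ k ≤ m.factorial * (m + d) ^ k :=
    Nat.mul_le_mul_left _ (Nat.pow_le_pow_left (by omega) _)
  exact_mod_cast h1.trans h2

/-- The number of tableaux against the multinomial coefficient. -/
theorem tableauCount_ge {d n : ℕ} {l : Fin d → ℕ} (ha : Antitone l) (hpos : ∀ i, 0 < l i) :
    (n.factorial / ∏ i, ((l i).factorial : ℝ)) *
      ∏ i, ∏ j ∈ Finset.Ioi i, ((l i - l j : ℝ) / (l i + d)) ≤ tableauCount n l := by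
  have h1 : tableauCount n l = n.factorial * ∏ i, ((∏ j ∈ Finset.Ioi i,
      ((shiftedRow l i : ℝ) - shiftedRow l j)) / ((shiftedRow l i).factorial : ℝ)) := by
    rw [tableauCount, diffProd, Finset.prod_div_distrib, mul_div_assoc]
  rw [h1, div_mul_eq_mul_div, mul_div_assoc, ← Finset.prod_div_distrib]
  refine mul_le_mul_of_nonneg_left ?_ (Nat.cast_nonneg _)
  refine Finset.prod_le_prod (fun i _ => ?_) fun i _ => ?_
  · refine div_nonneg (Finset.prod_nonneg fun j hj => div_nonneg ?_ (by positivity))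
      (by positivity)
    have := ha (Finset.mem_Ioi.mp hj).le
    exact sub_nonneg.mpr (by exact_mod_cast this)
  · have hli : (0 : ℝ) < (l i : ℝ) + d := by
      have : (0 : ℝ) < l i := by exact_mod_cast hpos i
      positivity
    -- The factorial of the shifted row exceeds that of the row by at most `(l i + d) ^ (d - 1 -
    -- i)`, and the exponent is the number of rows below i.
    rw [Finset.prod_div_distrib, Finset.prod_const, Fin.card_Ioi, div_div]
    refine div_le_div₀ ?_ ?_ (by positivity) ?_
    · refine Finset.prod_nonneg fun j hj => ?_
      have h2 := ha (Finset.mem_Ioi.mp hj).le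
      have h3 : (i : ℕ) < j := Fin.lt_def.mp (Finset.mem_Ioi.mp hj)
      refine sub_nonneg.mpr ?_
      have : shiftedRow l j ≤ shiftedRow l i := by simp only [shiftedRow]; omega
      exact_mod_cast this
    · refine Finset.prod_le_prod (fun j hj => ?_) fun j hj => ?_
      · have := ha (Finset.mem_Ioi.mp hj).le
        exact sub_nonneg.mpr (by exact_mod_cast this)
      · have h3 : (i : ℕ) < j := Fin.lt_def.mp (Finset.mem_Ioi.mp hj)
        have h4 : (l i : ℝ) + shiftedRow l j ≤ l j + shiftedRow l i := by
          have : l i + shiftedRow l j ≤ l j + shiftedRow l i := by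
            simp only [shiftedRow]; omega
          exact_mod_cast this
        linarith
    · rw [mul_comm]
      exact factorial_add_le (l i) (d - 1 - i) d (by omega)


/-! ### Lower bound of the block probabilities by the Gaussian density -/

/-- The contribution of one row to the logarithm of the multinomial probability. -/
theorem row_log_ge {m : ℕ} {s y w e μ δ Z A D B : ℝ} (hs : 1 ≤ s) (hδ : 0 < δ) (hδ1 : δ ≤ 1)
    (hD : 1 ≤ D) (hZ : 1 ≤ Z) (hA : 1 ≤ A) (hB : 200 * D * B ≤ 1)
    (hb1 : Z ≤ B * (s * δ)) (hb2 : A ≤ B * (s * δ)) (hb3 : 1 ≤ B * (s ^ 2 * δ ^ 2))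
    (hb4 : Z ^ 3 ≤ B * (s * δ ^ 2)) (hb5 : Z ^ 2 * A ≤ B * (s * δ ^ 2))
    (hm : (m : ℝ) = s ^ 2 * y + s * w) (hμ : δ ≤ μ) (hwe : |w - e| ≤ D / s)
    (hyμ : |y - μ| ≤ D * A / s) (he : |e| ≤ Z) :
    -(m * Real.log (s ^ 2)) + m - Real.log (s ^ 2) / 2 - Real.log μ / 2 -
      Real.log (2 * Real.pi) / 2 - s * w - e ^ 2 / μ / 2 - 136 * D ^ 3 * B ≤
      m * Real.log y - Real.log m.factorial ∧ |w| ≤ 2 * D * Z ∧ δ / 2 ≤ y ∧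
      s ^ 2 * δ / 4 ≤ m := by
  have hs0 : 0 < s := by linarith
  have hB0 : 0 < B := by
    by_contra h
    push Not at h
    have : B * (s * δ) ≤ 0 := mul_nonpos_of_nonpos_of_nonneg h (by positivity)
    linarith
  have hsδ : 0 < s * δ := by positivity
  have hDB : D * B ≤ 1 / 200 := by linarith
  have hμ0 : 0 < μ := by linarith
  have hDZ : D / s + Z ≤ 2 * D * Z := by
    have h1 : D / s ≤ D := div_le_self (by linarith) hs
    nlinarith
  have hw : |w| ≤ 2 * D * Z := by
    have h2 : |w| ≤ |w - e| + |e| := by simpa using abs_add_le (w - e) e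
    linarith
  have hDA : D * A / s ≤ δ / 200 := by
    rw [div_le_iff₀ hs0]
    have h1 : D * A ≤ D * (B * (s * δ)) := mul_le_mul_of_nonneg_left hb2 (by linarith)
    have h2 : D * B * (s * δ) ≤ 1 / 200 * (s * δ) := mul_le_mul_of_nonneg_right hDB hsδ.le
    linarith
  have hy : δ / 2 ≤ y := by
    have := (abs_le.mp hyμ).1
    linarith
  have hy0 : 0 < y := by linarith
  have hDZs : 2 * D * Z ≤ s * δ / 100 := by
    have h1 : D * Z ≤ D * (B * (s * δ)) := mul_le_mul_of_nonneg_left hb1 (by linarith)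
    have h2 : D * B * (s * δ) ≤ 1 / 200 * (s * δ) := mul_le_mul_of_nonneg_right hDB hsδ.le
    linarith
  have hsy : s * (δ / 2) ≤ s * y := mul_le_mul_of_nonneg_left hy hs0.le
  have hmlow : s ^ 2 * δ / 4 ≤ m := by
    rw [hm]
    have h1 : -(2 * D * Z) ≤ w := (abs_le.mp hw).1 |> fun h => h
    have h2 : s * (-(s * δ / 100)) ≤ s * w := mul_le_mul_of_nonneg_left (by linarith) hs0.le
    have h3 : s * (s * (δ / 2)) ≤ s * (s * y) := mul_le_mul_of_nonneg_left hsy hs0.le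
    have h4 : 0 < s * (s * δ) := by positivity
    linarith
  refine ⟨?_, hw, hy, hmlow⟩
  have hm0 : (0 : ℝ) < m := lt_of_lt_of_le (by positivity) hmlow
  have hmne : m ≠ 0 := by rintro rfl; simp at hm0
  have hfac := log_factorial_le hmne
  have hent := mul_log_div_le hs0 hy0 hm (by linarith)
  have hsq := sq_div_le_add hδ hμ hy hwe hyμ he hw (by nlinarith)
  have hlogy : Real.log ((m : ℝ) / (s ^ 2 * y)) =
      Real.log m - Real.log (s ^ 2) - Real.log y := by
    rw [Real.log_div hm0.ne' (by positivity), Real.log_mul (by positivity) hy0.ne']; ring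
  -- In the square-root term of Stirling's formula `log m` is replaced by `log (s² μ)`, using `log t
  -- ≤ t - 1`.
  have hlogμ : Real.log m ≤ Real.log (s ^ 2) + Real.log μ + (m / (s ^ 2 * μ) - 1) := by
    have h1 := Real.log_le_sub_one_of_pos (show 0 < (m : ℝ) / (s ^ 2 * μ) by positivity)
    rw [Real.log_div hm0.ne' (by positivity), Real.log_mul (by positivity) hμ0.ne'] at h1
    linarith
  have hE1 : (m : ℝ) / (s ^ 2 * μ) - 1 ≤ 3 * D * B := by
    rw [sub_le_iff_le_add, div_le_iff₀ (by positivity), hm]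
    have h1 : s ^ 2 * (y - μ) ≤ s ^ 2 * (D * A / s) :=
      mul_le_mul_of_nonneg_left (abs_le.mp hyμ).2 (by positivity)
    have h2 : s ^ 2 * (D * A / s) = s * D * A := by field_simp
    have h3 : s * w ≤ s * (2 * D * Z) := mul_le_mul_of_nonneg_left (abs_le.mp hw).2 hs0.le
    have h4 : s * D * A ≤ s * D * (B * (s * δ)) := mul_le_mul_of_nonneg_left hb2 (by positivity)
    have h5 : s * D * Z ≤ s * D * (B * (s * δ)) := mul_le_mul_of_nonneg_left hb1 (by positivity)
    have h6 : s ^ 2 * D * B * δ ≤ s ^ 2 * D * B * μ := mul_le_mul_of_nonneg_left hμ (by positivity)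
    linarith
  have hE2 : 1 / (12 * (m : ℝ)) ≤ B := by
    rw [div_le_iff₀ (by positivity)]
    have h1 : B * (s ^ 2 * δ ^ 2) ≤ B * (s ^ 2 * δ) := by
      refine mul_le_mul_of_nonneg_left (mul_le_mul_of_nonneg_left ?_ (by positivity)) hB0.le
      nlinarith
    have h2 : B * (s ^ 2 * δ / 4) ≤ B * m := mul_le_mul_of_nonneg_left hmlow hB0.le
    have h3 : 0 < B * m := by positivity
    linarith
  have hE3 : 4 * (D / s) * (2 * D * Z) / δ ≤ 8 * D ^ 2 * B := by
    have h1 : 4 * (D / s) * (2 * D * Z) / δ = 8 * D ^ 2 * Z / (s * δ) := by field_simp; ring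
    rw [h1, div_le_iff₀ hsδ]
    have := mul_le_mul_of_nonneg_left hb1 (show 0 ≤ 8 * D ^ 2 by positivity)
    linarith
  have hE4 : 2 * Z ^ 2 * (D * A / s) / δ ^ 2 ≤ 2 * D * B := by
    have h1 : 2 * Z ^ 2 * (D * A / s) / δ ^ 2 = 2 * D * (Z ^ 2 * A) / (s * δ ^ 2) := by field_simp
    rw [h1, div_le_iff₀ (by positivity)]
    have := mul_le_mul_of_nonneg_left hb5 (show 0 ≤ 2 * D by positivity)
    linarith
  have hE5 : 4 * |w| ^ 3 / (s * y ^ 2) ≤ 128 * D ^ 3 * B := by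
    rw [div_le_iff₀ (by positivity)]
    have h1 : |w| ^ 3 ≤ (2 * D * Z) ^ 3 := pow_le_pow_left₀ (abs_nonneg _) hw 3
    have h2 : (δ / 2) ^ 2 ≤ y ^ 2 := pow_le_pow_left₀ (by positivity) hy 2
    have h3 := mul_le_mul_of_nonneg_left hb4 (show 0 ≤ 32 * D ^ 3 by positivity)
    have h4 := mul_le_mul_of_nonneg_left h2 (show 0 ≤ 128 * D ^ 3 * B * s by positivity)
    have h5 : (2 * D * Z) ^ 3 = 8 * D ^ 3 * Z ^ 3 := by ring
    rw [h5] at h1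
    linarith
  -- All error terms are brought to `D³ B`; the coefficients add up to 128 + (8 + 2)/2 + 3/2 + 1,
  -- below 136.
  have hD2 : D ^ 2 * B ≤ D ^ 3 * B :=
    mul_le_mul_of_nonneg_right (pow_le_pow_right₀ hD (by norm_num)) hB0.le
  have hD1 : D * B ≤ D ^ 3 * B := by
    refine mul_le_mul_of_nonneg_right ?_ hB0.le
    calc D = D ^ 1 := (pow_one D).symm
      _ ≤ D ^ 3 := pow_le_pow_right₀ hD (by norm_num)
  have hD0 : B ≤ D ^ 3 * B := le_mul_of_one_le_left hB0.le (one_le_pow₀ hD)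
  have hw2 : w ^ 2 / (2 * y) = w ^ 2 / y / 2 := by field_simp
  rw [hlogy, hw2] at hent
  have hexp : (m : ℝ) * (Real.log m - Real.log (s ^ 2) - Real.log y) =
      m * Real.log m - m * Real.log (s ^ 2) - m * Real.log y := by ring
  rw [hexp] at hent
  linarith

/-! ### The local spectrum and the deviations of the row lengths -/

theorem localSpectrum_castSucc {r : ℕ} (μ : Fin (r + 1) → ℝ) (n : ℕ) (u : Fin r → ℝ) (i : Fin r) :
    localSpectrum μ n u i.castSucc = μ i.castSucc + u i / Real.sqrt n := by
  simp [localSpectrum, perturb]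

theorem localSpectrum_last {r : ℕ} (μ : Fin (r + 1) → ℝ) (n : ℕ) (u : Fin r → ℝ) :
    localSpectrum μ n u (Fin.last r) = μ (Fin.last r) - ∑ i, u i / Real.sqrt n := by
  simp [localSpectrum, perturb]

theorem sum_localSpectrum {r : ℕ} (μ : Fin (r + 1) → ℝ) (n : ℕ) (u : Fin r → ℝ) :
    ∑ i, localSpectrum μ n u i = ∑ i, μ i := by
  rw [Fin.sum_univ_castSucc, Fin.sum_univ_castSucc, localSpectrum_last]
  simp only [localSpectrum_castSucc, Finset.sum_add_distrib]
  ring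

theorem abs_localSpectrum_sub_le {r : ℕ} (μ : Fin (r + 1) → ℝ) (n : ℕ) (u : Fin r → ℝ) {A : ℝ}
    (hA0 : 0 ≤ A) (hA : ∀ i, |u i| ≤ A) (i : Fin (r + 1)) :
    |localSpectrum μ n u i - μ i| ≤ (r + 1 : ℝ) * A / Real.sqrt n := by
  have h1 : ∀ i, |u i / Real.sqrt n| ≤ A / Real.sqrt n := fun i => by
    rw [abs_div, abs_of_nonneg (Real.sqrt_nonneg _)]
    exact div_le_div_of_nonneg_right (hA i) (Real.sqrt_nonneg _)
  have h2 : 0 ≤ A / Real.sqrt n := div_nonneg hA0 (Real.sqrt_nonneg _)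
  have h3 : 0 ≤ (r : ℝ) * (A / Real.sqrt n) := mul_nonneg (Nat.cast_nonneg _) h2
  rw [mul_div_assoc]
  refine Fin.lastCases ?_ (fun i => ?_) i
  · rw [localSpectrum_last]
    have h4 : |∑ i, u i / Real.sqrt n| ≤ r * (A / Real.sqrt n) := by
      refine (Finset.abs_sum_le_sum_abs _ _).trans ((Finset.sum_le_sum fun i _ => h1 i).trans ?_)
      simp
    have h5 : μ (Fin.last r) - ∑ i, u i / Real.sqrt n - μ (Fin.last r) =
        -∑ i, u i / Real.sqrt n := by ring
    rw [h5, abs_neg]; linarith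
  · rw [localSpectrum_castSucc, add_sub_cancel_left]
    have := h1 i
    linarith

/-- The vector `v` completed to one with sum zero. -/
def completeZero {r : ℕ} (v : Fin r → ℝ) : Fin (r + 1) → ℝ :=
  Fin.snoc (α := fun _ => ℝ) v (-∑ i, v i)

theorem quadForm_eq_sum {r : ℕ} (μ : Fin (r + 1) → ℝ) (v : Fin r → ℝ) :
    quadForm μ v = ∑ i, completeZero v i ^ 2 / μ i := by
  rw [Fin.sum_univ_castSucc]
  simp [quadForm, completeZero]

/-- All weights satisfy `μ_i ≤ 1`, so every coordinate, including the completing one, has its square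
bounded by the quadratic form. -/
theorem abs_completeZero_le {r : ℕ} {μ : Fin (r + 1) → ℝ} (hμ : ∀ i, 0 < μ i)
    (h1 : ∑ i, μ i = 1) {v : Fin r → ℝ} {Z : ℝ} (hZ : 0 ≤ Z) (hv : quadForm μ v ≤ Z ^ 2)
    (i : Fin (r + 1)) : |completeZero v i| ≤ Z := by
  refine abs_le_of_sq_le_sq ?_ hZ
  refine le_trans ?_ hv
  rw [quadForm_eq_sum]
  have hle : μ i ≤ 1 := by
    rw [← h1]; exact Finset.single_le_sum (fun j _ => (hμ j).le) (Finset.mem_univ i)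
  calc completeZero v i ^ 2 ≤ completeZero v i ^ 2 / μ i := by
        rw [le_div_iff₀ (hμ i)]
        exact mul_le_of_le_one_right (sq_nonneg _) hle
    _ ≤ _ := Finset.single_le_sum (f := fun i => completeZero v i ^ 2 / μ i)
        (fun j _ => div_nonneg (sq_nonneg _) (hμ j).le) (Finset.mem_univ i)

/-- Rounding: the deviations of the row lengths from their means are close to `x - u`. -/
theorem abs_deviation_sub_le {r : ℕ} {μ : Fin (r + 1) → ℝ} (h1 : ∑ i, μ i = 1) {n : ℕ}
    (hn : 1 ≤ n) (u x : Fin r → ℝ) {l : Fin (r + 1) → ℕ} (hl : ∑ i, l i = n)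
    (hx : ∀ i : Fin r,
      |Real.sqrt n * x i + n * μ i.castSucc - (l i.castSucc : ℝ)| ≤ 1 / 2) (i : Fin (r + 1)) :
    |(l i - n * localSpectrum μ n u i) / Real.sqrt n - completeZero (x - u) i| ≤
      (r + 1 : ℝ) / Real.sqrt n := by
  have hs0 : 0 < Real.sqrt n := Real.sqrt_pos.mpr (by exact_mod_cast hn)
  have hsq : Real.sqrt n ^ 2 = n := Real.sq_sqrt (Nat.cast_nonneg n)
  set s := Real.sqrt n with hs
  have hcs : ∀ i : Fin r, |(l i.castSucc - n * localSpectrum μ n u i.castSucc) / s -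
      (x - u) i| ≤ 1 / s := by
    intro i
    have h2 : (l i.castSucc - n * localSpectrum μ n u i.castSucc) / s - (x - u) i =
        -(s * x i + n * μ i.castSucc - l i.castSucc) / s := by
      rw [localSpectrum_castSucc, ← hs, ← hsq, Pi.sub_apply]
      field_simp
      ring
    rw [h2, abs_div, abs_neg, abs_of_pos hs0]
    exact div_le_div_of_nonneg_right ((hx i).trans (by norm_num)) hs0.le
  have hsi : 0 ≤ 1 / s := by positivity
  have hri : 0 ≤ (r : ℝ) * (1 / s) := by positivity
  have hgoal : (r + 1 : ℝ) / s = r * (1 / s) + 1 / s := by ring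
  rw [hgoal]
  refine Fin.lastCases ?_ (fun i => ?_) i
  · have hsum : ∑ i, (l i - n * localSpectrum μ n u i) / s = 0 := by
      rw [← Finset.sum_div, Finset.sum_sub_distrib, ← Finset.mul_sum, sum_localSpectrum, h1,
        ← Nat.cast_sum, hl]
      simp
    rw [Fin.sum_univ_castSucc] at hsum
    have h3 : (l (Fin.last r) - n * localSpectrum μ n u (Fin.last r)) / s -
        completeZero (x - u) (Fin.last r) =
        -∑ i : Fin r, ((l i.castSucc - n * localSpectrum μ n u i.castSucc) / s - (x - u) i) := by
      rw [Finset.sum_sub_distrib]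
      simp only [completeZero, Fin.snoc_last]
      linarith
    rw [h3, abs_neg]
    refine (Finset.abs_sum_le_sum_abs _ _).trans ((Finset.sum_le_sum fun i _ => hcs i).trans ?_)
    simp only [Finset.sum_const, Finset.card_univ, Fintype.card_fin, nsmul_eq_mul]
    linarith
  · have h4 : completeZero (x - u) i.castSucc = (x - u) i := by simp [completeZero]
    rw [h4]
    have := hcs i
    linarith

theorem exp_le_prod_pairs {d : ℕ} {f : Fin d → Fin d → ℝ} {c : ℝ} (hc : 0 ≤ c)
    (hf : ∀ i j, i < j → Real.exp (-c) ≤ f i j) :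
    Real.exp (-((d : ℝ) ^ 2 * c)) ≤ ∏ i, ∏ j ∈ Finset.Ioi i, f i j := by
  have h1 : ∀ i : Fin d, Real.exp (-((d : ℝ) * c)) ≤ ∏ j ∈ Finset.Ioi i, f i j := by
    intro i
    calc Real.exp (-((d : ℝ) * c)) ≤ Real.exp (-c) ^ (Finset.Ioi i).card := by
          rw [← Real.exp_nat_mul]
          refine Real.exp_le_exp.mpr ?_
          have : ((Finset.Ioi i).card : ℝ) ≤ d := by
            have := Finset.card_le_univ (Finset.Ioi i)
            rw [Fintype.card_fin] at this
            exact_mod_cast this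
          nlinarith
      _ = ∏ j ∈ Finset.Ioi i, Real.exp (-c) := by rw [Finset.prod_const]
      _ ≤ _ := Finset.prod_le_prod (fun _ _ => (Real.exp_pos _).le)
          fun j hj => hf i j (Finset.mem_Ioi.mp hj)
  calc Real.exp (-((d : ℝ) ^ 2 * c)) = ∏ _i : Fin d, Real.exp (-((d : ℝ) * c)) := by
        rw [Finset.prod_const, Finset.card_univ, Fintype.card_fin, ← Real.exp_nat_mul]
        congr 1; ring
    _ ≤ _ := Finset.prod_le_prod (fun _ _ => (Real.exp_pos _).le) fun i _ => h1 i

theorem mul_exp_le_of_factors {g a b c Y P W : ℝ} (hg : 0 ≤ g)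
    (hc : Real.exp (-c) ≤ Real.exp (-a) * Real.exp (-b)) (h1 : g * Real.exp (-a) ≤ Y)
    (h2 : Real.exp (-b) ≤ P) (h3 : Y * P ≤ W) : g * Real.exp (-c) ≤ W := by
  have h0 : 0 ≤ Y := (mul_nonneg hg (Real.exp_pos _).le).trans h1
  calc g * Real.exp (-c) ≤ g * (Real.exp (-a) * Real.exp (-b)) := mul_le_mul_of_nonneg_left hc hg
    _ = g * Real.exp (-a) * Real.exp (-b) := by ring
    _ ≤ Y * P := mul_le_mul h1 h2 (Real.exp_pos _).le h0
    _ ≤ W := h3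

/-- The constant in the comparison of block probabilities with the Gaussian density. -/
def comparisonConst (r : ℕ) : ℝ := 400 * (r + 1 : ℝ) ^ 4

-- The local comparison on the bulk. The number `B = Z³ A / (√n δ²)` dominates each of the error
-- ratios `Z/(√n δ)`, `A/(√n δ)`, `1/(n δ²)`, `Z³/(√n δ²)` and `Z² A/(√n δ²)`. Its smallness also
-- keeps the row lengths well separated, so that `l` is a genuine diagram.
set_option maxHeartbeats 1000000 in
theorem whichBlock_ge_gaussDensity {r : ℕ} {μ : Fin (r + 1) → ℝ} (h1 : ∑ i, μ i = 1) {δ : ℝ}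
    (hδ : 0 < δ) (hμδ : ∀ i, δ ≤ μ i) (hgap : ∀ i j, i < j → δ ≤ μ i - μ j) {n : ℕ} (hn : 1 ≤ n)
    {A Z B : ℝ} (hA : 1 ≤ A) (hZ : 1 ≤ Z) (hB : Z ^ 3 * A = B * (Real.sqrt n * δ ^ 2))
    (hCB : comparisonConst r * B ≤ 1) {u x : Fin r → ℝ} (hu : ∀ i, |u i| ≤ A)
    {l : Fin (r + 1) → ℕ} (hl : ∑ i, l i = n)
    (hx : ∀ i : Fin r,
      |Real.sqrt n * x i + n * μ i.castSucc - (l i.castSucc : ℝ)| ≤ 1 / 2)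
    (hQ : quadForm μ (x - u) ≤ Z ^ 2) :
    Antitone l ∧ gaussDensity μ u x * Real.exp (-(comparisonConst r * B)) ≤
      Real.sqrt n ^ r * whichBlock n (Matrix.diagonal fun i => (localSpectrum μ n u i : ℂ)) l := by
  have hμ : ∀ i, 0 < μ i := fun i => hδ.trans_le (hμδ i)
  have hδ1 : δ ≤ 1 := by
    refine (hμδ 0).trans ?_
    rw [← h1]; exact Finset.single_le_sum (fun j _ => (hμ j).le) (Finset.mem_univ 0)
  have hs1 : 1 ≤ Real.sqrt n := Real.one_le_sqrt.mpr (by exact_mod_cast hn)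
  have hsq : Real.sqrt n ^ 2 = n := Real.sq_sqrt (Nat.cast_nonneg n)
  have hy := abs_localSpectrum_sub_le μ n u (A := A) (by linarith) hu
  have hwe := abs_deviation_sub_le h1 hn u x hl hx
  have he := abs_completeZero_le hμ h1 (by linarith) hQ
  have hysum := sum_localSpectrum μ n u
  have hgaussQ := quadForm_eq_sum μ (x - u)
  set y := localSpectrum μ n u with hydef
  set s := Real.sqrt n with hs
  set e := completeZero (x - u) with hedef
  set D : ℝ := (r : ℝ) + 1 with hD
  have hD1 : 1 ≤ D := by rw [hD]; linarith [(Nat.cast_nonneg r : (0 : ℝ) ≤ r)]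
  have hs0 : 0 < s := by linarith
  set w : Fin (r + 1) → ℝ := fun i => (l i - n * y i) / s with hw
  have hB0 : 0 < B := by
    have h2 : 0 < B * (s * δ ^ 2) := by rw [← hB]; positivity
    exact pos_of_mul_pos_left h2 (by positivity)
  have hZ2 : 1 ≤ Z ^ 2 := one_le_pow₀ hZ
  have hZ3 : 1 ≤ Z ^ 3 := one_le_pow₀ hZ
  have hδδ : s * δ ^ 2 ≤ s * δ := mul_le_mul_of_nonneg_left (by nlinarith) hs0.le
  have hBδ : B * (s * δ ^ 2) ≤ B * (s * δ) := mul_le_mul_of_nonneg_left hδδ hB0.le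
  have hb4 : Z ^ 3 ≤ B * (s * δ ^ 2) := by rw [← hB]; exact le_mul_of_one_le_right (by linarith) hA
  have hZ13 : Z ≤ Z ^ 3 := by
    calc Z = Z ^ 1 := (pow_one Z).symm
      _ ≤ Z ^ 3 := pow_le_pow_right₀ hZ (by norm_num)
  have hb1 : Z ≤ B * (s * δ) := hZ13.trans (hb4.trans hBδ)
  have hb2 : A ≤ B * (s * δ) := by
    refine le_trans ?_ hBδ
    rw [← hB]; exact le_mul_of_one_le_left (by linarith) hZ3
  have hb5 : Z ^ 2 * A ≤ B * (s * δ ^ 2) := by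
    rw [← hB]
    exact mul_le_mul_of_nonneg_right (pow_le_pow_right₀ hZ (by norm_num)) (by linarith)
  have hb3 : 1 ≤ B * (s ^ 2 * δ ^ 2) := by
    refine (hZ3.trans hb4).trans (mul_le_mul_of_nonneg_left ?_ hB0.le)
    refine mul_le_mul_of_nonneg_right ?_ (by positivity)
    nlinarith
  have hD4 : D ≤ D ^ 4 := by
    calc D = D ^ 1 := (pow_one D).symm
      _ ≤ D ^ 4 := pow_le_pow_right₀ hD1 (by norm_num)
  have hC : comparisonConst r = 400 * D ^ 4 := rfl
  have hDB : 400 * (D * B) ≤ 1 := by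
    have h2 : D * B ≤ D ^ 4 * B := mul_le_mul_of_nonneg_right hD4 hB0.le
    rw [hC] at hCB; linarith
  have hm : ∀ i, (l i : ℝ) = s ^ 2 * y i + s * w i := by
    intro i
    rw [hw, hsq]; field_simp; ring
  have hrow := fun i => row_log_ge (m := l i) hs1 hδ hδ1 hD1 hZ hA (B := B) (by linarith) hb1 hb2
    hb3 hb4 hb5 (hm i) (hμδ i) (hwe i) (hy i) (he i)
  have hwM : ∀ i, |w i| ≤ 2 * D * Z := fun i => (hrow i).2.1
  have hyδ : ∀ i, δ / 2 ≤ y i := fun i => (hrow i).2.2.1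
  have hlow : ∀ i, s ^ 2 * δ / 4 ≤ l i := fun i => (hrow i).2.2.2
  have hy0 : ∀ i, 0 < y i := fun i => by linarith [hyδ i]
  have hlpos : ∀ i, 0 < l i := fun i => by
    have : (0 : ℝ) < l i := lt_of_lt_of_le (by positivity) (hlow i)
    exact_mod_cast this
  have hy1 : ∀ i, y i ≤ 1 := fun i => by
    rw [← h1, ← hysum]; exact Finset.single_le_sum (fun j _ => (hy0 j).le) (Finset.mem_univ i)
  have hsδ : 0 < s * δ := by positivity
  have hDA : D * A / s ≤ δ / 4 := by
    rw [div_le_iff₀ hs0]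
    have h2 : D * A ≤ D * (B * (s * δ)) := mul_le_mul_of_nonneg_left hb2 (by linarith)
    have h3 : D * B * (s * δ) ≤ 1 / 400 * (s * δ) :=
      mul_le_mul_of_nonneg_right (by linarith) hsδ.le
    linarith
  have hygap : ∀ i j, i < j → δ / 2 ≤ y i - y j := by
    intro i j hij
    have h2 := (abs_le.mp (hy i)).1
    have h3 := (abs_le.mp (hy j)).2
    have h4 := hgap i j hij
    linarith
  have hDZ : 2 * D * Z ≤ s * δ / 200 := by
    have h2 : D * Z ≤ D * (B * (s * δ)) := mul_le_mul_of_nonneg_left hb1 (by linarith)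
    have h3 : D * B * (s * δ) ≤ 1 / 400 * (s * δ) :=
      mul_le_mul_of_nonneg_right (by linarith) hsδ.le
    linarith
  have hlgap : ∀ i j, i < j → s ^ 2 * δ / 4 ≤ (l i : ℝ) - l j := by
    intro i j hij
    rw [hm i, hm j]
    have h2 := (abs_le.mp (hwM i)).1
    have h3 := (abs_le.mp (hwM j)).2
    have h4 : s * (-(s * δ / 100)) ≤ s * (w i - w j) :=
      mul_le_mul_of_nonneg_left (by linarith) hs0.le
    have h5 : s ^ 2 * (δ / 2) ≤ s ^ 2 * (y i - y j) :=
      mul_le_mul_of_nonneg_left (hygap i j hij) (by positivity)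
    have h6 : 0 < s * (s * δ) := by positivity
    linarith
  have hanti : Antitone l := by
    refine antitone_iff_forall_lt.mpr fun i j hij => ?_
    have h2 := hlgap i j hij
    have h3 : 0 ≤ s ^ 2 * δ / 4 := by positivity
    have : (l j : ℝ) ≤ l i := by linarith
    exact_mod_cast this
  refine ⟨hanti, ?_⟩
  -- The largest truncation for which the segments at the row ends, of total length `(r + 1) * K`,
  -- fit into the row differences, which are at least `s² δ / 4`.
  set K := ⌊s ^ 2 * δ / (4 * D)⌋₊ with hK
  have hKle : (K : ℝ) ≤ s ^ 2 * δ / (4 * D) := Nat.floor_le (by positivity)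
  have hKlt : s ^ 2 * δ ≤ 4 * D * ((K : ℝ) + 1) := by
    have h2 := (Nat.lt_floor_add_one (s ^ 2 * δ / (4 * D))).le
    rw [div_le_iff₀ (by positivity)] at h2
    rw [hK]; linarith
  have hDcast : ((r + 1 : ℕ) : ℝ) = D := by push_cast; rfl
  have hKl : ∀ i j, i < j → (r + 1) * K + l j ≤ l i := by
    intro i j hij
    have h2 := hlgap i j hij
    rw [le_div_iff₀ (by positivity)] at hKle
    have h3 : ((r + 1 : ℕ) : ℝ) * K + l j ≤ l i := by rw [hDcast]; linarith
    exact_mod_cast h3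
  have hmain := whichBlock_diagonal_ge_tableauCount hl hanti hKl hy0
  have hD2s : 16 * D ≤ s ^ 2 * δ ^ 2 := by
    have h2 := mul_le_mul_of_nonneg_left hb3 (show 0 ≤ 16 * D by linarith)
    have h3 : 16 * D * B * (s ^ 2 * δ ^ 2) ≤ 1 * (s ^ 2 * δ ^ 2) :=
      mul_le_mul_of_nonneg_right (by linarith) (by positivity)
    linarith
  have hpair : ∀ i j, i < j → Real.exp (-(40 * D * B)) ≤
      (l i - l j : ℝ) / (l i + (r + 1 : ℕ)) * ∑ t ∈ Finset.range (K + 1), (y j / y i) ^ t := by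
    intro i j hij
    rw [hDcast]
    refine le_trans (Real.exp_le_exp.mpr ?_) (pair_factor_ge hs1 hδ (hm i) (hm j) (hwM i) (hwM j)
      (hygap i j hij) (hy0 j) (hy1 i) hD1 (by nlinarith) (by linarith) hKlt hD2s)
    have h2 : 2 * D * Z / (s * δ) ≤ 2 * D * B := by
      rw [div_le_iff₀ hsδ]
      have := mul_le_mul_of_nonneg_left hb1 (show 0 ≤ 2 * D by linarith)
      linarith
    have h3 : D / (s ^ 2 * δ ^ 2) ≤ D * B := by
      rw [div_le_iff₀ (by positivity)]
      have := mul_le_mul_of_nonneg_left hb3 (show 0 ≤ D by linarith)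
      linarith
    linarith
  have hpairs := exp_le_prod_pairs (d := r + 1)
    (f := fun i j => (l i - l j : ℝ) / (l i + (r + 1 : ℕ)) *
      ∑ t ∈ Finset.range (K + 1), (y j / y i) ^ t) (by positivity) hpair
  simp only [Finset.prod_mul_distrib] at hpairs
  set P1 := ∏ i, ∏ j ∈ Finset.Ioi i, (l i - l j : ℝ) / (l i + (r + 1 : ℕ)) with hP1
  set P2 := ∏ i, ∏ j ∈ Finset.Ioi i, ∑ t ∈ Finset.range (K + 1), (y j / y i) ^ t with hP2
  rw [hDcast] at hpairs
  have hP2nn : 0 ≤ P2 := Finset.prod_nonneg fun i _ => Finset.prod_nonneg fun j _ =>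
    Finset.sum_nonneg fun t _ => pow_nonneg (div_nonneg (hy0 j).le (hy0 i).le) _
  have hcount := tableauCount_ge (n := n) hanti hlpos
  set N := (n.factorial : ℝ) / ∏ i, ((l i).factorial : ℝ) with hN
  set X := ∏ i, y i ^ l i with hX
  have hXpos : 0 < X := Finset.prod_pos fun i _ => pow_pos (hy0 i) _
  have hNpos : 0 < N := div_pos (by positivity) (Finset.prod_pos fun i _ => by positivity)
  have hlog : Real.log (N * X) = Real.log n.factorial +
      ∑ i, (l i * Real.log (y i) - Real.log (l i).factorial) := by
    rw [Real.log_mul hNpos.ne' hXpos.ne', hN, Real.log_div (by positivity)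
      (Finset.prod_ne_zero_iff.mpr fun i _ => by positivity),
      Real.log_prod (fun i _ => by positivity), hX,
      Real.log_prod (fun i _ => (pow_pos (hy0 i) _).ne'), Finset.sum_sub_distrib]
    simp only [Real.log_pow]
    ring
  -- The linear terms of the row estimates cancel, since both the row lengths and their means sum to
  -- n.
  have hsumw : ∑ i, s * w i = 0 := by
    have h2 : ∑ i, (l i : ℝ) = n := by rw [← Nat.cast_sum, hl]
    simp only [hm] at h2
    rw [Finset.sum_add_distrib, ← Finset.mul_sum, hysum, h1, mul_one, hsq] at h2
    linarith
  have hsumrow := Finset.sum_le_sum fun i (_ : i ∈ Finset.univ) => (hrow i).1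
  simp only [Finset.sum_sub_distrib, Finset.sum_add_distrib, Finset.sum_neg_distrib,
    ← Finset.sum_mul, ← Finset.sum_div, Finset.sum_const, Finset.card_univ, Fintype.card_fin,
    nsmul_eq_mul, hDcast] at hsumrow
  rw [hsumw, ← Nat.cast_sum, hl, ← hgaussQ, hsq] at hsumrow
  have hnfac := Stirling.le_log_factorial_stirling (n := n) (by omega)
  -- The factorials of the `r + 1` rows contribute `-(r+1)/2 * log n` and `n!` contributes `log n /
  -- 2`; the net factor `n^(-r/2)` is compensated by `s ^ r`.
  have hNX : -((r : ℝ) / 2 * Real.log n) - (r : ℝ) / 2 * Real.log (2 * Real.pi) -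
      (∑ i, Real.log (μ i)) / 2 - quadForm μ (x - u) / 2 - 136 * D ^ 4 * B ≤
      Real.log (N * X) := by
    rw [hlog, Finset.sum_sub_distrib]
    have hr : (r : ℝ) = D - 1 := by rw [hD]; ring
    rw [hr]
    linarith
  have hNX2 : gaussDensity μ u x * Real.exp (-(136 * D ^ 4 * B)) ≤ s ^ r * (N * X) := by
    have hprod0 : 0 < ∏ i, μ i := Finset.prod_pos fun i _ => hμ i
    have hg : 0 < gaussDensity μ u x * Real.exp (-(136 * D ^ 4 * B)) := by
      rw [gaussDensity_eq hμ h1]; positivity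
    have hNX0 : 0 < N * X := mul_pos hNpos hXpos
    have hls : Real.log s = Real.log n / 2 := Real.log_sqrt (Nat.cast_nonneg n)
    rw [← Real.log_le_log_iff hg (by positivity), Real.log_mul (by positivity) hNX0.ne',
      Real.log_pow, hls, gaussDensity_eq hμ h1, mul_assoc,
      ← Real.exp_add, Real.log_mul (by positivity) (by positivity), Real.log_exp, Real.log_inv,
      Real.log_sqrt (by positivity), Real.log_mul (by positivity) hprod0.ne', Real.log_pow,
      Real.log_prod (fun i _ => (hμ i).ne')]
    linarith
  have hfin : s ^ r * (N * X) * (P1 * P2) ≤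
      s ^ r * whichBlock n (Matrix.diagonal fun i => (y i : ℂ)) l := by
    rw [mul_assoc]
    refine mul_le_mul_of_nonneg_left (le_trans ?_ hmain) (by positivity)
    calc N * X * (P1 * P2) = N * P1 * (X * P2) := by ring
      _ ≤ _ := mul_le_mul_of_nonneg_right hcount (by positivity)
  -- The rows cost `136 D⁴ B` and the at most `D²` pairs cost `40 D B` each, together below `400 D⁴
  -- B`.
  have hexp : Real.exp (-(comparisonConst r * B)) ≤
      Real.exp (-(136 * D ^ 4 * B)) * Real.exp (-(D ^ 2 * (40 * D * B))) := by
    rw [← Real.exp_add]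
    refine Real.exp_le_exp.mpr ?_
    have h2 : D ^ 3 * B ≤ D ^ 4 * B :=
      mul_le_mul_of_nonneg_right (pow_le_pow_right₀ hD1 (by norm_num)) hB0.le
    have h3 : 0 ≤ D ^ 4 * B := by positivity
    rw [hC]
    linarith
  exact mul_exp_le_of_factors (gaussDensity_nonneg μ u x) hexp hNX2 hpairs hfin


/-! ### Consequences of the spectral gap -/

theorem gap_le_last {r : ℕ} (μ : Fin (r + 1) → ℝ) : gap μ ≤ μ (Fin.last r) := by
  have h := ciInf_le (Set.finite_range fun i : Fin (r + 1) =>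
    μ i - Fin.snoc (α := fun _ : Fin (r + 2) => ℝ) μ 0 i.succ).bddBelow (Fin.last r)
  rw [Fin.succ_last, Fin.snoc_last, sub_zero] at h
  exact h

theorem gap_le_sub_succ {r : ℕ} (μ : Fin (r + 1) → ℝ) (i : Fin r) :
    gap μ ≤ μ i.castSucc - μ i.succ := by
  have h := ciInf_le (Set.finite_range fun i : Fin (r + 1) =>
    μ i - Fin.snoc (α := fun _ : Fin (r + 2) => ℝ) μ 0 i.succ).bddBelow i.castSucc
  rw [Fin.succ_castSucc, Fin.snoc_castSucc] at h
  exact h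

theorem antitone_of_gap_nonneg {r : ℕ} {μ : Fin (r + 1) → ℝ} (h : 0 ≤ gap μ) : Antitone μ :=
  Fin.antitone_iff_succ_le.mpr fun i => by linarith [gap_le_sub_succ μ i]

theorem gap_le {r : ℕ} {μ : Fin (r + 1) → ℝ} (h : 0 ≤ gap μ) (i : Fin (r + 1)) : gap μ ≤ μ i :=
  (gap_le_last μ).trans (antitone_of_gap_nonneg h (Fin.le_last i))

theorem gap_le_sub {r : ℕ} {μ : Fin (r + 1) → ℝ} (h : 0 ≤ gap μ) {i j : Fin (r + 1)}
    (hij : i < j) : gap μ ≤ μ i - μ j := by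
  have hi : (i : ℕ) < r := by have := j.2; rw [Fin.lt_def] at hij; omega
  have h1 := gap_le_sub_succ μ ⟨i, hi⟩
  have h2 : μ j ≤ μ (Fin.succ ⟨i, hi⟩) :=
    antitone_of_gap_nonneg h (Fin.le_def.mpr (by rw [Fin.val_succ]; exact hij))
  have h3 : Fin.castSucc ⟨(i : ℕ), hi⟩ = i := rfl
  rw [h3] at h1
  linarith

/-- The rotation disappears, so all estimates are automatically uniform in ζ. -/
theorem blockProb_eq {r : ℕ} (μ : Fin (r + 1) → ℝ) (n : ℕ) (u : Fin r → ℝ)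
    (ζ : Fin (r + 1) → Fin (r + 1) → ℂ) (l : Fin (r + 1) → ℕ) :
    blockProb μ n u ζ l =
      whichBlock n (Matrix.diagonal fun i => (localSpectrum μ n u i : ℂ)) l :=
  whichBlock_unitary_conj _ _ (localRotation_unitary _ _) l

/-! ### The smoothed distribution -/

/-- The cube on which `tauDensity μ n l` is supported. -/
def cube {r : ℕ} (μ : Fin (r + 1) → ℝ) (n : ℕ) (l : Fin (r + 1) → ℕ) : Set (Fin r → ℝ) :=
  {x | ∀ i : Fin r, |Real.sqrt n * x i + n * μ i.castSucc - (l i.castSucc : ℝ)| ≤ 1 / 2}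

/-- The interior of `cube μ n l`. -/
def openCube {r : ℕ} (μ : Fin (r + 1) → ℝ) (n : ℕ) (l : Fin (r + 1) → ℕ) : Set (Fin r → ℝ) :=
  {x | ∀ i : Fin r, |Real.sqrt n * x i + n * μ i.castSucc - (l i.castSucc : ℝ)| < 1 / 2}

theorem cube_eq_Icc {r : ℕ} (μ : Fin (r + 1) → ℝ) {n : ℕ} (hn : 1 ≤ n) (l : Fin (r + 1) → ℕ) :
    cube μ n l = Set.Icc (fun i => ((l i.castSucc : ℝ) - n * μ i.castSucc - 1 / 2) / Real.sqrt n)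
      (fun i => ((l i.castSucc : ℝ) - n * μ i.castSucc + 1 / 2) / Real.sqrt n) := by
  have hs : 0 < Real.sqrt n := Real.sqrt_pos.mpr (by exact_mod_cast hn)
  ext x
  simp only [cube, Set.mem_ofPred_eq, Set.mem_Icc, Pi.le_def, abs_le, div_le_iff₀ hs,
    le_div_iff₀ hs]
  constructor
  · intro h
    exact ⟨fun i => by linarith [(h i).1], fun i => by linarith [(h i).2]⟩
  · rintro ⟨h1, h2⟩ i
    exact ⟨by linarith [h1 i], by linarith [h2 i]⟩

theorem openCube_eq_pi {r : ℕ} (μ : Fin (r + 1) → ℝ) {n : ℕ} (hn : 1 ≤ n)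
    (l : Fin (r + 1) → ℕ) :
    openCube μ n l = Set.pi Set.univ fun i : Fin r =>
      Set.Ioo (((l i.castSucc : ℝ) - n * μ i.castSucc - 1 / 2) / Real.sqrt n)
        (((l i.castSucc : ℝ) - n * μ i.castSucc + 1 / 2) / Real.sqrt n) := by
  have hs : 0 < Real.sqrt n := Real.sqrt_pos.mpr (by exact_mod_cast hn)
  ext x
  simp only [openCube, Set.mem_ofPred_eq, Set.mem_pi, Set.mem_univ, true_imp_iff, Set.mem_Ioo,
    abs_lt, div_lt_iff₀ hs, lt_div_iff₀ hs]
  refine forall_congr' fun i => ?_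
  constructor
  · rintro ⟨h1, h2⟩; exact ⟨by linarith, by linarith⟩
  · rintro ⟨h1, h2⟩; exact ⟨by linarith, by linarith⟩

theorem openCube_ae_eq_cube {r : ℕ} (μ : Fin (r + 1) → ℝ) {n : ℕ} (hn : 1 ≤ n)
    (l : Fin (r + 1) → ℕ) : openCube μ n l =ᵐ[volume] cube μ n l := by
  rw [openCube_eq_pi μ hn, cube_eq_Icc μ hn]
  exact Measure.univ_pi_Ioo_ae_eq_Icc

theorem measurableSet_cube {r : ℕ} (μ : Fin (r + 1) → ℝ) {n : ℕ} (hn : 1 ≤ n)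
    (l : Fin (r + 1) → ℕ) : MeasurableSet (cube μ n l) := by
  rw [cube_eq_Icc μ hn]; exact measurableSet_Icc

theorem measurableSet_openCube {r : ℕ} (μ : Fin (r + 1) → ℝ) {n : ℕ} (hn : 1 ≤ n)
    (l : Fin (r + 1) → ℕ) : MeasurableSet (openCube μ n l) := by
  rw [openCube_eq_pi μ hn]
  exact MeasurableSet.univ_pi fun i => measurableSet_Ioo

theorem volume_cube {r : ℕ} (μ : Fin (r + 1) → ℝ) {n : ℕ} (hn : 1 ≤ n)
    (l : Fin (r + 1) → ℕ) : volume (cube μ n l) = ENNReal.ofReal ((1 / Real.sqrt n) ^ r) := by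
  have hs : 0 < Real.sqrt n := Real.sqrt_pos.mpr (by exact_mod_cast hn)
  rw [cube_eq_Icc μ hn, Real.volume_Icc_pi, ENNReal.ofReal_pow (by positivity)]
  rw [Finset.prod_congr rfl (g := fun _ => ENNReal.ofReal (1 / Real.sqrt n)), Finset.prod_const,
    Finset.card_univ, Fintype.card_fin]
  intro i _
  congr 1; ring

theorem tauDensity_eq_indicator {r : ℕ} (μ : Fin (r + 1) → ℝ) (n : ℕ) (l : Fin (r + 1) → ℕ) :
    tauDensity μ n l = (cube μ n l).indicator fun _ => Real.sqrt n ^ r := rfl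

theorem integrable_tauDensity {r : ℕ} (μ : Fin (r + 1) → ℝ) {n : ℕ} (hn : 1 ≤ n)
    (l : Fin (r + 1) → ℕ) : Integrable (tauDensity μ n l) := by
  rw [tauDensity_eq_indicator, integrable_indicator_iff (measurableSet_cube μ hn l)]
  exact integrableOn_const (by rw [volume_cube μ hn]; exact ENNReal.ofReal_ne_top)

theorem integral_tauDensity {r : ℕ} (μ : Fin (r + 1) → ℝ) {n : ℕ} (hn : 1 ≤ n)
    (l : Fin (r + 1) → ℕ) : ∫ x, tauDensity μ n l x = 1 := by
  have hs : 0 < Real.sqrt n := Real.sqrt_pos.mpr (by exact_mod_cast hn)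
  rw [tauDensity_eq_indicator, integral_indicator (measurableSet_cube μ hn l), setIntegral_const,
    Measure.real, volume_cube μ hn, ENNReal.toReal_ofReal (by positivity), smul_eq_mul,
    ← mul_pow, one_div, inv_mul_cancel₀ hs.ne', one_pow]

theorem tauDensity_nonneg {r : ℕ} (μ : Fin (r + 1) → ℝ) (n : ℕ) (l : Fin (r + 1) → ℕ)
    (x : Fin r → ℝ) : 0 ≤ tauDensity μ n l x :=
  Set.indicator_nonneg (fun _ _ => pow_nonneg (Real.sqrt_nonneg _) _) x

/-- The density `∑ p_l τ_l`. -/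
def smoothed {r : ℕ} (μ : Fin (r + 1) → ℝ) (n : ℕ) (p : (Fin (r + 1) → ℕ) → ℝ)
    (x : Fin r → ℝ) : ℝ := ∑ l ∈ diagrams (r + 1) n, p l * tauDensity μ n l x

theorem integrable_smoothed {r : ℕ} (μ : Fin (r + 1) → ℝ) {n : ℕ} (hn : 1 ≤ n)
    (p : (Fin (r + 1) → ℕ) → ℝ) : Integrable (smoothed μ n p) :=
  integrable_finsetSum _ fun l _ => (integrable_tauDensity μ hn l).const_mul _

theorem integral_smoothed {r : ℕ} (μ : Fin (r + 1) → ℝ) {n : ℕ} (hn : 1 ≤ n)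
    (p : (Fin (r + 1) → ℕ) → ℝ) :
    ∫ x, smoothed μ n p x = ∑ l ∈ diagrams (r + 1) n, p l := by
  unfold smoothed
  rw [integral_finsetSum _ fun l _ => (integrable_tauDensity μ hn l).const_mul _]
  refine Finset.sum_congr rfl fun l _ => ?_
  rw [integral_const_mul, integral_tauDensity μ hn, mul_one]

/-- Two integrable functions, where the integral of the second is at most that of the first, are
close in `L¹` if the second is not much smaller than the first. -/
theorem integral_abs_sub_le_of_le {α : Type*} [MeasurableSpace α] {ν : Measure α} {f g h : α → ℝ}
    (hf : Integrable f ν) (hg : Integrable g ν) (hh : Integrable h ν)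
    (hfg : ∫ x, g x ∂ν ≤ ∫ x, f x ∂ν) (h0 : ∀ x, 0 ≤ h x) (hle : ∀ x, f x - g x ≤ h x) :
    ∫ x, |f x - g x| ∂ν ≤ 2 * ∫ x, h x ∂ν := by
  -- This is `|a| = 2 a⁺ - a` with `a⁺ ≤ h`; the integral of `a` is nonnegative by hypothesis.
  have h1 : ∀ x, |f x - g x| ≤ 2 * h x - (f x - g x) := by
    intro x
    rw [abs_le]
    constructor <;> linarith [h0 x, hle x]
  calc ∫ x, |f x - g x| ∂ν ≤ ∫ x, 2 * h x - (f x - g x) ∂ν :=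
        integral_mono (hf.sub hg).abs ((hh.const_mul 2).sub (hf.sub hg)) h1
    _ = 2 * ∫ x, h x ∂ν - (∫ x, f x ∂ν - ∫ x, g x ∂ν) := by
        have h2 : ∫ x, 2 * h x - (f x - g x) ∂ν = ∫ x, 2 * h x ∂ν - ∫ x, (f x - g x) ∂ν :=
          integral_sub (hh.const_mul 2) (hf.sub hg)
        rw [h2, integral_const_mul, integral_sub hf hg]
    _ ≤ _ := by linarith

/-- A point of the bulk lies in the cube of some tuple of row lengths. -/
theorem exists_cube_mem {r : ℕ} {μ : Fin (r + 1) → ℝ} (h1 : ∑ i, μ i = 1) {n : ℕ}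
    {E : ℝ} (x : Fin r → ℝ) (hx : ∀ i, |x i| ≤ E) (hE : (r : ℝ) * (Real.sqrt n * E + 1) ≤ n * μ (Fin.last r))
    (hE' : ∀ i : Fin r, Real.sqrt n * E ≤ n * μ i.castSucc) :
    ∃ l : Fin (r + 1) → ℕ, ∑ i, l i = n ∧ x ∈ cube μ n l := by
  have hs : 0 ≤ Real.sqrt n := Real.sqrt_nonneg _
  set z : Fin r → ℝ := fun i => Real.sqrt n * x i + n * μ i.castSucc with hz
  have hbd : ∀ i, |Real.sqrt n * x i| ≤ Real.sqrt n * E := fun i => by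
    rw [abs_mul, abs_of_nonneg hs]; exact mul_le_mul_of_nonneg_left (hx i) hs
  have hz0 : ∀ i, 0 ≤ z i := fun i => by
    have h2 := (abs_le.mp (hbd i)).1
    have h3 := hE' i
    simp only [hz]; linarith
  have hr0 : ∀ i, 0 ≤ round (z i) := fun i => by
    have h2 := (abs_le.mp (abs_sub_round (z i))).2
    by_contra h
    push Not at h
    have h3 : (round (z i) : ℝ) ≤ -1 := by exact_mod_cast Int.le_sub_one_of_lt h
    linarith [hz0 i]
  set m : Fin r → ℕ := fun i => (round (z i)).toNat with hm
  have hmr : ∀ i, (m i : ℝ) = round (z i) := fun i => by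
    have : ((m i : ℤ)) = round (z i) := Int.toNat_of_nonneg (hr0 i)
    exact_mod_cast congrArg (fun t : ℤ => (t : ℝ)) this
  have hmz : ∀ i, |z i - m i| ≤ 1 / 2 := fun i => by rw [hmr]; exact abs_sub_round (z i)
  have hsum : ∑ i, m i ≤ n := by
    have h2 : ∑ i, (m i : ℝ) ≤ ∑ i : Fin r, (n * μ i.castSucc + (Real.sqrt n * E + 1)) := by
      refine Finset.sum_le_sum fun i _ => ?_
      have h3 := (abs_le.mp (hmz i)).1
      have h4 := (abs_le.mp (hbd i)).2
      simp only [hz] at h3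
      linarith
    rw [Finset.sum_add_distrib, ← Finset.mul_sum, Finset.sum_const, Finset.card_univ,
      Fintype.card_fin, nsmul_eq_mul] at h2
    rw [Fin.sum_univ_castSucc] at h1
    have h5 : ∑ i : Fin r, μ i.castSucc = 1 - μ (Fin.last r) := by linarith
    rw [h5] at h2
    have h6 : ((∑ i, m i : ℕ) : ℝ) ≤ n := by push_cast; linarith
    exact_mod_cast h6
  -- The last row takes the remaining boxes; by `hsum` the natural subtraction is not truncated.
  refine ⟨Fin.snoc (α := fun _ => ℕ) m (n - ∑ i, m i), ?_, fun i => ?_⟩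
  · rw [Fin.sum_univ_castSucc]
    simp only [Fin.snoc_castSucc, Fin.snoc_last]
    omega
  · rw [Fin.snoc_castSucc]; exact hmz i

/-- The `L¹` distance between the Gaussian density and the smoothed block distribution, with
explicit bounds. -/
theorem integral_abs_gaussDensity_sub_smoothed_le {r : ℕ} {μ : Fin (r + 1) → ℝ}
    (h1 : ∑ i, μ i = 1) {δ : ℝ} (hδ : 0 < δ) (hμδ : ∀ i, δ ≤ μ i)
    (hgap : ∀ i j, i < j → δ ≤ μ i - μ j) {n : ℕ} (hn : 1 ≤ n) {A Z B : ℝ} (hA : 1 ≤ A)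
    (hZ : 1 ≤ Z) (hB : Z ^ 3 * A = B * (Real.sqrt n * δ ^ 2)) (hCB : comparisonConst r * B ≤ 1)
    {u : Fin r → ℝ} (hu : ∀ i, |u i| ≤ A) (hpos : ∀ i, 0 ≤ localSpectrum μ n u i)
    (ζ : Fin (r + 1) → Fin (r + 1) → ℂ) :
    ∫ x, |gaussDensity μ u x - smoothed μ n (blockProb μ n u ζ) x| ≤
      2 * (comparisonConst r * B + Real.sqrt 2 ^ r * Real.exp (-(Z ^ 2 / 4))) := by
  have hμ : ∀ i, 0 < μ i := fun i => hδ.trans_le (hμδ i)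
  have hδ1 : δ ≤ 1 := by
    refine (hμδ 0).trans ?_
    rw [← h1]; exact Finset.single_le_sum (fun j _ => (hμ j).le) (Finset.mem_univ 0)
  have hs1 : 1 ≤ Real.sqrt n := Real.one_le_sqrt.mpr (by exact_mod_cast hn)
  have hsq : Real.sqrt n ^ 2 = n := Real.sq_sqrt (Nat.cast_nonneg n)
  have hsum1 : ∑ l ∈ diagrams (r + 1) n, blockProb μ n u ζ l ≤ 1 := by
    simp only [blockProb_eq]
    exact sum_whichBlock_diagonal_le _ hpos (by rw [sum_localSpectrum, h1])
  have hp0 : ∀ l, 0 ≤ blockProb μ n u ζ l := fun l => by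
    rw [blockProb_eq]; exact whichBlock_diagonal_nonneg _ hpos l
  have hB0 : 0 < B := by
    have h2 : 0 < B * (Real.sqrt n * δ ^ 2) := by rw [← hB]; positivity
    exact pos_of_mul_pos_left h2 (by positivity)
  have hC0 : 0 ≤ comparisonConst r := by unfold comparisonConst; positivity
  have hφ := integrable_gaussDensity hμ h1 u
  have hg0 : ∀ x, 0 ≤ smoothed μ n (blockProb μ n u ζ) x := fun x =>
    Finset.sum_nonneg fun l _ => mul_nonneg (hp0 l) (tauDensity_nonneg _ _ _ _)
  set bad : Set (Fin r → ℝ) := {x | Z ^ 2 < quadForm μ (x - u)} with hbad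
  have hmeas : MeasurableSet bad :=
    (isOpen_lt continuous_const
      ((continuous_quadForm μ).comp (continuous_id.sub continuous_const))).measurableSet
  -- On the bulk the loss is the relative error times the Gaussian; off the bulk the whole Gaussian
  -- is given up.
  set h : (Fin r → ℝ) → ℝ := fun x =>
    comparisonConst r * B * gaussDensity μ u x + bad.indicator (gaussDensity μ u) x with hh
  have hhint : Integrable h := (hφ.const_mul _).add (hφ.indicator hmeas)
  have hhI : ∫ x, h x ≤ comparisonConst r * B + Real.sqrt 2 ^ r * Real.exp (-(Z ^ 2 / 4)) := by
    rw [hh, integral_add (hφ.const_mul _) (hφ.indicator hmeas), integral_const_mul,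
      integral_gaussDensity hμ h1, mul_one, integral_indicator hmeas]
    have := setIntegral_gaussDensity_le hμ h1 u (Z ^ 2)
    linarith
  refine (integral_abs_sub_le_of_le hφ (integrable_smoothed μ hn _) hhint ?_ ?_ ?_).trans
    (by linarith)
  · rw [integral_smoothed μ hn, integral_gaussDensity hμ h1]; exact hsum1
  · intro x
    exact add_nonneg (mul_nonneg (mul_nonneg hC0 hB0.le) (gaussDensity_nonneg _ _ _))
      (Set.indicator_nonneg (fun x _ => gaussDensity_nonneg μ u x) x)
  · intro x
    by_cases hx : x ∈ bad
    · have h2 : h x = comparisonConst r * B * gaussDensity μ u x + gaussDensity μ u x := by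
        simp only [hh, Set.indicator_of_mem hx]
      rw [h2]
      have h3 := mul_nonneg (mul_nonneg hC0 hB0.le) (gaussDensity_nonneg μ u x)
      linarith [hg0 x]
    · have hQ : quadForm μ (x - u) ≤ Z ^ 2 := not_lt.mp hx
      have he := abs_completeZero_le hμ h1 (by linarith) hQ
      have hxE : ∀ i, |x i| ≤ Z + A := by
        intro i
        have h2 := he i.castSucc
        have h3 : completeZero (x - u) i.castSucc = x i - u i := by simp [completeZero]
        rw [h3] at h2
        have h4 : |x i| ≤ |x i - u i| + |u i| := by simpa using abs_add_le (x i - u i) (u i)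
        linarith [hu i]
      have hD1 : (1 : ℝ) ≤ r + 1 := by linarith [(Nat.cast_nonneg r : (0 : ℝ) ≤ r)]
      have hDB : 400 * ((r + 1 : ℝ) * B) ≤ 1 := by
        have h2 : (r + 1 : ℝ) ≤ (r + 1 : ℝ) ^ 4 := le_self_pow₀ hD1 (by norm_num)
        have h3 := mul_le_mul_of_nonneg_right h2 hB0.le
        unfold comparisonConst at hCB
        linarith
      have hZA : Z + A + 1 ≤ 3 * (Z ^ 3 * A) := by
        have h2 : Z ≤ Z ^ 3 := le_self_pow₀ hZ (by norm_num)
        have h3 : (1 : ℝ) ≤ Z ^ 3 := one_le_pow₀ hZ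
        have h4 : Z ^ 3 ≤ Z ^ 3 * A := le_mul_of_one_le_right (by linarith) hA
        have h5 : A ≤ Z ^ 3 * A := le_mul_of_one_le_left (by linarith) h3
        linarith
      -- The deviations on the bulk, at most `Z + A`, are small against `√n δ`, so rounding gives
      -- nonnegative rows with n boxes in total.
      have hkey : (r + 1 : ℝ) * (Real.sqrt n * (Z + A) + 1) ≤ n * δ := by
        have h2 : Real.sqrt n * (Z + A) + 1 ≤ Real.sqrt n * (3 * (Z ^ 3 * A)) := by
          have := mul_le_mul_of_nonneg_left hZA (Real.sqrt_nonneg n)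
          linarith
        rw [hB] at h2
        have h3 : (r + 1 : ℝ) * (Real.sqrt n * (Z + A) + 1) ≤
            (r + 1 : ℝ) * (Real.sqrt n * (3 * (B * (Real.sqrt n * δ ^ 2)))) :=
          mul_le_mul_of_nonneg_left h2 (by linarith)
        have h4 : (r + 1 : ℝ) * (Real.sqrt n * (3 * (B * (Real.sqrt n * δ ^ 2)))) =
            3 * ((r + 1 : ℝ) * B) * (Real.sqrt n ^ 2 * δ ^ 2) := by ring
        rw [hsq] at h4
        have h5 : 3 * ((r + 1 : ℝ) * B) * (n * δ ^ 2) ≤ 1 * (n * δ ^ 2) :=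
          mul_le_mul_of_nonneg_right (by linarith) (by positivity)
        have h6 : (n : ℝ) * δ ^ 2 ≤ n * δ :=
          mul_le_mul_of_nonneg_left (by nlinarith) (Nat.cast_nonneg n)
        linarith
      have hX0 : 0 ≤ Real.sqrt n * (Z + A) := mul_nonneg (Real.sqrt_nonneg n) (by linarith)
      have hrX : 0 ≤ (r : ℝ) * (Real.sqrt n * (Z + A) + 1) :=
        mul_nonneg (Nat.cast_nonneg r) (by linarith)
      obtain ⟨l, hl, hxl⟩ := exists_cube_mem (n := n) (E := Z + A) h1 x hxE
        (by
          have := mul_le_mul_of_nonneg_left (hμδ (Fin.last r)) (Nat.cast_nonneg (α := ℝ) n)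
          linarith)
        (fun i => by
          have := mul_le_mul_of_nonneg_left (hμδ i.castSucc) (Nat.cast_nonneg (α := ℝ) n)
          linarith)
      obtain ⟨hanti, hge⟩ := whichBlock_ge_gaussDensity h1 hδ hμδ hgap hn hA hZ hB hCB hu hl hxl hQ
      have hld : l ∈ diagrams (r + 1) n := by
        simp [diagrams, Finset.mem_filter, Finset.mem_piAntidiag, hl, hanti]
      have h2 : blockProb μ n u ζ l * Real.sqrt n ^ r ≤ smoothed μ n (blockProb μ n u ζ) x := by
        have h3 := Finset.single_le_sum
          (f := fun l => blockProb μ n u ζ l * tauDensity μ n l x)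
          (fun l _ => mul_nonneg (hp0 l) (tauDensity_nonneg μ n l x)) hld
        rwa [tauDensity_eq_indicator, Set.indicator_of_mem hxl] at h3
      rw [blockProb_eq] at h2
      have h4 : h x = comparisonConst r * B * gaussDensity μ u x := by
        simp only [hh, Set.indicator_of_notMem hx, add_zero]
      rw [h4]
      have h5 := Real.add_one_le_exp (-(comparisonConst r * B))
      have h6 := mul_le_mul_of_nonneg_left h5 (gaussDensity_nonneg μ u x)
      linarith

theorem integral_abs_gaussDensity_sub_smoothed_le_two {r : ℕ} {μ : Fin (r + 1) → ℝ}
    (h1 : ∑ i, μ i = 1) (hμ : ∀ i, 0 < μ i) {n : ℕ} (hn : 1 ≤ n)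
    {u : Fin r → ℝ} (hpos : ∀ i, 0 ≤ localSpectrum μ n u i)
    (ζ : Fin (r + 1) → Fin (r + 1) → ℂ) :
    ∫ x, |gaussDensity μ u x - smoothed μ n (blockProb μ n u ζ) x| ≤ 2 := by
  have hφ := integrable_gaussDensity hμ h1 u
  have hsum1 : ∑ l ∈ diagrams (r + 1) n, blockProb μ n u ζ l ≤ 1 := by
    simp only [blockProb_eq]
    exact sum_whichBlock_diagonal_le _ hpos (by rw [sum_localSpectrum, h1])
  have h := integral_abs_sub_le_of_le hφ (integrable_smoothed μ hn (blockProb μ n u ζ)) hφ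
    (by rw [integral_smoothed μ hn, integral_gaussDensity hμ h1]; exact hsum1)
    (gaussDensity_nonneg μ u) (fun x => by
      have : 0 ≤ smoothed μ n (blockProb μ n u ζ) x := Finset.sum_nonneg fun l _ => mul_nonneg
        (by rw [blockProb_eq]; exact whichBlock_diagonal_nonneg _ hpos l)
        (tauDensity_nonneg _ _ _ _)
      linarith)
  rwa [integral_gaussDensity hμ h1, mul_one] at h

/-! ### The discretised Gaussian distribution -/

theorem youngOf_eq_of_mem {r : ℕ} {μ : Fin (r + 1) → ℝ} {n : ℕ} (κ : Fin (r + 1) → ℕ)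
    {l : Fin (r + 1) → ℕ} (hl : l ∈ diagrams (r + 1) n) {x : Fin r → ℝ}
    (hx : x ∈ openCube μ n l) : youngOf μ n κ x = l := by
  have h : ∃ l ∈ diagrams (r + 1) n, ∀ i : Fin r,
      |Real.sqrt n * x i + n * μ i.castSucc - (l i.castSucc : ℝ)| < 1 / 2 := ⟨l, hl, hx⟩
  unfold youngOf
  rw [dif_pos h]
  obtain ⟨hd, hc⟩ := h.choose_spec
  set l' := h.choose
  have hcs : ∀ i : Fin r, l' i.castSucc = l i.castSucc := by
    intro i
    have h2 := abs_lt.mp (hc i)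
    have h3 := abs_lt.mp (hx i)
    have h4 : (l' i.castSucc : ℝ) < l i.castSucc + 1 := by linarith [h2.1, h3.2]
    have h5 : (l i.castSucc : ℝ) < l' i.castSucc + 1 := by linarith [h2.2, h3.1]
    have h6 : l' i.castSucc < l i.castSucc + 1 := by exact_mod_cast h4
    have h7 : l i.castSucc < l' i.castSucc + 1 := by exact_mod_cast h5
    omega
  simp only [diagrams, Finset.mem_filter, Finset.mem_piAntidiag] at hd hl
  have h8 := hd.1.1.trans hl.1.1.symm
  simp only [Fin.sum_univ_castSucc, hcs] at h8
  funext i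
  refine Fin.lastCases ?_ (fun i => hcs i) i
  exact Nat.add_left_cancel h8

theorem exists_openCube_of_youngOf_ne {r : ℕ} {μ : Fin (r + 1) → ℝ} {n : ℕ}
    {κ : Fin (r + 1) → ℕ} {x : Fin r → ℝ} (h : youngOf μ n κ x ≠ κ) :
    youngOf μ n κ x ∈ diagrams (r + 1) n ∧ x ∈ openCube μ n (youngOf μ n κ x) := by
  unfold youngOf at h ⊢
  split_ifs at h ⊢ with h1
  · exact h1.choose_spec
  · exact absurd rfl h

/-- Although `youngOf` is defined by choice, the open cubes of distinct diagrams are disjoint. So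
the fibre over a diagram other than κ is its open cube, and the fibre over κ is the complement of
the other cubes. -/
theorem measurableSet_youngOf_eq {r : ℕ} (μ : Fin (r + 1) → ℝ) {n : ℕ} (hn : 1 ≤ n)
    (κ : Fin (r + 1) → ℕ) {l : Fin (r + 1) → ℕ} (hl : l ∈ diagrams (r + 1) n) :
    MeasurableSet {x : Fin r → ℝ | youngOf μ n κ x = l} := by
  by_cases h : l = κ
  · have : {x : Fin r → ℝ | youngOf μ n κ x = l} =
        (⋃ l' ∈ (diagrams (r + 1) n).erase l, openCube μ n l')ᶜ := by
      ext x
      simp only [Set.mem_ofPred_eq, Set.mem_compl_iff, Set.mem_iUnion, Finset.mem_erase, not_exists]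
      constructor
      · intro hx l' hl' hxl'
        exact hl'.1 ((youngOf_eq_of_mem κ hl'.2 hxl').symm.trans hx)
      · intro hx
        by_contra hne
        have h2 := exists_openCube_of_youngOf_ne (h ▸ hne)
        exact hx _ ⟨hne, h2.1⟩ h2.2
    rw [this]
    exact (Finset.measurableSet_biUnion _ fun l' _ => measurableSet_openCube μ hn l').compl
  · have : {x : Fin r → ℝ | youngOf μ n κ x = l} = openCube μ n l := by
      ext x
      simp only [Set.mem_ofPred_eq]
      constructor
      · intro hx
        have := (exists_openCube_of_youngOf_ne (κ := κ) (by rw [hx]; exact h)).2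
        rwa [hx] at this
      · exact youngOf_eq_of_mem κ hl
    rw [this]
    exact measurableSet_openCube μ hn l

/-- Up to the null boundary, the cube of `l'` lies in the fibre over `l'`. -/
theorem setIntegral_tauDensity {r : ℕ} (μ : Fin (r + 1) → ℝ) {n : ℕ} (hn : 1 ≤ n)
    (κ : Fin (r + 1) → ℕ) {l l' : Fin (r + 1) → ℕ} (hl : l ∈ diagrams (r + 1) n)
    (hl' : l' ∈ diagrams (r + 1) n) :
    ∫ x in {x | youngOf μ n κ x = l}, tauDensity μ n l' x = if l' = l then 1 else 0 := by
  rw [← integral_indicator (measurableSet_youngOf_eq μ hn κ hl)]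
  have hae := openCube_ae_eq_cube μ hn l'
  have hmem : ∀ᵐ x, x ∈ cube μ n l' → x ∈ openCube μ n l' := by
    filter_upwards [hae.mem_iff] with x hx
    exact hx.mpr
  split_ifs with h
  · subst h
    rw [← integral_tauDensity μ hn l']
    refine integral_congr_ae ?_
    filter_upwards [hmem] with x hx
    by_cases hxc : x ∈ cube μ n l'
    · rw [Set.indicator_of_mem]
      exact youngOf_eq_of_mem κ hl' (hx hxc)
    · rw [Set.indicator_apply, tauDensity_eq_indicator, Set.indicator_of_notMem hxc, ite_self]
  · rw [← integral_zero (Fin r → ℝ) ℝ]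
    refine integral_congr_ae ?_
    filter_upwards [hmem] with x hx
    by_cases hxc : x ∈ cube μ n l'
    · rw [Set.indicator_of_notMem]
      intro hxl
      exact h ((youngOf_eq_of_mem κ hl' (hx hxc)).symm.trans hxl)
    · rw [Set.indicator_apply, tauDensity_eq_indicator, Set.indicator_of_notMem hxc, ite_self]

/-- Discretising does not increase the `L¹` distance. -/
theorem sum_abs_sigmaGauss_sub_le {r : ℕ} {μ : Fin (r + 1) → ℝ} (h1 : ∑ i, μ i = 1)
    (hμ : ∀ i, 0 < μ i) {n : ℕ} (hn : 1 ≤ n) {κ : Fin (r + 1) → ℕ}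
    (u : Fin r → ℝ) (p : (Fin (r + 1) → ℕ) → ℝ) :
    ∑ l ∈ diagrams (r + 1) n, |sigmaGauss μ n κ u l - p l| ≤
      ∫ x, |gaussDensity μ u x - smoothed μ n p x| := by
  have hφ := integrable_gaussDensity hμ h1 u
  have hg := integrable_smoothed μ hn p
  have hint : Integrable fun x => |gaussDensity μ u x - smoothed μ n p x| := (hφ.sub hg).abs
  have hterm : ∀ l ∈ diagrams (r + 1) n, |sigmaGauss μ n κ u l - p l| ≤
      ∫ x in {x | youngOf μ n κ x = l}, |gaussDensity μ u x - smoothed μ n p x| := by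
    intro l hl
    -- Discretising the smoothed density returns p, so both distributions are integrals over the
    -- same disjoint fibres.
    have h2 : ∫ x in {x | youngOf μ n κ x = l}, smoothed μ n p x = p l := by
      unfold smoothed
      rw [integral_finsetSum _ fun l' _ => ((integrable_tauDensity μ hn l').const_mul _).integrableOn]
      rw [Finset.sum_eq_single l]
      · rw [integral_const_mul, setIntegral_tauDensity μ hn κ hl hl, if_pos rfl, mul_one]
      · intro l' hl' hne
        rw [integral_const_mul, setIntegral_tauDensity μ hn κ hl hl', if_neg hne, mul_zero]
      · intro h; exact absurd hl h
    have h3 : sigmaGauss μ n κ u l - p l =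
        ∫ x in {x | youngOf μ n κ x = l}, (gaussDensity μ u x - smoothed μ n p x) := by
      rw [integral_sub hφ.integrableOn hg.integrableOn, h2]; rfl
    rw [h3]
    exact abs_integral_le_integral_abs
  refine (Finset.sum_le_sum hterm).trans ?_
  rw [← integral_biUnion_finset _ (fun l hl => measurableSet_youngOf_eq μ hn κ hl) ?_
    (fun l _ => hint.integrableOn)]
  · exact setIntegral_le_integral hint (Filter.Eventually.of_forall fun x => abs_nonneg _)
  · intro l _ l' _ hne
    refine Set.disjoint_left.mpr fun x hx hx' => hne ?_
    exact (hx : youngOf μ n κ x = l).symm.trans hx'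

/-! ### Rates -/

/-- Since `exp t ≥ t ^ k / k!` with t of order `n^(2γ/3)`, the condition `k ≥ 3/(8γ)` is what makes
`t ^ k` at least of order `n^(1/4)`. -/
theorem exp_neg_rpow_le {γ : ℝ} {k : ℕ} (hk : 3 / (8 * γ) ≤ k) (hγ : 0 < γ) {n : ℕ} (hn : 1 ≤ n) :
    Real.exp (-(((n : ℝ) ^ (γ / 3)) ^ 2 / 4)) ≤
      k.factorial * 4 ^ k * (n : ℝ) ^ (-(1 / 4) + γ) := by
  have hn1 : (1 : ℝ) ≤ n := by exact_mod_cast hn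
  have hn0 : (0 : ℝ) < n := by linarith
  set t : ℝ := ((n : ℝ) ^ (γ / 3)) ^ 2 / 4 with ht
  have ht0 : 0 < t := by positivity
  have h1 : t ^ k / k.factorial ≤ Real.exp t := Real.pow_div_factorial_le_exp t ht0.le k
  have h2 : t ^ k = (n : ℝ) ^ (2 * γ / 3 * k) / 4 ^ k := by
    rw [ht, div_pow, ← pow_mul, ← Real.rpow_natCast ((n : ℝ) ^ (γ / 3)), ← Real.rpow_mul hn0.le]
    congr 2; push_cast; ring
  have h3 : (n : ℝ) ^ (1 / 4 : ℝ) ≤ (n : ℝ) ^ (2 * γ / 3 * k) := by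
    refine Real.rpow_le_rpow_of_exponent_le hn1 ?_
    rw [div_le_iff₀ (by positivity)] at hk
    linarith
  have h4 : (n : ℝ) ^ (-(1 / 4 : ℝ)) ≤ (n : ℝ) ^ (-(1 / 4) + γ) :=
    Real.rpow_le_rpow_of_exponent_le hn1 (by linarith)
  have h5 : (n : ℝ) ^ (1 / 4 : ℝ) / (4 ^ k * k.factorial) ≤ Real.exp t := by
    calc (n : ℝ) ^ (1 / 4 : ℝ) / (4 ^ k * k.factorial)
        ≤ (n : ℝ) ^ (2 * γ / 3 * k) / (4 ^ k * k.factorial) :=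
          div_le_div_of_nonneg_right h3 (by positivity)
      _ = t ^ k / k.factorial := by rw [h2, div_div]
      _ ≤ Real.exp t := h1
  rw [Real.exp_neg]
  calc (Real.exp t)⁻¹ ≤ ((n : ℝ) ^ (1 / 4 : ℝ) / (4 ^ k * k.factorial))⁻¹ :=
        inv_anti₀ (by positivity) h5
    _ = k.factorial * 4 ^ k * (n : ℝ) ^ (-(1 / 4 : ℝ)) := by
        rw [Real.rpow_neg hn0.le, inv_div]; field_simp
    _ ≤ _ := mul_le_mul_of_nonneg_left h4 (by positivity)

theorem exists_L1_rate (r : ℕ) {γ : ℝ} (hγ : 0 < γ) :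
    ∃ C : ℝ, 0 < C ∧ ∀ μ : Fin (r + 1) → ℝ, ∑ i, μ i = 1 → 0 < gap μ → ∀ n : ℕ, 1 ≤ n →
      ∀ u : Fin r → ℝ, (∀ i, |u i| ≤ (n : ℝ) ^ γ) → (∀ i, 0 ≤ localSpectrum μ n u i) →
      ∀ ζ : Fin (r + 1) → Fin (r + 1) → ℂ,
        ∫ x, |gaussDensity μ u x - smoothed μ n (blockProb μ n u ζ) x| ≤
          C * (n : ℝ) ^ (-(1 / 4) + γ) / gap μ := by
  obtain ⟨k, hk⟩ := exists_nat_ge (3 / (8 * γ))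
  set C1 := comparisonConst r with hC1
  have hC1' : 1 ≤ C1 := by
    rw [hC1, comparisonConst]
    have : (1 : ℝ) ≤ ((r : ℝ) + 1) ^ 4 :=
      one_le_pow₀ (by linarith [(Nat.cast_nonneg r : (0 : ℝ) ≤ r)])
    linarith
  set C2 : ℝ := Real.sqrt 2 ^ r * (k.factorial * 4 ^ k) with hC2
  have hC2' : 0 < C2 := by positivity
  refine ⟨2 * (C1 + C2), by linarith, fun μ h1 hgap n hn u hu hpos ζ => ?_⟩
  have hn1 : (1 : ℝ) ≤ n := by exact_mod_cast hn
  have hn0 : (0 : ℝ) < n := by linarith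
  set δ := gap μ with hδ
  have hμ : ∀ i, 0 < μ i := fun i => hgap.trans_le (gap_le hgap.le i)
  have hδ1 : δ ≤ 1 := by
    refine (gap_le hgap.le 0).trans ?_
    rw [← h1]; exact Finset.single_le_sum (fun j _ => (hμ j).le) (Finset.mem_univ 0)
  set S := (n : ℝ) ^ (-(1 / 4) + γ) with hS
  have hS0 : 0 < S := Real.rpow_pos_of_pos hn0 _
  have hSδ : S ≤ S / δ := by rw [le_div_iff₀ hgap]; nlinarith
  -- In the other case the claimed bound exceeds the trivial bound 2.
  by_cases hsmall : C1 * (S / δ) ≤ 1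
  · set A := (n : ℝ) ^ γ with hA
    set Z := (n : ℝ) ^ (γ / 3) with hZ
    have hA1 : 1 ≤ A := Real.one_le_rpow hn1 hγ.le
    have hZ1 : 1 ≤ Z := Real.one_le_rpow hn1 (by positivity)
    have hZ3 : Z ^ 3 = A := by
      rw [hZ, hA, ← Real.rpow_natCast, ← Real.rpow_mul hn0.le]; congr 1; push_cast; ring
    -- With `Z³ = A = n^γ` the error parameter B is exactly `(S / δ)²`; this is how a factor `1/δ²`
    -- in the error becomes `1/δ` in the final bound.
    have hB : Z ^ 3 * A = (S / δ) ^ 2 * (Real.sqrt n * δ ^ 2) := by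
      have h2 : (S / δ) ^ 2 * (Real.sqrt n * δ ^ 2) = S ^ 2 * Real.sqrt n := by
        field_simp
      rw [h2, hZ3, hA, hS, ← Real.rpow_add hn0, ← Real.rpow_natCast, ← Real.rpow_mul hn0.le,
        Real.sqrt_eq_rpow, ← Real.rpow_add hn0]
      congr 1; push_cast; ring
    have hq0 : 0 < S / δ := by positivity
    have hq1 : S / δ ≤ 1 := (le_mul_of_one_le_left hq0.le hC1').trans hsmall
    have hqq : (S / δ) ^ 2 ≤ S / δ := by rw [sq]; exact mul_le_of_le_one_left hq0.le hq1
    have hCB : C1 * (S / δ) ^ 2 ≤ 1 :=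
      (mul_le_mul_of_nonneg_left hqq (by linarith)).trans hsmall
    refine (integral_abs_gaussDensity_sub_smoothed_le h1 hgap (gap_le hgap.le)
      (fun i j hij => gap_le_sub hgap.le hij) hn hA1 hZ1 hB hCB hu hpos ζ).trans ?_
    have h3 := exp_neg_rpow_le hk hγ hn
    have h4 : Real.sqrt 2 ^ r * Real.exp (-(Z ^ 2 / 4)) ≤ C2 * (S / δ) := by
      calc Real.sqrt 2 ^ r * Real.exp (-(Z ^ 2 / 4))
          ≤ Real.sqrt 2 ^ r * (k.factorial * 4 ^ k * S) :=
            mul_le_mul_of_nonneg_left h3 (by positivity)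
        _ = C2 * S := by rw [hC2]; ring
        _ ≤ C2 * (S / δ) := mul_le_mul_of_nonneg_left hSδ hC2'.le
    have h5 : C1 * (S / δ) ^ 2 ≤ C1 * (S / δ) := mul_le_mul_of_nonneg_left hqq (by linarith)
    rw [mul_div_assoc]
    linarith
  · refine (integral_abs_gaussDensity_sub_smoothed_le_two h1 hμ hn hpos ζ).trans ?_
    push Not at hsmall
    have hq0 : 0 < C2 * (S / δ) := by positivity
    rw [mul_div_assoc]
    linarith

/-- The eigenvalues move by at most `(r + 1) n^(γ - 1/2)`, which tends to zero, while all of them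
start at or above the gap. -/
theorem localSpectrum_nonneg_of_large (r : ℕ) {γ : ℝ} (hγ : γ < 1 / 2) {δ : ℝ} (hδ : 0 < δ) :
    ∃ N : ℕ, ∀ n : ℕ, N ≤ n → ∀ μ : Fin (r + 1) → ℝ, δ ≤ gap μ →
      ∀ u : Fin r → ℝ, (∀ i, |u i| ≤ (n : ℝ) ^ γ) → ∀ i, 0 ≤ localSpectrum μ n u i := by
  have hlim : Filter.Tendsto (fun n : ℕ => ((r : ℝ) + 1) * (n : ℝ) ^ (-(1 / 2 - γ))) Filter.atTop
      (nhds (((r : ℝ) + 1) * 0)) :=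
    ((tendsto_rpow_neg_atTop (by linarith)).comp tendsto_natCast_atTop_atTop).const_mul _
  rw [mul_zero] at hlim
  obtain ⟨N, hN⟩ := Filter.eventually_atTop.mp (hlim.eventually (gt_mem_nhds hδ))
  refine ⟨N + 1, fun n hn μ hgap u hu i => ?_⟩
  have hn0 : (0 : ℝ) < n := by exact_mod_cast (show 0 < n by omega)
  have h1 := abs_localSpectrum_sub_le μ n u (Real.rpow_nonneg hn0.le γ) hu i
  have h2 : ((r : ℝ) + 1) * (n : ℝ) ^ γ / Real.sqrt n =
      ((r : ℝ) + 1) * (n : ℝ) ^ (-(1 / 2 - γ)) := by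
    rw [mul_div_assoc, Real.sqrt_eq_rpow, ← Real.rpow_sub hn0]; congr 2; ring
  rw [h2] at h1
  have h3 := hN n (by omega)
  have h4 := gap_le (hδ.le.trans hgap) i
  linarith [(abs_le.mp h1).1]

end

/-! ### The main theorem -/

theorem lemma6 (r : ℕ) (γ ε : ℝ) (hγ : 0 < γ) (hγ' : γ < 1 / 4) (hε : 0 < ε) :
    (∃ C : ℝ, 0 < C ∧
      ∀ μ : Fin (r + 1) → ℝ, ∑ i, μ i = 1 → 0 < gap μ →
      ∀ n : ℕ, 1 ≤ n →
      ∀ u : Fin r → ℝ, (∀ i, |u i| ≤ (n : ℝ) ^ γ) → (∀ i, 0 ≤ localSpectrum μ n u i) →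
      ∀ ζ : Fin (r + 1) → Fin (r + 1) → ℂ,
        eLpNorm (fun x : Fin r → ℝ => gaussDensity μ u x -
            ∑ l ∈ diagrams (r + 1) n, blockProb μ n u ζ l * tauDensity μ n l x) 1 volume
          ≤ ENNReal.ofReal
            (C * ((n : ℝ) ^ (-(1 / 2) + ε) + (n : ℝ) ^ (-(1 / 4) + γ)) / gap μ) ∧
        ∀ κ ∈ diagrams (r + 1) n,
          ∑ l ∈ diagrams (r + 1) n, |sigmaGauss μ n κ u l - blockProb μ n u ζ l|
            ≤ C * ((n : ℝ) ^ (-(1 / 2) + ε) + (n : ℝ) ^ (-(1 / 4) + γ)) / gap μ) ∧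
    (∀ δ : ℝ, 0 < δ → ∃ N : ℕ, ∀ n : ℕ, N ≤ n →
      ∀ μ : Fin (r + 1) → ℝ, ∑ i, μ i = 1 → δ ≤ gap μ →
      ∀ u : Fin r → ℝ, (∀ i, |u i| ≤ (n : ℝ) ^ γ) → ∀ i, 0 ≤ localSpectrum μ n u i) := by
  refine ⟨?_, fun δ hδ => ?_⟩
  · obtain ⟨C, hC, h⟩ := exists_L1_rate r hγ
    refine ⟨C, hC, fun μ h1 hgap n hn u hu hpos ζ => ?_⟩
    have hμ : ∀ i, 0 < μ i := fun i => hgap.trans_le (gap_le hgap.le i)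
    have hbound : ∫ x, |gaussDensity μ u x - smoothed μ n (blockProb μ n u ζ) x| ≤
        C * ((n : ℝ) ^ (-(1 / 2) + ε) + (n : ℝ) ^ (-(1 / 4) + γ)) / gap μ := by
      refine (h μ h1 hgap n hn u hu hpos ζ).trans ?_
      refine div_le_div_of_nonneg_right (mul_le_mul_of_nonneg_left ?_ hC.le) hgap.le
      -- The rate `n^(-1/4+γ)` already bounds the distance; the other term is nonnegative and is
      -- merely added.
      exact le_add_of_nonneg_left (Real.rpow_nonneg (Nat.cast_nonneg n) _)
    refine ⟨?_, fun κ _ => (sum_abs_sigmaGauss_sub_le h1 hμ hn u _).trans hbound⟩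
    have hint : Integrable fun x => gaussDensity μ u x - smoothed μ n (blockProb μ n u ζ) x :=
      (integrable_gaussDensity hμ h1 u).sub (integrable_smoothed μ hn _)
    rw [eLpNorm_one_eq_lintegral_enorm]
    refine le_trans (le_of_eq ?_) (ENNReal.ofReal_le_ofReal hbound)
    exact (ofReal_integral_norm_eq_lintegral_enorm hint).symm
  · obtain ⟨N, hN⟩ := localSpectrum_nonneg_of_large r (γ := γ) (by linarith) hδ
    exact ⟨N, fun n hn μ _ hgap => hN n hn μ hgap⟩
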